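/- **Formal systems.** Finite types are generated from the ground types $0$ (natural numbers) and $X$ (an abstract space) by function types $\tau(\rho)$; $1:=0(0)$. The system $\mathcal{A}^\omega=\mathrm{WE}\text{-}\mathrm{PA}^\omega+\mathrm{QF}\text{-}\mathrm{AC}+\mathrm{DC}$, formulated over all these types, is classical many-sorted predicate logic with equality $=_0$ as the only primitive relation, the Peano axioms with full induction, the defining equations of the combinators $\Pi,\Sigma$ and of the simultaneous primitive recursors in all types, the quantifier-free rule of extensionality (from $A_0\to s=_\rho t$ infer $A_0\to r[s]=_\tau r[t]$ for quantifier-free $A_0$), quantifier-free choice and dependent choice for tuples of all types. Real numbers are represented by objects of type $1$ (sequences of codes of rationals with fixed Cauchy rate $2^{-n}$), with closed terms for the arithmetical operations and defined relations $=_\mathbb{R},<_\mathbb{R},\le_\mathbb{R}$; $(\gamma)^{-1}_l$ is a closed term representing $\gamma^{-1}$ whenever $|\gamma|>_\mathbb{R}2^{-l}$. A statement of the form "$\gamma>_\mathbb{R}0\wedge\dots\to\dots\gamma^{-1}\dots$" abbreviates "for all $l^0$: $\gamma>_\mathbb{R}2^{-l}\wedge\dots\to\dots(\gamma)^{-1}_l\dots$".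 $\mathcal{A}^\omega[X,\langle\cdot,\cdot\rangle]$ adds constants $0_X,1_X,+_X,-_X,\cdot_X,\|\cdot\|_X$ with the axioms of a real normed space (including those making the operations extensional), $\|1_X\|_X=_\mathbb{R}1$, and the parallelogram law. Here $x=_Xy$ means $\|x-_Xy\|_X=_\mathbb{R}0$, equality at higher types is pointwise, and $\langle x,y\rangle_X:=\frac14(\|x+_Xy\|_X^2-\|x-_Xy\|_X^2)$. The system $\mathcal{U}^\omega$ further adds constants $\chi_A$ of type $0(X)(X)$, $J^{A}$ of type $X(X)(1)$ (written $J^A_\gamma x$), $c_X$ of type $X$, $\tilde\rho,\tilde\gamma$ of type $1$ and $m_{\tilde\gamma},n_{\tilde\gamma}$ of type $0$, writes $y\in Ax$ for $\chi_Axy=_00$, and adds the axioms * (I) $\forall x^X,y^X(\chi_Axy\le_01)$; * (II) $\forall\gamma^1,x^X\big(\gamma>_\mathbb{R}0\to\gamma^{-1}(x-_XJ^A_\gamma x)\in A(J^A_\gamma x)\big)$; * (III) $\forall x^X,y^X,u^X,v^X\big(u\in Ax\wedge v\in Ay\to\langle x-_Xy,u-_Xv\rangle_X\ge_\mathbb{R}\tilde\rho\,\|u-_Xv\|_X^2\big)$;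 * (IV) $\tilde\gamma\ge_\mathbb{R}2^{-m_{\tilde\gamma}}$; * (V) $\tilde\rho\ge_\mathbb{R}-\tilde\gamma+2^{-n_{\tilde\gamma}}$. The system $\mathcal{U}^{*\omega}$ is obtained from $\mathcal{U}^\omega$ by replacing (II) by $\forall\gamma^1,x^X\big(\tilde\rho>_\mathbb{R}-\gamma/2\wedge\gamma>_\mathbb{R}0\to\gamma^{-1}(x-_XJ^A_\gamma x)\in A(J^A_\gamma x)\big)$ and (V) by $\tilde\rho\ge_\mathbb{R}-\tilde\gamma/2+2^{-n_{\tilde\gamma}}$. **Theorem.** $\mathcal{U}^\omega$ proves that the following four statements are pairwise equivalent (that is, it proves every implication between any two of them): 1. Extensionality of $A$: $\forall x^X,y^X,x'^X,y'^X\big(x=_Xx'\wedge y=_Xy'\to\chi_Axy=_0\chi_Ax'y'\big)$. 2. The strong resolvent axiom for $\tilde\rho>-\gamma$: $\forall\gamma^1,x^X,p^X\big(\gamma>_\mathbb{R}0\wedge\tilde\rho>_\mathbb{R}-\gamma\wedge p=_XJ^A_\gamma x\to\gamma^{-1}(x-_Xp)\in Ap\big)$. 3. Maximal $\tilde\rho$-comonotonicity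 of $A$: $\forall x^X,u^X\big(\forall y^X,v^X\big(v\in Ay\to\langle x-_Xy,u-_Xv\rangle_X\ge_\mathbb{R}\tilde\rho\,\|u-_Xv\|_X^2\big)\to u\in Ax\big)$. 4. Closedness of the graph of $A$: $\forall x^X,y^X,x_{(\cdot)}^{X(0)},y_{(\cdot)}^{X(0)}\big(x_n\to_Xx\wedge y_n\to_Xy\wedge\forall n^0(y_n\in Ax_n)\to y\in Ax\big)$, where $x_n\to_Xx$ is $\forall k^0\exists N^0\forall m\ge_0N(\|x_m-_Xx\|_X\le_\mathbb{R}2^{-k})$. Moreover, $\mathcal{U}^{*\omega}$ proves the pairwise equivalence of (1), (3), (4) and of (2) with the condition $\tilde\rho>_\mathbb{R}-\gamma/2$ in place of $\tilde\rho>_\mathbb{R}-\gamma$. -/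

import Mathlib

namespace Comon

/-! ## Types, variables and terms of the finite-type language over the abstract type `X` -/

/-- The finite types `T^X` over the ground types `0` (`nat`) and `X` (`abs`).
`σ⇒τ` is the type of functions from `σ` to `τ`, written `τ(σ)` in the proof mining literature. -/
inductive Ty : Type
  | nat : Ty
  | abs : Ty
  | fn : Ty → Ty → Ty

infixr:60 "⇒" => Ty.fn

abbrev N : Ty := Ty.nat
abbrev X : Ty := Ty.abs

/-- The type `1 = 0(0)`, whose objects represent real numbers. -/
abbrev R1 : Ty := N⇒N

/-- A context lists the types of the free variables (de Bruijn indices, most recent first). -/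
abbrev Ctx := List Ty

/-- Typed de Bruijn variables; also used as typed positions in a tuple of types. -/
inductive Var : Ctx → Ty → Type
  | z {Γ : Ctx} {τ : Ty} : Var (τ :: Γ) τ
  | s {Γ : Ctx} {σ τ : Ty} : Var Γ τ → Var (σ :: Γ) τ

/-- `tele F [ρ₁,…,ρₖ] τ = F ρ₁ ⇒ … ⇒ F ρₖ ⇒ τ`. -/
def tele (F : Ty → Ty) : List Ty → Ty → Ty
  | [], τ => τ
  | ρ :: ρs, τ => F ρ⇒tele F ρs τ

/-- The constants. `pi`, `sigma` are the combinators; `recur ρs i` is the `i`-th simultaneous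
recursor for the tuple of types `ρs`. Then come the constants for the normed space, and
`chi` (the characteristic function of the graph of `A`), `res` (`J^{χ_A}`), and the constants
`γ̃`, `m_γ̃`, `c_X`, `ρ̃`, `n_γ̃`. -/
inductive Con : Ty → Type
  | zero : Con N
  | succ : Con (N⇒N)
  | pi (ρ τ : Ty) : Con (ρ⇒τ⇒ρ)
  | sigma (δ ρ τ : Ty) : Con ((δ⇒ρ⇒τ)⇒(δ⇒ρ)⇒δ⇒τ)
  | recur (ρs : List Ty) {τ : Ty} (i : Var ρs τ) :
      Con (N⇒tele id ρs (tele (fun ρ => tele id ρs (N⇒ρ)) ρs τ))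
  | zeroX : Con X
  | oneX : Con X
  | plusX : Con (X⇒X⇒X)
  | minusX : Con (X⇒X)
  | scalX : Con (R1⇒X⇒X)
  | normX : Con (X⇒R1)
  | chi : Con (X⇒X⇒N)
  | res : Con (R1⇒X⇒X)
  | gam : Con R1
  | mgam : Con N
  | anchor : Con X
  | rho : Con R1
  | ngam : Con N

/-- Terms are built from variables and constants by application only. -/
inductive Tm : Ctx → Ty → Type
  | var {Γ : Ctx} {τ : Ty} : Var Γ τ → Tm Γ τ
  | con {Γ : Ctx} {τ : Ty} : Con τ → Tm Γ τ
  | app {Γ : Ctx} {σ τ : Ty} : Tm Γ (σ⇒τ) → Tm Γ σ → Tm Γ τ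

infixl:100 "⬝" => Tm.app

/-- Formulas: the only prime formulas are equations of type `0`. -/
inductive Fm : Ctx → Type
  | eq {Γ : Ctx} : Tm Γ N → Tm Γ N → Fm Γ
  | and {Γ : Ctx} : Fm Γ → Fm Γ → Fm Γ
  | or {Γ : Ctx} : Fm Γ → Fm Γ → Fm Γ
  | imp {Γ : Ctx} : Fm Γ → Fm Γ → Fm Γ
  | all {Γ : Ctx} (τ : Ty) : Fm (τ :: Γ) → Fm Γ
  | ex {Γ : Ctx} (τ : Ty) : Fm (τ :: Γ) → Fm Γ

/-- Quantifier-free formulas. -/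
def Fm.QF : {Γ : Ctx} → Fm Γ → Prop
  | _, .eq _ _ => True
  | _, .and φ ψ => φ.QF ∧ ψ.QF
  | _, .or φ ψ => φ.QF ∧ ψ.QF
  | _, .imp φ ψ => φ.QF ∧ ψ.QF
  | _, .all _ _ => False
  | _, .ex _ _ => False

/-! ## Renaming and substitution -/

abbrev Ren (Γ Δ : Ctx) := ∀ τ : Ty, Var Γ τ → Var Δ τ
abbrev Sub (Γ Δ : Ctx) := ∀ τ : Ty, Var Γ τ → Tm Δ τ

def Ren.nil {Γ : Ctx} : Ren [] Γ := fun _ v => nomatch v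

def Ren.lift {Γ Δ : Ctx} (r : Ren Γ Δ) (σ : Ty) : Ren (σ :: Γ) (σ :: Δ)
  | _, .z => .z
  | _, .s v => .s (r _ v)

def Tm.rename {Γ Δ : Ctx} (r : Ren Γ Δ) : {τ : Ty} → Tm Γ τ → Tm Δ τ
  | _, .var v => .var (r _ v)
  | _, .con c => .con c
  | _, .app f a => .app (f.rename r) (a.rename r)

def Tm.wk {Γ : Ctx} {σ τ : Ty} (t : Tm Γ τ) : Tm (σ :: Γ) τ := t.rename (fun _ v => .s v)

/-- A closed term, used in an arbitrary context. -/
def Tm.emb {Γ : Ctx} {τ : Ty} (t : Tm [] τ) : Tm Γ τ := t.rename Ren.nil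

def Fm.rename : {Γ Δ : Ctx} → Ren Γ Δ → Fm Γ → Fm Δ
  | _, _, r, .eq a b => .eq (a.rename r) (b.rename r)
  | _, _, r, .and φ ψ => .and (φ.rename r) (ψ.rename r)
  | _, _, r, .or φ ψ => .or (φ.rename r) (ψ.rename r)
  | _, _, r, .imp φ ψ => .imp (φ.rename r) (ψ.rename r)
  | _, _, r, .all τ φ => .all τ (φ.rename (r.lift τ))
  | _, _, r, .ex τ φ => .ex τ (φ.rename (r.lift τ))

def Fm.wk {Γ : Ctx} {σ : Ty} (φ : Fm Γ) : Fm (σ :: Γ) := φ.rename (fun _ v => .s v)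

/-- A sentence, used in an arbitrary context. -/
def Fm.emb {Γ : Ctx} (φ : Fm []) : Fm Γ := φ.rename Ren.nil

def Sub.lift {Γ Δ : Ctx} (s : Sub Γ Δ) (σ : Ty) : Sub (σ :: Γ) (σ :: Δ)
  | _, .z => .var .z
  | _, .s v => (s _ v).wk

def Tm.subst {Γ Δ : Ctx} (s : Sub Γ Δ) : {τ : Ty} → Tm Γ τ → Tm Δ τ
  | _, .var v => s _ v
  | _, .con c => .con c
  | _, .app f a => .app (f.subst s) (a.subst s)

def Fm.subst : {Γ Δ : Ctx} → Sub Γ Δ → Fm Γ → Fm Δ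
  | _, _, s, .eq a b => .eq (a.subst s) (b.subst s)
  | _, _, s, .and φ ψ => .and (φ.subst s) (ψ.subst s)
  | _, _, s, .or φ ψ => .or (φ.subst s) (ψ.subst s)
  | _, _, s, .imp φ ψ => .imp (φ.subst s) (ψ.subst s)
  | _, _, s, .all τ φ => .all τ (φ.subst (s.lift τ))
  | _, _, s, .ex τ φ => .ex τ (φ.subst (s.lift τ))

/-- The substitution of `t` for the most recent variable. -/
def Sub.one {Γ : Ctx} {σ : Ty} (t : Tm Γ σ) : Sub (σ :: Γ) Γ
  | _, .z => t
  | _, .s v => .var v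

def Tm.inst {Γ : Ctx} {σ τ : Ty} (r : Tm (σ :: Γ) τ) (t : Tm Γ σ) : Tm Γ τ := r.subst (Sub.one t)
def Fm.inst {Γ : Ctx} {σ : Ty} (φ : Fm (σ :: Γ)) (t : Tm Γ σ) : Fm Γ := φ.subst (Sub.one t)

/-! ## Abbreviations: variables, numerals, λ-abstraction, recursion -/

section Abbreviations
variable {Γ : Ctx}

abbrev v0 {σ : Ty} : Tm (σ :: Γ) σ := .var .z
abbrev v1 {σ a : Ty} : Tm (a :: σ :: Γ) σ := .var (.s .z)
abbrev v2 {σ a b : Ty} : Tm (a :: b :: σ :: Γ) σ := .var (.s (.s .z))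
abbrev v3 {σ a b c : Ty} : Tm (a :: b :: c :: σ :: Γ) σ := .var (.s (.s (.s .z)))

abbrev O : Tm Γ N := .con .zero
abbrev S (t : Tm Γ N) : Tm Γ N := (.con .succ)⬝t

/-- Numerals. -/
def num : ℕ → Tm Γ N
  | 0 => O
  | n + 1 => S (num n)

/-- Bracket abstraction, given the abstraction of each variable. -/
def lamWith {Γ' : Ctx} {σ : Ty} (h : ∀ ρ, Var Γ' ρ → Tm Γ (σ⇒ρ)) : {τ : Ty} → Tm Γ' τ → Tm Γ (σ⇒τ)
  | _, .var v => h _ v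
  | τ, .con c => (.con (.pi τ σ))⬝(.con c)
  | τ, .app (σ := ρ) f a => (.con (.sigma σ ρ τ))⬝(lamWith h f)⬝(lamWith h a)

/-- `λx.x = Σ Π Π`, and `λx.y = Π y` for a variable `y` other than `x`. -/
def lamVar (σ : Ty) : ∀ ρ, Var (σ :: Γ) ρ → Tm Γ (σ⇒ρ)
  | _, .z => (.con (.sigma σ (σ⇒σ) σ))⬝(.con (.pi σ (σ⇒σ)))⬝(.con (.pi σ σ))
  | ρ, .s v => (.con (.pi ρ σ))⬝(.var v)

/-- λ-abstraction over the most recent variable, defined through the combinators. -/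
def lam {σ τ : Ty} (t : Tm (σ :: Γ) τ) : Tm Γ (σ⇒τ) := lamWith (lamVar σ) t

/-- Application of a term to a tuple of terms. -/
def apps (F : Ty → Ty) : (ρs : List Ty) → {τ : Ty} → Tm Γ (tele F ρs τ) →
    (∀ σ, Var ρs σ → Tm Γ (F σ)) → Tm Γ τ
  | [], _, t, _ => t
  | _ :: ρs, _, t, a => apps F ρs (Tm.app t (a _ .z)) (fun σ v => a σ (.s v))

/-- `(R_i) x y̲ z̲` for the simultaneous recursors. -/
def recApp {ρs : List Ty} {τ : Ty} (i : Var ρs τ) (x : Tm Γ N) (y : ∀ σ, Var ρs σ → Tm Γ σ)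
    (z : ∀ σ, Var ρs σ → Tm Γ (tele id ρs (N⇒σ))) : Tm Γ τ :=
  apps (fun ρ => tele id ρs (N⇒ρ)) ρs (apps id ρs ((.con (.recur ρs i))⬝x) y) z

/-- Ordinary recursion of type `0`: value `a` at `0`, and `f (value at c) c` at `S c`. -/
def recN (x a : Tm Γ N) (f : Tm Γ (N⇒N⇒N)) : Tm Γ N := (.con (.recur [N] .z))⬝x⬝a⬝f

/-! ## Primitive recursive arithmetic as closed terms -/

def tPred : Tm [] (N⇒N) := lam (recN v0 O (lam (lam v0)))
abbrev pred (a : Tm Γ N) : Tm Γ N := tPred.emb⬝a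

def tPlus : Tm [] (N⇒N⇒N) := lam (lam (recN v0 v1 (lam (lam (S v1)))))
abbrev plus (a b : Tm Γ N) : Tm Γ N := tPlus.emb⬝a⬝b

def tTimes : Tm [] (N⇒N⇒N) := lam (lam (recN v0 O (lam (lam (plus v1 v3)))))
abbrev times (a b : Tm Γ N) : Tm Γ N := tTimes.emb⬝a⬝b

/-- Truncated subtraction. -/
def tMonus : Tm [] (N⇒N⇒N) := lam (lam (recN v0 v1 (lam (lam (pred v1)))))
abbrev monus (a b : Tm Γ N) : Tm Γ N := tMonus.emb⬝a⬝b

/-- `2 ^ n`. -/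
def tPow : Tm [] (N⇒N) := lam (recN v0 (S O) (lam (lam (plus v1 v1))))
abbrev pow (a : Tm Γ N) : Tm Γ N := tPow.emb⬝a

/-- `cond c a b` is `a` if `c = 0` and `b` otherwise. -/
def tCond : Tm [] (N⇒N⇒N⇒N) := lam (lam (lam (recN v2 v1 (lam (lam v2)))))
abbrev cond (c a b : Tm Γ N) : Tm Γ N := tCond.emb⬝c⬝a⬝b

/-- The remainder modulo `2`. -/
def tPar : Tm [] (N⇒N) := lam (recN v0 O (lam (lam (monus (S O) v1))))
abbrev par (a : Tm Γ N) : Tm Γ N := tPar.emb⬝a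

/-- The integer part of the half. -/
def tHalf : Tm [] (N⇒N) := lam (recN v0 O (lam (lam (plus v1 (par v0)))))
abbrev half (a : Tm Γ N) : Tm Γ N := tHalf.emb⬝a

/-- `|a - b|`. -/
def tDist : Tm [] (N⇒N⇒N) := lam (lam (plus (monus v1 v0) (monus v0 v1)))
abbrev dist (a b : Tm Γ N) : Tm Γ N := tDist.emb⬝a⬝b

/-- `least f b` is the least `u < b` with `f u = 0` if there is one, and `b` otherwise. -/
def tLeast : Tm [] ((N⇒N)⇒N⇒N) :=
  lam (lam (recN v0 O (lam (lam (cond (v3⬝v1) v1 (S v0))))))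
abbrev least (f : Tm Γ (N⇒N)) (b : Tm Γ N) : Tm Γ N := tLeast.emb⬝f⬝b

/-- `bmin f b` is the least `u ≤ b` with `f u = 0` if there is one, and `0` otherwise. -/
def tBmin : Tm [] ((N⇒N)⇒N⇒N) :=
  lam (lam (cond (v1⬝(least v1 v0)) (least v1 v0) O))
abbrev bmin (f : Tm Γ (N⇒N)) (b : Tm Γ N) : Tm Γ N := tBmin.emb⬝f⬝b

/-- `(n + m)² + 3n + m`. -/
def tJB : Tm [] (N⇒N⇒N) :=
  lam (lam (plus (plus (times (plus v1 v0) (plus v1 v0)) (times (num 3) v1)) v0))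

/-- The pairing `j(n,m)`: the least `u ≤ (n+m)²+3n+m` with `2u = (n+m)²+3n+m`, else `0`. -/
def tJ : Tm [] (N⇒N⇒N) :=
  lam (lam (bmin (lam (dist (times (num 2) v0) (tJB.emb⬝v2⬝v1))) (tJB.emb⬝v1⬝v0)))
abbrev pair (n m : Tm Γ N) : Tm Γ N := tJ.emb⬝n⬝m

/-- First projection: the least `x ≤ w` such that `j(x,y) = w` for some `y ≤ w`. -/
def tFst : Tm [] (N⇒N) :=
  lam (bmin (lam (dist (pair v0 (bmin (lam (dist (pair v1 v0) v2)) v1)) v1)) v0)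
abbrev fst (a : Tm Γ N) : Tm Γ N := tFst.emb⬝a

/-- Second projection: the least `y ≤ w` such that `j(x,y) = w` for some `x ≤ w`. -/
def tSnd : Tm [] (N⇒N) :=
  lam (bmin (lam (dist (pair (bmin (lam (dist (pair v0 v1) v2)) v1) v0) v1)) v0)
abbrev snd (a : Tm Γ N) : Tm Γ N := tSnd.emb⬝a

/-! ## Rational numbers

The number `j(n,m)` codes `(n/2)/(m+1)` for even `n` and `-((n+1)/2)/(m+1)` for odd `n`. -/

/-- Positive part of the numerator. -/
def tPos : Tm [] (N⇒N) := lam (cond (par (fst v0)) (half (fst v0)) O)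
abbrev posQ (a : Tm Γ N) : Tm Γ N := tPos.emb⬝a

/-- Negative part of the numerator. -/
def tNeg : Tm [] (N⇒N) := lam (cond (par (fst v0)) O (S (half (fst v0))))
abbrev negpQ (a : Tm Γ N) : Tm Γ N := tNeg.emb⬝a

/-- Denominator. -/
def tDen : Tm [] (N⇒N) := lam (S (snd v0))
abbrev denQ (a : Tm Γ N) : Tm Γ N := tDen.emb⬝a

/-- A code of `(p - q) / d`, for `d > 0`. -/
def tMk : Tm [] (N⇒N⇒N⇒N) :=
  lam (lam (lam (pair (plus (times (num 2) (monus v2 v1)) (pred (times (num 2) (monus v1 v2))))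
    (pred v0))))
abbrev mkQ (p q d : Tm Γ N) : Tm Γ N := tMk.emb⬝p⬝q⬝d

def tPlusQ : Tm [] (N⇒N⇒N) :=
  lam (lam (mkQ (plus (times (posQ v1) (denQ v0)) (times (posQ v0) (denQ v1)))
    (plus (times (negpQ v1) (denQ v0)) (times (negpQ v0) (denQ v1)))
    (times (denQ v1) (denQ v0))))
abbrev plusQ (a b : Tm Γ N) : Tm Γ N := tPlusQ.emb⬝a⬝b

def tTimesQ : Tm [] (N⇒N⇒N) :=
  lam (lam (mkQ (plus (times (posQ v1) (posQ v0)) (times (negpQ v1) (negpQ v0)))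
    (plus (times (posQ v1) (negpQ v0)) (times (negpQ v1) (posQ v0)))
    (times (denQ v1) (denQ v0))))
abbrev timesQ (a b : Tm Γ N) : Tm Γ N := tTimesQ.emb⬝a⬝b

def tMinusQ : Tm [] (N⇒N) := lam (mkQ (negpQ v0) (posQ v0) (denQ v0))
abbrev minusQ (a : Tm Γ N) : Tm Γ N := tMinusQ.emb⬝a

def tAbsQ : Tm [] (N⇒N) := lam (mkQ (plus (posQ v0) (negpQ v0)) O (denQ v0))
abbrev absQ (a : Tm Γ N) : Tm Γ N := tAbsQ.emb⬝a

/-- The reciprocal of a rational number (a code of `0` for argument `0`). -/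
def tInvQ : Tm [] (N⇒N) :=
  lam (cond (posQ v0)
    (cond (negpQ v0) (pair O O) (mkQ O (denQ v0) (negpQ v0)))
    (mkQ (denQ v0) O (posQ v0)))
abbrev invQ (a : Tm Γ N) : Tm Γ N := tInvQ.emb⬝a

/-- The value is `0` if and only if `a <_ℚ b`. -/
def tLtQ : Tm [] (N⇒N⇒N) :=
  lam (lam (monus (S (plus (times (posQ v1) (denQ v0)) (times (negpQ v0) (denQ v1))))
    (plus (times (posQ v0) (denQ v1)) (times (negpQ v1) (denQ v0)))))
abbrev ltTmQ (a b : Tm Γ N) : Tm Γ N := tLtQ.emb⬝a⬝b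

/-- The code `j(2, 2ⁿ - 1)` of `2⁻ⁿ`. -/
def tTwoNeg : Tm [] (N⇒N) := lam (pair (num 2) (pred (pow v0)))
abbrev twoNeg (a : Tm Γ N) : Tm Γ N := tTwoNeg.emb⬝a

/-! ## Real numbers

A real number is given by a sequence `f` of codes of rationals with `|f k - f (k+1)| < 2^{-k-1}`;
`hat` turns an arbitrary `f` into such a sequence. -/

/-- `f̂ n = f n` if `|f k - f (k+1)| < 2^{-k-1}` for all `k < n`; otherwise `f̂ n = f k` for the
least `k < n` that violates this. -/
def tHat : Tm [] (R1⇒R1) :=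
  lam (lam (v1⬝(least (lam (monus (S O)
    (ltTmQ (absQ (plusQ (v2⬝v0) (minusQ (v2⬝(S v0))))) (twoNeg (S v0))))) v0)))
abbrev hat (f : Tm Γ R1) (n : Tm Γ N) : Tm Γ N := tHat.emb⬝f⬝n

/-- A rational number as a real number: the constant sequence. -/
def tRat : Tm [] (N⇒R1) := lam (lam v1)
abbrev ratR (q : Tm Γ N) : Tm Γ R1 := tRat.emb⬝q

abbrev zeroR : Tm Γ R1 := ratR (pair O O)
abbrev oneR : Tm Γ R1 := ratR (pair (num 2) O)
/-- The real number `2⁻ⁿ`. -/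
abbrev twoNegR (n : Tm Γ N) : Tm Γ R1 := ratR (twoNeg n)

def tPlusR : Tm [] (R1⇒R1⇒R1) := lam (lam (lam (plusQ (hat v2 (S v0)) (hat v1 (S v0)))))
abbrev plusR (f g : Tm Γ R1) : Tm Γ R1 := tPlusR.emb⬝f⬝g

def tMinusR : Tm [] (R1⇒R1) := lam (lam (minusQ (hat v1 v0)))
abbrev minusR (f : Tm Γ R1) : Tm Γ R1 := tMinusR.emb⬝f
abbrev subR (f g : Tm Γ R1) : Tm Γ R1 := plusR f (minusR g)

def tAbsR : Tm [] (R1⇒R1) := lam (lam (absQ (hat v1 v0)))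
abbrev absR (f : Tm Γ R1) : Tm Γ R1 := tAbsR.emb⬝f

/-- A natural number that bounds all `|f̂ n|`. -/
def tBd : Tm [] (R1⇒N) := lam (S (plus (posQ (v0⬝O)) (negpQ (v0⬝O))))
abbrev bd (f : Tm Γ R1) : Tm Γ N := tBd.emb⬝f

def tTimesR : Tm [] (R1⇒R1⇒R1) :=
  lam (lam (lam (timesQ (hat v2 (plus v0 (plus (bd v2) (bd v1))))
    (hat v1 (plus v0 (plus (bd v2) (bd v1)))))))
abbrev timesR (f g : Tm Γ R1) : Tm Γ R1 := tTimesR.emb⬝f⬝g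

/-- `(f)⁻¹_l`, which represents the reciprocal of `f` whenever `|f| > 2^{-l}`. -/
def tInvR : Tm [] (N⇒R1⇒R1) :=
  lam (lam (lam (invQ (hat v1 (plus v0 (plus (times (num 2) v2) (num 2)))))))
abbrev invR (l : Tm Γ N) (f : Tm Γ R1) : Tm Γ R1 := tInvR.emb⬝l⬝f

/-! ## Defined formulas -/

abbrev falsum : Fm Γ := .eq O (S O)
abbrev neg (φ : Fm Γ) : Fm Γ := φ.imp falsum

/-- `a ≤₀ b`. -/
abbrev leN (a b : Tm Γ N) : Fm Γ := .eq (monus a b) O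
/-- `a <_ℚ b`. -/
abbrev ltQ (a b : Tm Γ N) : Fm Γ := .eq (ltTmQ a b) O

/-- `f =_ℝ g`: `∀ n, |f̂(n+1) - ĝ(n+1)| < 2^{-n}`. -/
def eqR (f g : Tm Γ R1) : Fm Γ :=
  .all N (ltQ (absQ (plusQ (hat f.wk (S v0)) (minusQ (hat g.wk (S v0))))) (twoNeg v0))

/-- `f <_ℝ g`: `∃ n, ĝ(n+1) - f̂(n+1) ≥ 2^{-n}`. -/
def ltR (f g : Tm Γ R1) : Fm Γ :=
  .ex N (neg (ltQ (plusQ (hat g.wk (S v0)) (minusQ (hat f.wk (S v0)))) (twoNeg v0)))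

/-- `f ≤_ℝ g`. -/
def leR (f g : Tm Γ R1) : Fm Γ := neg (ltR g f)

abbrev zeroX : Tm Γ X := .con .zeroX
abbrev oneX : Tm Γ X := .con .oneX
abbrev plusX (x y : Tm Γ X) : Tm Γ X := (.con .plusX)⬝x⬝y
abbrev minusX (x : Tm Γ X) : Tm Γ X := (.con .minusX)⬝x
abbrev subX (x y : Tm Γ X) : Tm Γ X := plusX x (minusX y)
abbrev scalX (a : Tm Γ R1) (x : Tm Γ X) : Tm Γ X := (.con .scalX)⬝a⬝x
abbrev normX (x : Tm Γ X) : Tm Γ R1 := (.con .normX)⬝x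
abbrev sqNorm (x : Tm Γ X) : Tm Γ R1 := timesR (normX x) (normX x)

/-- `⟨x, y⟩ := ¼ (‖x + y‖² - ‖x - y‖²)`. -/
def innerX (x y : Tm Γ X) : Tm Γ R1 :=
  timesR (twoNegR (num 2)) (subR (sqNorm (plusX x y)) (sqNorm (subX x y)))

/-- `x =_X y`: `‖x - y‖ =_ℝ 0`. -/
def eqX (x y : Tm Γ X) : Fm Γ := eqR (normX (subX x y)) zeroR

/-- Equality at all types: pointwise, down to `=₀` and `=_X`. -/
def eqT : {Γ : Ctx} → (τ : Ty) → Tm Γ τ → Tm Γ τ → Fm Γ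
  | _, .nat, s, t => .eq s t
  | _, .abs, s, t => eqX s t
  | _, .fn σ τ, s, t => .all σ (eqT τ (s.wk⬝v0) (t.wk⬝v0))

end Abbreviations

/-! ## Tuples of quantifiers, and the schemata of choice -/

def allL {Γ : Ctx} : (ρs : List Ty) → Fm (ρs ++ Γ) → Fm Γ
  | [], φ => φ
  | ρ :: ρs, φ => allL ρs (.all ρ φ)

def exL {Γ : Ctx} : (ρs : List Ty) → Fm (ρs ++ Γ) → Fm Γ
  | [], φ => φ
  | ρ :: ρs, φ => exL ρs (.ex ρ φ)

def Var.inl {Γ : Ctx} : {Δ : Ctx} → {τ : Ty} → Var Δ τ → Var (Δ ++ Γ) τ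
  | _, _, .z => .z
  | _, _, .s v => .s v.inl

def Var.inr {Γ : Ctx} {τ : Ty} : (Δ : Ctx) → Var Γ τ → Var (Δ ++ Γ) τ
  | [], v => v
  | _ :: Δ, v => .s (Var.inr Δ v)

/-- Case distinction on a variable of a concatenated context. -/
def Var.split {Γ : Ctx} {τ : Ty} : (Δ : Ctx) → Var (Δ ++ Γ) τ → Var Δ τ ⊕ Var Γ τ
  | [], v => .inr v
  | _ :: _, .z => .inl .z
  | _ :: Δ, .s v => (Var.split Δ v).map Var.s id

def Var.mapTy (F : Ty → Ty) : {Δ : Ctx} → {τ : Ty} → Var Δ τ → Var (Δ.map F) (F τ)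
  | _, _, .z => .z
  | _, _, .s v => .s (v.mapTy F)

/-- From `A(x̲, y̲)` to `A(x̲, Y̲ x̲)`. -/
def acSub (Γ : Ctx) (xs ys : List Ty) :
    Sub (ys ++ (xs ++ Γ)) (xs ++ (ys.map (tele id xs) ++ Γ)) := fun _ v =>
  match Var.split ys v with
  | .inl y => apps id xs (.var (.inr xs (.inl (y.mapTy (tele id xs))))) (fun _ x => .var x.inl)
  | .inr w =>
    match Var.split xs w with
    | .inl x => .var x.inl
    | .inr g => .var (.inr xs (.inr _ g))

/-- `∀ x̲ ∃ y̲ A(x̲, y̲) → ∃ Y̲ ∀ x̲ A(x̲, Y̲ x̲)`. -/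
def acFm {Γ : Ctx} (xs ys : List Ty) (A : Fm (ys ++ (xs ++ Γ))) : Fm Γ :=
  (allL xs (exL ys A)).imp
    (exL (ys.map (tele id xs)) (allL xs (A.subst (acSub Γ xs ys))))

/-- From `A(x, y̲, z̲)` to `A(x, f̲ x, f̲ (S x))`. -/
def dcSub (Γ : Ctx) (ρs : List Ty) :
    Sub (ρs ++ (ρs ++ (N :: Γ))) (N :: (ρs.map (fun ρ => N⇒ρ) ++ Γ)) := fun _ v =>
  match Var.split ρs v with
  | .inl i => (.var (.s (.inl (i.mapTy (fun ρ => N⇒ρ)))))⬝(S v0)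
  | .inr w =>
    match Var.split ρs w with
    | .inl i => (.var (.s (.inl (i.mapTy (fun ρ => N⇒ρ)))))⬝v0
    | .inr .z => v0
    | .inr (.s g) => .var (.s (.inr _ g))

/-- `∀ x⁰, y̲ ∃ z̲ A(x, y̲, z̲) → ∃ f̲ ∀ x⁰ A(x, f̲ x, f̲ (S x))`. -/
def dcFm {Γ : Ctx} (ρs : List Ty) (A : Fm (ρs ++ (ρs ++ (N :: Γ)))) : Fm Γ :=
  (Fm.all N (allL ρs (exL ρs A))).imp
    (exL (ρs.map (fun ρ => N⇒ρ)) (.all N (A.subst (dcSub Γ ρs))))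

/-- The substitution of `S x` for the most recent variable `x`. -/
def Sub.succ (Γ : Ctx) : Sub (N :: Γ) (N :: Γ)
  | _, .z => S v0
  | _, .s v => .var (.s v)

/-! ## Derivability

`Prv T Γ Δ φ`: from the assumptions `Δ`, with free variables in `Γ`, the formula `φ` is derivable
in `A^ω = WE-PA^ω + QF-AC + DC` (over the types `T^X`) extended by the sentences in `T` as axioms.
This is natural deduction for many-sorted classical logic; the quantifier-free rule of
extensionality may be applied only to premises derived without assumptions. -/
inductive Prv (T : Set (Fm [])) : (Γ : Ctx) → List (Fm Γ) → Fm Γ → Prop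
  /- classical predicate logic -/
  | hyp {Γ Δ} {φ : Fm Γ} : φ ∈ Δ → Prv T Γ Δ φ
  | andI {Γ Δ} {φ ψ : Fm Γ} : Prv T Γ Δ φ → Prv T Γ Δ ψ → Prv T Γ Δ (φ.and ψ)
  | andL {Γ Δ} {φ ψ : Fm Γ} : Prv T Γ Δ (φ.and ψ) → Prv T Γ Δ φ
  | andR {Γ Δ} {φ ψ : Fm Γ} : Prv T Γ Δ (φ.and ψ) → Prv T Γ Δ ψ
  | orL {Γ Δ} {φ ψ : Fm Γ} : Prv T Γ Δ φ → Prv T Γ Δ (φ.or ψ)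
  | orR {Γ Δ} {φ ψ : Fm Γ} : Prv T Γ Δ ψ → Prv T Γ Δ (φ.or ψ)
  | orE {Γ Δ} {φ ψ χ : Fm Γ} : Prv T Γ Δ (φ.or ψ) → Prv T Γ (φ :: Δ) χ → Prv T Γ (ψ :: Δ) χ → Prv T Γ Δ χ
  | impI {Γ Δ} {φ ψ : Fm Γ} : Prv T Γ (φ :: Δ) ψ → Prv T Γ Δ (φ.imp ψ)
  | impE {Γ Δ} {φ ψ : Fm Γ} : Prv T Γ Δ (φ.imp ψ) → Prv T Γ Δ φ → Prv T Γ Δ ψ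
  | efq {Γ Δ} {φ : Fm Γ} : Prv T Γ Δ falsum → Prv T Γ Δ φ
  | lem {Γ Δ} (φ : Fm Γ) : Prv T Γ Δ (φ.or (neg φ))
  | allI {Γ Δ τ} {φ : Fm (τ :: Γ)} : Prv T (τ :: Γ) (Δ.map Fm.wk) φ → Prv T Γ Δ (.all τ φ)
  | allE {Γ Δ τ} {φ : Fm (τ :: Γ)} (t : Tm Γ τ) : Prv T Γ Δ (.all τ φ) → Prv T Γ Δ (φ.inst t)
  | exI {Γ Δ τ} {φ : Fm (τ :: Γ)} (t : Tm Γ τ) : Prv T Γ Δ (φ.inst t) → Prv T Γ Δ (.ex τ φ)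
  | exE {Γ Δ τ} {φ : Fm (τ :: Γ)} {ψ : Fm Γ} : Prv T Γ Δ (.ex τ φ) → Prv T (τ :: Γ) (φ :: Δ.map Fm.wk) ψ.wk → Prv T Γ Δ ψ
  /- equality of type `0`, successor, induction -/
  | refl {Γ Δ} (a : Tm Γ N) : Prv T Γ Δ (.eq a a)
  | symm {Γ Δ} {a b : Tm Γ N} : Prv T Γ Δ (.eq a b) → Prv T Γ Δ (.eq b a)
  | trans {Γ Δ} {a b c : Tm Γ N} :
      Prv T Γ Δ (.eq a b) → Prv T Γ Δ (.eq b c) → Prv T Γ Δ (.eq a c)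
  | succNe {Γ Δ} (a : Tm Γ N) : Prv T Γ Δ (neg (.eq (S a) O))
  | succInj {Γ Δ} {a b : Tm Γ N} : Prv T Γ Δ (.eq (S a) (S b)) → Prv T Γ Δ (.eq a b)
  | ind {Γ Δ} (φ : Fm (N :: Γ)) :
      Prv T Γ Δ (φ.inst O) → Prv T Γ Δ (.all N (φ.imp (φ.subst (Sub.succ Γ)))) →
      Prv T Γ Δ (.all N φ)
  /- combinators and simultaneous recursors -/
  | pi {Γ Δ ρ τ} (x : Tm Γ ρ) (y : Tm Γ τ) : Prv T Γ Δ (eqT ρ ((.con (.pi ρ τ))⬝x⬝y) x)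
  | sigma {Γ Δ δ ρ τ} (x : Tm Γ (δ⇒ρ⇒τ)) (y : Tm Γ (δ⇒ρ)) (z : Tm Γ δ) :
      Prv T Γ Δ (eqT τ ((.con (.sigma δ ρ τ))⬝x⬝y⬝z) (x⬝z⬝(y⬝z)))
  | recZero {Γ Δ ρs τ} (i : Var ρs τ) (y : ∀ σ, Var ρs σ → Tm Γ σ)
      (z : ∀ σ, Var ρs σ → Tm Γ (tele id ρs (N⇒σ))) :
      Prv T Γ Δ (eqT τ (recApp i O y z) (y τ i))
  | recSucc {Γ Δ ρs τ} (i : Var ρs τ) (x : Tm Γ N) (y : ∀ σ, Var ρs σ → Tm Γ σ)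
      (z : ∀ σ, Var ρs σ → Tm Γ (tele id ρs (N⇒σ))) :
      Prv T Γ Δ (eqT τ (recApp i (S x) y z)
        ((apps id ρs (z τ i) (fun _ j => recApp j x y z))⬝x))
  /- the quantifier-free rule of extensionality -/
  | qfer {Γ Δ ρ τ} {A : Fm Γ} {s t : Tm Γ ρ} (r : Tm (ρ :: Γ) τ) :
      A.QF → Prv T Γ [] (A.imp (eqT ρ s t)) →
      Prv T Γ Δ (A.imp (eqT τ (r.inst s) (r.inst t)))
  /- quantifier-free choice and dependent choice -/
  | qfac {Γ Δ} (xs ys : List Ty) (A : Fm (ys ++ (xs ++ Γ))) : A.QF → Prv T Γ Δ (acFm xs ys A)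
  | dc {Γ Δ} (ρs : List Ty) (A : Fm (ρs ++ (ρs ++ (N :: Γ)))) : Prv T Γ Δ (dcFm ρs A)
  /- the axioms of the theory -/
  | ax {Γ Δ} {φ : Fm []} : φ ∈ T → Prv T Γ Δ φ.emb

/-- `T ⊢ φ`: the sentence `φ` is a theorem of `A^ω + T`. -/
def Proves (T : Set (Fm [])) (φ : Fm []) : Prop := Prv T [] [] φ

/-! ## The theory of real inner product spaces -/

/-- Real vector space axioms, with respect to `=_X`. -/
def vectorSpaceAxioms : List (Fm []) :=
  [ -- ∀ x y z, x + (y + z) = (x + y) + z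
    .all X (.all X (.all X (eqX (plusX v2 (plusX v1 v0)) (plusX (plusX v2 v1) v0)))),
    -- ∀ x y, x + y = y + x
    .all X (.all X (eqX (plusX v1 v0) (plusX v0 v1))),
    -- ∀ x, x + 0 = x
    .all X (eqX (plusX v0 zeroX) v0),
    -- ∀ x, x + (-x) = 0
    .all X (eqX (plusX v0 (minusX v0)) zeroX),
    -- ∀ x, 1 x = x
    .all X (eqX (scalX oneR v0) v0),
    -- ∀ α β x, α (β x) = (α β) x
    .all R1 (.all R1 (.all X (eqX (scalX v2 (scalX v1 v0)) (scalX (timesR v2 v1) v0)))),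
    -- ∀ α β x, (α + β) x = α x + β x
    .all R1 (.all R1 (.all X (eqX (scalX (plusR v2 v1) v0) (plusX (scalX v2 v0) (scalX v1 v0))))),
    -- ∀ α x y, α (x + y) = α x + α y
    .all R1 (.all X (.all X (eqX (scalX v2 (plusX v1 v0)) (plusX (scalX v2 v1) (scalX v2 v0))))) ]

/-- The axioms for the norm, including those that make all operations extensional. -/
def normAxioms : List (Fm []) :=
  [ -- ∀ x, ‖x - x‖ = 0
    .all X (eqR (normX (subX v0 v0)) zeroR),
    -- ∀ x y, ‖x - y‖ = ‖y - x‖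
    .all X (.all X (eqR (normX (subX v1 v0)) (normX (subX v0 v1)))),
    -- ∀ x y z, ‖x - z‖ ≤ ‖x - y‖ + ‖y - z‖
    .all X (.all X (.all X (leR (normX (subX v2 v0))
      (plusR (normX (subX v2 v1)) (normX (subX v1 v0)))))),
    -- ∀ α x y, ‖α x - α y‖ = |α| ‖x - y‖
    .all R1 (.all X (.all X (eqR (normX (subX (scalX v2 v1) (scalX v2 v0)))
      (timesR (absR v2) (normX (subX v1 v0)))))),
    -- ∀ α β x, ‖α x - β x‖ = |α - β| ‖x‖
    .all R1 (.all R1 (.all X (eqR (normX (subX (scalX v2 v0) (scalX v1 v0)))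
      (timesR (absR (subR v2 v1)) (normX v0))))),
    -- ∀ x y u v, ‖(x + y) - (u + v)‖ ≤ ‖x - u‖ + ‖y - v‖
    .all X (.all X (.all X (.all X (leR (normX (subX (plusX v3 v2) (plusX v1 v0)))
      (plusR (normX (subX v3 v1)) (normX (subX v2 v0))))))),
    -- ∀ x y, ‖(-x) - (-y)‖ = ‖x - y‖
    .all X (.all X (eqR (normX (subX (minusX v1) (minusX v0))) (normX (subX v1 v0)))),
    -- ∀ x y, |‖x‖ - ‖y‖| ≤ ‖x - y‖
    .all X (.all X (leR (absR (subR (normX v1) (normX v0))) (normX (subX v1 v0)))),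
    -- ‖1_X‖ = 1
    eqR (normX oneX) oneR ]

/-- `∀ x y, ‖x + y‖² + ‖x - y‖² = 2 (‖x‖² + ‖y‖²)`. -/
def parallelogram : Fm [] :=
  .all X (.all X (eqR (plusR (sqNorm (plusX v1 v0)) (sqNorm (subX v1 v0)))
    (timesR (ratR (pair (num 4) O)) (plusR (sqNorm v1) (sqNorm v0)))))

def innerProductAxioms : List (Fm []) := vectorSpaceAxioms ++ normAxioms ++ [parallelogram]

/-! ## Comonotone operators with total resolvents -/

section Operators
variable {Γ : Ctx}

/-- `χ_A x u`. -/
abbrev chi (x u : Tm Γ X) : Tm Γ N := (.con .chi)⬝x⬝u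
/-- `J^A_γ x`. -/
abbrev J (g : Tm Γ R1) (x : Tm Γ X) : Tm Γ X := (.con .res)⬝g⬝x
abbrev gam : Tm Γ R1 := .con .gam
abbrev mgam : Tm Γ N := .con .mgam
abbrev rho : Tm Γ R1 := .con .rho
abbrev ngam : Tm Γ N := .con .ngam

/-- `u ∈ A x`, that is, `χ_A x u =₀ 0`. -/
def mem (u x : Tm Γ X) : Fm Γ := .eq (chi x u) O

/-- `γ/2`. -/
abbrev halfR (g : Tm Γ R1) : Tm Γ R1 := timesR (twoNegR (num 1)) g

/-- `⟨x - y, u - v⟩ ≥ ρ̃ ‖u - v‖²`. -/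
def comonIneq (x y u v : Tm Γ X) : Fm Γ :=
  leR (timesR rho (sqNorm (subX u v))) (innerX (subX x y) (subX u v))

/-- `x_n →_X x`: `∀ k ∃ N ∀ m ≥ N, ‖x_m - x‖ ≤ 2^{-k}`. -/
def convX (xs : Tm Γ (N⇒X)) (x : Tm Γ X) : Fm Γ :=
  .all N (.ex N (.all N ((leN v1 v0).imp
    (leR (normX (subX (xs.wk.wk.wk⬝v0) x.wk.wk.wk)) (twoNegR v2)))))

end Operators

/-- `∀ x y, χ_A x y ≤₀ 1`. -/
def axBool : Fm [] := .all X (.all X (leN (chi v1 v0) (S O)))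

/-- `∀ γ x l, γ > 2^{-l} → (γ)⁻¹_l (x - J_γ x) ∈ A (J_γ x)`. -/
def axRes : Fm [] :=
  .all R1 (.all X (.all N ((ltR (twoNegR v0) v2).imp
    (mem (scalX (invR v0 v2) (subX v1 (J v2 v1))) (J v2 v1)))))

/-- `∀ γ x l, ρ̃ > -γ/2 ∧ γ > 2^{-l} → (γ)⁻¹_l (x - J_γ x) ∈ A (J_γ x)`. -/
def axResStar : Fm [] :=
  .all R1 (.all X (.all N (((ltR (minusR (halfR v2)) rho).and (ltR (twoNegR v0) v2)).imp
    (mem (scalX (invR v0 v2) (subX v1 (J v2 v1))) (J v2 v1)))))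

/-- `∀ x y u v, u ∈ A x ∧ v ∈ A y → ⟨x - y, u - v⟩ ≥ ρ̃ ‖u - v‖²`. -/
def axComon : Fm [] :=
  .all X (.all X (.all X (.all X (((mem v1 v3).and (mem v0 v2)).imp (comonIneq v3 v2 v1 v0)))))

/-- `γ̃ ≥ 2^{-m_γ̃}`. -/
def axGam : Fm [] := leR (twoNegR mgam) gam

/-- `ρ̃ ≥ -γ̃ + 2^{-n_γ̃}`. -/
def axRho : Fm [] := leR (plusR (minusR gam) (twoNegR ngam)) rho

/-- `ρ̃ ≥ -γ̃/2 + 2^{-n_γ̃}`. -/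
def axRhoStar : Fm [] := leR (plusR (minusR (halfR gam)) (twoNegR ngam)) rho

/-- The axioms of `U^ω`. -/
def U : Set (Fm []) := {φ | φ ∈ innerProductAxioms ++ [axBool, axRes, axComon, axGam, axRho]}

/-- The axioms of `U^{*ω}`. -/
def UStar : Set (Fm []) :=
  {φ | φ ∈ innerProductAxioms ++ [axBool, axResStar, axComon, axGam, axRhoStar]}

/-! ## The equivalent statements -/

/-- `∀ x y x' y', x =_X x' ∧ y =_X y' → χ_A x y =₀ χ_A x' y'`. -/
def extensionality : Fm [] :=
  .all X (.all X (.all X (.all X (((eqX v3 v1).and (eqX v2 v0)).imp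
    (.eq (chi v3 v2) (chi v1 v0))))))

/-- `∀ γ x p l, γ > 2^{-l} ∧ ρ̃ > -γ ∧ p =_X J_γ x → (γ)⁻¹_l (x - p) ∈ A p`. -/
def strongResolvent : Fm [] :=
  .all R1 (.all X (.all X (.all N
    (((ltR (twoNegR v0) v3).and ((ltR (minusR v3) rho).and (eqX v1 (J v3 v2)))).imp
      (mem (scalX (invR v0 v3) (subX v2 v1)) v1)))))

/-- `∀ γ x p l, γ > 2^{-l} ∧ ρ̃ > -γ/2 ∧ p =_X J_γ x → (γ)⁻¹_l (x - p) ∈ A p`. -/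
def strongResolventStar : Fm [] :=
  .all R1 (.all X (.all X (.all N
    (((ltR (twoNegR v0) v3).and ((ltR (minusR (halfR v3)) rho).and (eqX v1 (J v3 v2)))).imp
      (mem (scalX (invR v0 v3) (subX v2 v1)) v1)))))

/-- `∀ x u, (∀ y v, v ∈ A y → ⟨x - y, u - v⟩ ≥ ρ̃ ‖u - v‖²) → u ∈ A x`. -/
def maximalComonotone : Fm [] :=
  .all X (.all X ((Fm.all X (.all X ((mem v0 v1).imp (comonIneq v3 v1 v2 v0)))).imp (mem v0 v1)))

/-- `∀ x y x_(·) y_(·), x_n → x ∧ y_n → y ∧ (∀ n, y_n ∈ A x_n) → y ∈ A x`. -/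
def closedGraph : Fm [] :=
  .all X (.all X (.all (N⇒X) (.all (N⇒X)
    (((convX v1 v3).and ((convX v0 v2).and (.all N (mem (v1⬝v0) (v2⬝v0))))).imp (mem v2 v3)))))

end Comon

namespace Comon

/-! ## Calculus of renamings and substitutions -/

theorem Ren.lift_comp {Γ Δ Θ : Ctx} (r : Ren Γ Δ) (r' : Ren Δ Θ) (σ : Ty) :
    (fun τ v => (r'.lift σ) τ (r.lift σ τ v)) = Ren.lift (fun τ v => r' τ (r τ v)) σ := by
  funext τ v; cases v <;> rfl

theorem Ren.lift_id {Γ : Ctx} (σ : Ty) :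
    Ren.lift (fun _ v => v : Ren Γ Γ) σ = fun _ v => v := by
  funext τ v; cases v <;> rfl

theorem Tm.rename_rename {Γ Δ Θ : Ctx} (r : Ren Γ Δ) (r' : Ren Δ Θ) {τ : Ty} (t : Tm Γ τ) :
    (t.rename r).rename r' = t.rename (fun τ v => r' τ (r τ v)) := by
  induction t with
  | var v => rfl
  | con c => rfl
  | app f a hf ha => simp only [Tm.rename, hf, ha]

theorem Tm.rename_id {Γ : Ctx} {τ : Ty} (t : Tm Γ τ) : t.rename (fun _ v => v) = t := by
  induction t with
  | var v => rfl
  | con c => rfl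
  | app f a hf ha => simp only [Tm.rename, hf, ha]

theorem Tm.app_rename {Γ Δ : Ctx} (r : Ren Γ Δ) {σ τ : Ty} (f : Tm Γ (σ⇒τ)) (a : Tm Γ σ) :
    (f⬝a).rename r = (f.rename r)⬝(a.rename r) := rfl

theorem Fm.rename_rename {Γ Δ Θ : Ctx} (r : Ren Γ Δ) (r' : Ren Δ Θ) (φ : Fm Γ) :
    (φ.rename r).rename r' = φ.rename (fun τ v => r' τ (r τ v)) := by
  induction φ generalizing Δ Θ with
  | eq a b => simp only [Fm.rename, Tm.rename_rename]
  | and φ ψ h1 h2 => simp only [Fm.rename, h1, h2]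
  | or φ ψ h1 h2 => simp only [Fm.rename, h1, h2]
  | imp φ ψ h1 h2 => simp only [Fm.rename, h1, h2]
  | all τ φ h => simp only [Fm.rename, h, Ren.lift_comp]
  | ex τ φ h => simp only [Fm.rename, h, Ren.lift_comp]

theorem Fm.rename_id {Γ : Ctx} (φ : Fm Γ) : φ.rename (fun _ v => v) = φ := by
  induction φ with
  | eq a b => simp only [Fm.rename, Tm.rename_id]
  | and φ ψ h1 h2 => simp only [Fm.rename, h1, h2]
  | or φ ψ h1 h2 => simp only [Fm.rename, h1, h2]
  | imp φ ψ h1 h2 => simp only [Fm.rename, h1, h2]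
  | all τ φ h => simp only [Fm.rename, Ren.lift_id, h]
  | ex τ φ h => simp only [Fm.rename, Ren.lift_id, h]

theorem Tm.wk_rename_lift {Γ Δ : Ctx} (r : Ren Γ Δ) {σ τ : Ty} (t : Tm Γ τ) :
    (t.wk (σ := σ)).rename (r.lift σ) = (t.rename r).wk := by
  simp only [Tm.wk, Tm.rename_rename]; rfl

theorem Fm.wk_rename_lift {Γ Δ : Ctx} (r : Ren Γ Δ) {σ : Ty} (φ : Fm Γ) :
    (φ.wk (σ := σ)).rename (r.lift σ) = (φ.rename r).wk := by
  simp only [Fm.wk, Fm.rename_rename]; rfl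

theorem Ren.eq_nil {Γ : Ctx} (r : Ren [] Γ) : r = Ren.nil := by
  funext τ v; nomatch v

theorem Fm.emb_rename {Γ Δ : Ctx} (r : Ren Γ Δ) (φ : Fm []) : (φ.emb).rename r = φ.emb := by
  simp only [Fm.emb, Fm.rename_rename]; rw [Ren.eq_nil (fun τ v => r τ (Ren.nil τ v))]

theorem Fm.emb_nil (φ : Fm []) : φ.emb = φ := by
  rw [Fm.emb, ← Ren.eq_nil (fun _ v => v), Fm.rename_id]

theorem Tm.emb_rename {Γ Δ : Ctx} (r : Ren Γ Δ) {τ : Ty} (t : Tm [] τ) :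
    (t.emb).rename r = t.emb := by
  simp only [Tm.emb, Tm.rename_rename]; rw [Ren.eq_nil (fun τ v => r τ (Ren.nil τ v))]

theorem Sub.lift_ren {Γ Δ Θ : Ctx} (r : Ren Γ Δ) (s : Sub Δ Θ) (σ : Ty) :
    (fun τ v => (s.lift σ) τ (r.lift σ τ v)) = Sub.lift (fun τ v => s τ (r τ v)) σ := by
  funext τ v; cases v <;> rfl

theorem Sub.ren_lift {Γ Δ Θ : Ctx} (s : Sub Γ Δ) (r : Ren Δ Θ) (σ : Ty) :
    (fun τ v => ((s.lift σ) τ v).rename (r.lift σ)) =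
      Sub.lift (fun τ v => (s τ v).rename r) σ := by
  funext τ v; cases v with
  | z => rfl
  | s v => exact Tm.wk_rename_lift r _

theorem Tm.subst_rename {Γ Δ Θ : Ctx} (r : Ren Γ Δ) (s : Sub Δ Θ) {τ : Ty} (t : Tm Γ τ) :
    (t.rename r).subst s = t.subst (fun τ v => s τ (r τ v)) := by
  induction t with
  | var v => rfl
  | con c => rfl
  | app f a hf ha => simp only [Tm.rename, Tm.subst, hf, ha]

theorem Tm.rename_subst {Γ Δ Θ : Ctx} (s : Sub Γ Δ) (r : Ren Δ Θ) {τ : Ty} (t : Tm Γ τ) :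
    (t.subst s).rename r = t.subst (fun τ v => (s τ v).rename r) := by
  induction t with
  | var v => rfl
  | con c => rfl
  | app f a hf ha => simp only [Tm.rename, Tm.subst, hf, ha]

theorem Tm.subst_subst {Γ Δ Θ : Ctx} (s : Sub Γ Δ) (s' : Sub Δ Θ) {τ : Ty} (t : Tm Γ τ) :
    (t.subst s).subst s' = t.subst (fun τ v => (s τ v).subst s') := by
  induction t with
  | var v => rfl
  | con c => rfl
  | app f a hf ha => simp only [Tm.subst, hf, ha]

theorem Tm.subst_var {Γ : Ctx} {τ : Ty} (t : Tm Γ τ) : t.subst (fun _ v => .var v) = t := by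
  induction t with
  | var v => rfl
  | con c => rfl
  | app f a hf ha => simp only [Tm.subst, hf, ha]

theorem Fm.subst_rename {Γ Δ Θ : Ctx} (r : Ren Γ Δ) (s : Sub Δ Θ) (φ : Fm Γ) :
    (φ.rename r).subst s = φ.subst (fun τ v => s τ (r τ v)) := by
  induction φ generalizing Δ Θ with
  | eq a b => simp only [Fm.rename, Fm.subst, Tm.subst_rename]
  | and φ ψ h1 h2 => simp only [Fm.rename, Fm.subst, h1, h2]
  | or φ ψ h1 h2 => simp only [Fm.rename, Fm.subst, h1, h2]
  | imp φ ψ h1 h2 => simp only [Fm.rename, Fm.subst, h1, h2]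
  | all τ φ h => simp only [Fm.rename, Fm.subst, h, Sub.lift_ren]
  | ex τ φ h => simp only [Fm.rename, Fm.subst, h, Sub.lift_ren]

theorem Fm.rename_subst {Γ Δ Θ : Ctx} (s : Sub Γ Δ) (r : Ren Δ Θ) (φ : Fm Γ) :
    (φ.subst s).rename r = φ.subst (fun τ v => (s τ v).rename r) := by
  induction φ generalizing Δ Θ with
  | eq a b => simp only [Fm.rename, Fm.subst, Tm.rename_subst]
  | and φ ψ h1 h2 => simp only [Fm.rename, Fm.subst, h1, h2]
  | or φ ψ h1 h2 => simp only [Fm.rename, Fm.subst, h1, h2]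
  | imp φ ψ h1 h2 => simp only [Fm.rename, Fm.subst, h1, h2]
  | all τ φ h => simp only [Fm.rename, Fm.subst, h, Sub.ren_lift]
  | ex τ φ h => simp only [Fm.rename, Fm.subst, h, Sub.ren_lift]

theorem Sub.lift_sub {Γ Δ Θ : Ctx} (s : Sub Γ Δ) (s' : Sub Δ Θ) (σ : Ty) :
    (fun τ v => ((s.lift σ) τ v).subst (s'.lift σ)) =
      Sub.lift (fun τ v => (s τ v).subst s') σ := by
  funext τ v; cases v with
  | z => rfl
  | s v =>
    show ((s τ v).wk).subst (s'.lift σ) = ((s τ v).subst s').wk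
    rw [Tm.wk, Tm.wk, Tm.subst_rename, Tm.rename_subst]; rfl

theorem Fm.subst_subst {Γ Δ Θ : Ctx} (s : Sub Γ Δ) (s' : Sub Δ Θ) (φ : Fm Γ) :
    (φ.subst s).subst s' = φ.subst (fun τ v => (s τ v).subst s') := by
  induction φ generalizing Δ Θ with
  | eq a b => simp only [Fm.subst, Tm.subst_subst]
  | and φ ψ h1 h2 => simp only [Fm.subst, h1, h2]
  | or φ ψ h1 h2 => simp only [Fm.subst, h1, h2]
  | imp φ ψ h1 h2 => simp only [Fm.subst, h1, h2]
  | all τ φ h => simp only [Fm.subst, h, Sub.lift_sub]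
  | ex τ φ h => simp only [Fm.subst, h, Sub.lift_sub]

theorem Sub.lift_var {Γ : Ctx} (σ : Ty) :
    Sub.lift (fun _ v => .var v : Sub Γ Γ) σ = fun _ v => .var v := by
  funext τ v; cases v <;> rfl

theorem Fm.subst_var {Γ : Ctx} (φ : Fm Γ) : φ.subst (fun _ v => .var v) = φ := by
  induction φ with
  | eq a b => simp only [Fm.subst, Tm.subst_var]
  | and φ ψ h1 h2 => simp only [Fm.subst, h1, h2]
  | or φ ψ h1 h2 => simp only [Fm.subst, h1, h2]
  | imp φ ψ h1 h2 => simp only [Fm.subst, h1, h2]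
  | all τ φ h => simp only [Fm.subst, Sub.lift_var, h]
  | ex τ φ h => simp only [Fm.subst, Sub.lift_var, h]

theorem Sub.one_ren {Γ Δ : Ctx} (r : Ren Γ Δ) {σ : Ty} (t : Tm Γ σ) :
    (fun τ v => (Sub.one t τ v).rename r) =
      fun τ v => Sub.one (t.rename r) τ (r.lift σ τ v) := by
  funext τ v; cases v <;> rfl

theorem Tm.inst_rename {Γ Δ : Ctx} (r : Ren Γ Δ) {σ τ : Ty} (t : Tm (σ :: Γ) τ) (a : Tm Γ σ) :
    (t.inst a).rename r = (t.rename (r.lift σ)).inst (a.rename r) := by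
  simp only [Tm.inst, Tm.rename_subst, Tm.subst_rename, Sub.one_ren]

theorem Fm.inst_rename {Γ Δ : Ctx} (r : Ren Γ Δ) {σ : Ty} (φ : Fm (σ :: Γ)) (a : Tm Γ σ) :
    (φ.inst a).rename r = (φ.rename (r.lift σ)).inst (a.rename r) := by
  simp only [Fm.inst, Fm.rename_subst, Fm.subst_rename, Sub.one_ren]

theorem Tm.wk_inst {Γ : Ctx} {σ τ : Ty} (t : Tm Γ τ) (a : Tm Γ σ) : t.wk.inst a = t := by
  rw [Tm.wk, Tm.inst, Tm.subst_rename]; exact Tm.subst_var t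

/-- Quantifier rules applied with a fresh variable produce an instance of a weakened formula at that
variable; this turns it back into the matrix. -/
theorem Fm.rename_lift_inst {Γ : Ctx} {σ : Ty} (φ : Fm (σ :: Γ)) :
    (φ.rename (Ren.lift (fun _ v => .s v) σ)).inst v0 = φ := by
  rw [Fm.inst, Fm.subst_rename]
  refine Eq.trans (congrArg (Fm.subst · φ) ?_) (Fm.subst_var φ)
  funext τ v; cases v <;> rfl

/-- Extension of a substitution by a term for the most recent variable. -/
def Sub.cons {Γ Δ : Ctx} {σ : Ty} (t : Tm Δ σ) (s : Sub Γ Δ) : Sub (σ :: Γ) Δ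
  | _, .z => t
  | _, .s v => s _ v

theorem Fm.subst_lift_inst {Γ Δ : Ctx} {σ : Ty} (s : Sub Γ Δ) (t : Tm Δ σ) (φ : Fm (σ :: Γ)) :
    (φ.subst (s.lift σ)).inst t = φ.subst (Sub.cons t s) := by
  rw [Fm.inst, Fm.subst_subst]
  congr 1
  funext τ v; cases v with
  | z => rfl
  | s v => exact Tm.wk_inst _ t

/-! ### Renaming of defined formulas and of the choice schemata; derivability under renaming -/

theorem eqT_rename {Γ Δ : Ctx} (r : Ren Γ Δ) {τ : Ty} (a b : Tm Γ τ) :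
    (eqT τ a b).rename r = eqT τ (a.rename r) (b.rename r) := by
  induction τ generalizing Γ Δ with
  | nat => rfl
  | abs =>
    simp only [eqT, eqX, eqR, Fm.rename, Tm.rename, Tm.wk_rename_lift, Tm.emb_rename, Ren.lift]
  | fn σ τ _ h =>
    simp only [eqT, Fm.rename, h, Tm.rename, Tm.wk_rename_lift]; rfl

theorem Fm.QF.rename {Γ Δ : Ctx} (r : Ren Γ Δ) {φ : Fm Γ} (h : φ.QF) : (φ.rename r).QF := by
  induction φ generalizing Δ with
  | eq a b => trivial
  | and φ ψ h1 h2 => exact ⟨h1 r h.1, h2 r h.2⟩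
  | or φ ψ h1 h2 => exact ⟨h1 r h.1, h2 r h.2⟩
  | imp φ ψ h1 h2 => exact ⟨h1 r h.1, h2 r h.2⟩
  | all τ φ _ => exact h
  | ex τ φ _ => exact h

theorem apps_rename {Γ Δ : Ctx} (r : Ren Γ Δ) (F : Ty → Ty) (ρs : List Ty) {τ : Ty}
    (t : Tm Γ (tele F ρs τ)) (a : ∀ σ, Var ρs σ → Tm Γ (F σ)) :
    (apps F ρs t a).rename r = apps F ρs (t.rename r) (fun σ v => (a σ v).rename r) := by
  induction ρs with
  | nil => rfl
  | cons ρ ρs h => exact h _ _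

theorem recApp_rename {Γ Δ : Ctx} (r : Ren Γ Δ) {ρs : List Ty} {τ : Ty} (i : Var ρs τ)
    (x : Tm Γ N) (y : ∀ σ, Var ρs σ → Tm Γ σ) (z : ∀ σ, Var ρs σ → Tm Γ (tele id ρs (N⇒σ))) :
    (recApp i x y z).rename r =
      recApp i (x.rename r) (fun σ v => (y σ v).rename r) (fun σ v => (z σ v).rename r) := by
  unfold recApp
  rw [apps_rename, apps_rename]; rfl

/-- Lifting of a renaming along a telescope. -/
def Ren.liftL {Γ Δ : Ctx} (r : Ren Γ Δ) : ∀ ρs : List Ty, Ren (ρs ++ Γ) (ρs ++ Δ)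
  | [] => r
  | ρ :: ρs => (Ren.liftL r ρs).lift ρ

theorem allL_rename {Γ Δ : Ctx} (r : Ren Γ Δ) (ρs : List Ty) (φ : Fm (ρs ++ Γ)) :
    (allL ρs φ).rename r = allL ρs (φ.rename (r.liftL ρs)) := by
  induction ρs with
  | nil => rfl
  | cons ρ ρs h => exact h _

theorem exL_rename {Γ Δ : Ctx} (r : Ren Γ Δ) (ρs : List Ty) (φ : Fm (ρs ++ Γ)) :
    (exL ρs φ).rename r = exL ρs (φ.rename (r.liftL ρs)) := by
  induction ρs with
  | nil => rfl
  | cons ρ ρs h => exact h _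

theorem Ren.liftL_inl {Γ Δ : Ctx} (r : Ren Γ Δ) {ρs : List Ty} {τ : Ty} (v : Var ρs τ) :
    r.liftL ρs τ v.inl = v.inl := by
  induction v with
  | z => rfl
  | s v h => exact congrArg Var.s h

theorem Ren.liftL_inr {Γ Δ : Ctx} (r : Ren Γ Δ) (ρs : List Ty) {τ : Ty} (v : Var Γ τ) :
    r.liftL ρs τ (v.inr ρs) = (r τ v).inr ρs := by
  induction ρs with
  | nil => rfl
  | cons ρ ρs h => exact congrArg Var.s h

/-- A lifted renaming fixes the variables of the telescope and moves only the others. The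
substitutions in the choice schemata are defined by this case distinction, so they commute with
renaming. -/
theorem split_liftL {Γ Δ : Ctx} (r : Ren Γ Δ) (ρs : List Ty) {τ : Ty} (v : Var (ρs ++ Γ) τ) :
    Var.split ρs (r.liftL ρs τ v) = (Var.split ρs v).map id (r τ) := by
  induction ρs with
  | nil => rfl
  | cons ρ ρs h =>
    cases v with
    | z => rfl
    | s v =>
      simp only [Ren.liftL, Ren.lift, Var.split, h]
      cases Var.split ρs v <;> rfl

theorem acFm_rename {Γ Δ : Ctx} (r : Ren Γ Δ) (xs ys : List Ty) (A : Fm (ys ++ (xs ++ Γ))) :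
    (acFm xs ys A).rename r = acFm xs ys (A.rename ((r.liftL xs).liftL ys)) := by
  simp only [acFm, Fm.rename, allL_rename, exL_rename, Fm.rename_subst, Fm.subst_rename]
  congr 4
  funext τ v
  simp only [acSub, split_liftL]
  cases Var.split ys v with
  | inl y => simp [apps_rename, Tm.rename, Ren.liftL_inl, Ren.liftL_inr]
  | inr w =>
    simp only [Sum.map_inr, split_liftL]
    cases Var.split xs w with
    | inl x => simp [Tm.rename, Ren.liftL_inl]
    | inr g => simp [Tm.rename, Ren.liftL_inr]

theorem dcFm_rename {Γ Δ : Ctx} (r : Ren Γ Δ) (ρs : List Ty) (A : Fm (ρs ++ (ρs ++ (N :: Γ)))) :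
    (dcFm ρs A).rename r = dcFm ρs (A.rename (((r.lift N).liftL ρs).liftL ρs)) := by
  simp only [dcFm, Fm.rename, allL_rename, exL_rename, Fm.rename_subst, Fm.subst_rename]
  congr 4
  funext τ v
  simp only [dcSub, split_liftL]
  cases Var.split ρs v with
  | inl y => simp [Tm.rename, Ren.lift, Ren.liftL_inl]
  | inr w =>
    simp only [Sum.map_inr, split_liftL]
    cases Var.split ρs w with
    | inl x => simp [Tm.rename, Ren.lift, Ren.liftL_inl]
    | inr g =>
      cases g with
      | z => simp [Tm.rename, Ren.lift]
      | s g => simp [Tm.rename, Ren.lift, Ren.liftL_inr]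

theorem Fm.subst_succ_rename {Γ Δ : Ctx} (r : Ren Γ Δ) (φ : Fm (N :: Γ)) :
    (φ.subst (Sub.succ Γ)).rename (r.lift N) = (φ.rename (r.lift N)).subst (Sub.succ Δ) := by
  rw [Fm.rename_subst, Fm.subst_rename]
  congr 1
  funext τ v; cases v <;> rfl

/-- Derivability is stable under weakening of the assumptions and renaming of the variables. -/
theorem Prv.rename {T : Set (Fm [])} {Γ : Ctx} {Δ : List (Fm Γ)} {φ : Fm Γ} (h : Prv T Γ Δ φ) :
    ∀ {Γ' : Ctx} (r : Ren Γ Γ') {Δ' : List (Fm Γ')}, (∀ δ ∈ Δ, δ.rename r ∈ Δ') →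
      Prv T Γ' Δ' (φ.rename r) := by
  have cons : ∀ {Γ Γ' : Ctx} {Δ : List (Fm Γ)} {Δ' : List (Fm Γ')} {r : Ren Γ Γ'} (χ : Fm Γ),
      (∀ δ ∈ Δ, δ.rename r ∈ Δ') → ∀ δ ∈ χ :: Δ, δ.rename r ∈ χ.rename r :: Δ' := by
    intro Γ Γ' Δ Δ' r χ h δ hδ
    rcases List.mem_cons.1 hδ with rfl | hδ
    · exact List.mem_cons_self
    · exact List.mem_cons_of_mem _ (h δ hδ)
  have wk : ∀ {Γ Γ' : Ctx} {Δ : List (Fm Γ)} {Δ' : List (Fm Γ')} {r : Ren Γ Γ'} (τ : Ty),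
      (∀ δ ∈ Δ, δ.rename r ∈ Δ') →
      ∀ δ ∈ Δ.map (Fm.wk (σ := τ)), δ.rename (r.lift τ) ∈ Δ'.map (Fm.wk (σ := τ)) := by
    intro Γ Γ' Δ Δ' r τ h δ hδ
    obtain ⟨δ', hδ', rfl⟩ := List.mem_map.1 hδ
    rw [Fm.wk_rename_lift]
    exact List.mem_map_of_mem (h δ' hδ')
  induction h with
  | hyp h => intro Γ' r Δ' hr; exact .hyp (hr _ h)
  | andI _ _ h1 h2 => intro Γ' r Δ' hr; exact .andI (h1 r hr) (h2 r hr)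
  | andL _ h => intro Γ' r Δ' hr; exact .andL (h r hr)
  | andR _ h => intro Γ' r Δ' hr; exact .andR (h r hr)
  | orL _ h => intro Γ' r Δ' hr; exact .orL (h r hr)
  | orR _ h => intro Γ' r Δ' hr; exact .orR (h r hr)
  | orE _ _ _ h1 h2 h3 =>
    intro Γ' r Δ' hr; exact .orE (h1 r hr) (h2 r (cons _ hr)) (h3 r (cons _ hr))
  | impI _ h => intro Γ' r Δ' hr; exact .impI (h r (cons _ hr))
  | impE _ _ h1 h2 => intro Γ' r Δ' hr; exact .impE (h1 r hr) (h2 r hr)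
  | efq _ h => intro Γ' r Δ' hr; exact .efq (h r hr)
  | lem φ => intro Γ' r Δ' hr; exact .lem _
  | allI _ h => intro Γ' r Δ' hr; exact .allI (h _ (wk _ hr))
  | allE t _ h =>
    intro Γ' r Δ' hr; rw [Fm.inst_rename]; exact .allE _ (h r hr)
  | exI t _ h =>
    intro Γ' r Δ' hr; refine .exI (t.rename r) ?_; rw [← Fm.inst_rename]; exact h r hr
  | exE _ _ h1 h2 =>
    intro Γ' r Δ' hr
    refine .exE (h1 r hr) ?_
    rw [← Fm.wk_rename_lift]
    exact h2 _ (cons _ (wk _ hr))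
  | refl a => intro Γ' r Δ' hr; exact .refl _
  | symm _ h => intro Γ' r Δ' hr; exact .symm (h r hr)
  | trans _ _ h1 h2 => intro Γ' r Δ' hr; exact .trans (h1 r hr) (h2 r hr)
  | succNe a => intro Γ' r Δ' hr; exact .succNe _
  | succInj _ h => intro Γ' r Δ' hr; exact .succInj (h r hr)
  | ind φ _ _ h1 h2 =>
    intro Γ' r Δ' hr
    refine .ind _ ?_ ?_
    · have := h1 r hr; rwa [Fm.inst_rename] at this
    · have := h2 r hr
      simp only [Fm.rename, Fm.subst_succ_rename] at this
      exact this
  | pi x y => intro Γ' r Δ' hr; rw [eqT_rename]; exact .pi _ _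
  | sigma x y z => intro Γ' r Δ' hr; rw [eqT_rename]; exact .sigma _ _ _
  | recZero i y z =>
    intro Γ' r Δ' hr; rw [eqT_rename, recApp_rename]; exact .recZero i _ _
  | recSucc i x y z =>
    intro Γ' r Δ' hr
    simp only [eqT_rename, Tm.app_rename, apps_rename, recApp_rename]
    exact .recSucc i _ _ _
  | qfer t hA _ h =>
    intro Γ' r Δ' hr
    -- The premise of the extensionality rule must remain free of assumptions, so the induction
    -- hypothesis is used with the empty list and not with `Δ'`.
    have h' := h r (Δ' := []) (by simp)
    simp only [Fm.rename, eqT_rename, Tm.inst_rename] at h' ⊢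
    exact .qfer _ (hA.rename r) h'
  | qfac xs ys A hA => intro Γ' r Δ' hr; rw [acFm_rename]; exact .qfac _ _ _ (hA.rename _)
  | dc ρs A => intro Γ' r Δ' hr; rw [dcFm_rename]; exact .dc _ _
  | ax h => intro Γ' r Δ' hr; rw [Fm.emb_rename]; exact .ax h

end Comon

namespace Comon

/-! ## Countability of the syntax -/

def Ty.code : Ty → ℕ
  | .nat => Nat.pair 0 0
  | .abs => Nat.pair 1 0
  | .fn σ τ => Nat.pair 2 (Nat.pair σ.code τ.code)

theorem Ty.code_injective : Function.Injective Ty.code := by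
  intro σ
  induction σ with
  | nat => intro τ h; cases τ <;> simp_all [Ty.code, Nat.pair_eq_pair]
  | abs => intro τ h; cases τ <;> simp_all [Ty.code, Nat.pair_eq_pair]
  | fn ρ σ h1 h2 =>
    intro τ h
    cases τ with
    | nat => simp [Ty.code, Nat.pair_eq_pair] at h
    | abs => simp [Ty.code, Nat.pair_eq_pair] at h
    | fn ρ' σ' =>
      simp only [Ty.code, Nat.pair_eq_pair, true_and] at h
      rw [h1 h.1, h2 h.2]

instance : Countable Ty := Ty.code_injective.countable

noncomputable instance : Encodable Ty := Encodable.ofCountable Ty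

def Var.code : {Γ : Ctx} → {τ : Ty} → Var Γ τ → ℕ
  | _, _, .z => 0
  | _, _, .s v => v.code + 1

/-- The code is the bare index; the context determines the type at that index, whence the equality
in the sigma type. -/
theorem Var.code_injective {Γ : Ctx} {σ τ : Ty} (v : Var Γ σ) (w : Var Γ τ)
    (h : v.code = w.code) : (⟨σ, v⟩ : Σ τ, Var Γ τ) = ⟨τ, w⟩ := by
  induction v with
  | z =>
    cases w with
    | z => rfl
    | s w => simp [Var.code] at h
  | s v ih =>
    cases w with
    | z => simp [Var.code] at h
    | s w =>
      have := ih w (by simpa [Var.code] using h)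
      cases this; rfl

noncomputable def Con.code : {τ : Ty} → Con τ → ℕ
  | _, .zero => Nat.pair 0 0
  | _, .succ => Nat.pair 1 0
  | _, .pi ρ τ => Nat.pair 2 (Nat.pair ρ.code τ.code)
  | _, .sigma δ ρ τ => Nat.pair 3 (Nat.pair δ.code (Nat.pair ρ.code τ.code))
  | _, .recur ρs i => Nat.pair 4 (Nat.pair (Encodable.encode ρs) i.code)
  | _, .zeroX => Nat.pair 5 0
  | _, .oneX => Nat.pair 6 0
  | _, .plusX => Nat.pair 7 0
  | _, .minusX => Nat.pair 8 0
  | _, .scalX => Nat.pair 9 0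
  | _, .normX => Nat.pair 10 0
  | _, .chi => Nat.pair 11 0
  | _, .res => Nat.pair 12 0
  | _, .gam => Nat.pair 13 0
  | _, .mgam => Nat.pair 14 0
  | _, .anchor => Nat.pair 15 0
  | _, .rho => Nat.pair 16 0
  | _, .ngam => Nat.pair 17 0

theorem Con.code_injective {σ τ : Ty} (c : Con σ) (d : Con τ) (h : c.code = d.code) :
    (⟨σ, c⟩ : Σ τ, Con τ) = ⟨τ, d⟩ := by
  cases c <;> cases d <;> simp only [Con.code, Nat.pair_eq_pair] at h <;>
    first
    | rfl
    | (exfalso; omega)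
    | skip
  · obtain ⟨-, h1, h2⟩ := h
    cases Ty.code_injective h1; cases Ty.code_injective h2; rfl
  · obtain ⟨-, h1, h2, h3⟩ := h
    cases Ty.code_injective h1; cases Ty.code_injective h2; cases Ty.code_injective h3; rfl
  · obtain ⟨-, h1, h2⟩ := h
    cases Encodable.encode_injective h1
    cases Var.code_injective _ _ h2; rfl

noncomputable def Tm.code : {Γ : Ctx} → {τ : Ty} → Tm Γ τ → ℕ
  | _, _, .var v => Nat.pair 0 v.code
  | _, _, .con c => Nat.pair 1 c.code
  | _, _, .app f a => Nat.pair 2 (Nat.pair f.code a.code)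

theorem Tm.code_injective {Γ : Ctx} {σ τ : Ty} (s : Tm Γ σ) (t : Tm Γ τ) (h : s.code = t.code) :
    (⟨σ, s⟩ : Σ τ, Tm Γ τ) = ⟨τ, t⟩ := by
  induction s generalizing τ with
  | var v =>
    cases t <;> simp only [Tm.code, Nat.pair_eq_pair] at h <;> first | (exfalso; omega) | skip
    cases Var.code_injective _ _ h.2; rfl
  | con c =>
    cases t <;> simp only [Tm.code, Nat.pair_eq_pair] at h <;> first | (exfalso; omega) | skip
    cases Con.code_injective _ _ h.2; rfl
  | app f a hf ha =>
    cases t <;> simp only [Tm.code, Nat.pair_eq_pair] at h <;> first | (exfalso; omega) | skip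
    cases hf _ h.2.1; cases ha _ h.2.2; rfl

noncomputable def Fm.code : {Γ : Ctx} → Fm Γ → ℕ
  | _, .eq a b => Nat.pair 0 (Nat.pair a.code b.code)
  | _, .and φ ψ => Nat.pair 1 (Nat.pair φ.code ψ.code)
  | _, .or φ ψ => Nat.pair 2 (Nat.pair φ.code ψ.code)
  | _, .imp φ ψ => Nat.pair 3 (Nat.pair φ.code ψ.code)
  | _, .all τ φ => Nat.pair 4 (Nat.pair τ.code φ.code)
  | _, .ex τ φ => Nat.pair 5 (Nat.pair τ.code φ.code)

theorem Fm.code_injective {Γ : Ctx} : Function.Injective (Fm.code (Γ := Γ)) := by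
  intro φ
  induction φ with
  | eq a b =>
    intro ψ h
    cases ψ <;> simp only [Fm.code, Nat.pair_eq_pair] at h <;> first | (exfalso; omega) | skip
    cases Tm.code_injective _ _ h.2.1; cases Tm.code_injective _ _ h.2.2; rfl
  | and _ _ h1 h2 | or _ _ h1 h2 | imp _ _ h1 h2 =>
    intro ψ h
    cases ψ <;> simp only [Fm.code, Nat.pair_eq_pair] at h <;> first | (exfalso; omega) | skip
    cases h1 h.2.1; cases h2 h.2.2; rfl
  | all _ _ h1 | ex _ _ h1 =>
    intro ψ h
    cases ψ <;> simp only [Fm.code, Nat.pair_eq_pair] at h <;> first | (exfalso; omega) | skip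
    cases Ty.code_injective h.2.1; cases h1 h.2.2; rfl

/-- Countability allows all formulas to be decided and witnessed in `ω` stages. -/
instance {Γ : Ctx} : Countable (Fm Γ) := Fm.code_injective.countable

/-! ## Structures and satisfaction -/

/-- A structure for the language; the elements of `D N` are compared by equality. -/
structure Str where
  D : Ty → Type
  app : ∀ {σ τ : Ty}, D (σ⇒τ) → D σ → D τ
  con : ∀ {τ : Ty}, Con τ → D τ

/-- Assignments of elements to the variables of a context. -/
abbrev Str.Env (M : Str) (Γ : Ctx) := ∀ τ : Ty, Var Γ τ → M.D τ

def Str.nil (M : Str) : M.Env [] := fun _ v => nomatch v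

def Str.cons {M : Str} {Γ : Ctx} {σ : Ty} (a : M.D σ) (e : M.Env Γ) : M.Env (σ :: Γ)
  | _, .z => a
  | _, .s v => e _ v

def Str.eval (M : Str) {Γ : Ctx} : {τ : Ty} → Tm Γ τ → M.Env Γ → M.D τ
  | _, .var v, e => e _ v
  | _, .con c, _ => M.con c
  | _, .app f a, e => M.app (M.eval f e) (M.eval a e)

def Str.Sat (M : Str) : {Γ : Ctx} → Fm Γ → M.Env Γ → Prop
  | _, .eq a b, e => M.eval a e = M.eval b e
  | _, .and φ ψ, e => M.Sat φ e ∧ M.Sat ψ e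
  | _, .or φ ψ, e => M.Sat φ e ∨ M.Sat ψ e
  | _, .imp φ ψ, e => M.Sat φ e → M.Sat ψ e
  | _, .all τ φ, e => ∀ a : M.D τ, M.Sat φ (Str.cons a e)
  | _, .ex τ φ, e => ∃ a : M.D τ, M.Sat φ (Str.cons a e)

section
variable {M : Str} {Γ : Ctx} {e : M.Env Γ} {φ ψ : Fm Γ}

theorem Str.eval_app {σ τ : Ty} (f : Tm Γ (σ⇒τ)) (a : Tm Γ σ) :
    M.eval (f⬝a) e = M.app (M.eval f e) (M.eval a e) := rfl

theorem Str.sat_eq {a b : Tm Γ N} : M.Sat (.eq a b) e ↔ M.eval a e = M.eval b e := Iff.rfl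

theorem Str.sat_and : M.Sat (φ.and ψ) e ↔ M.Sat φ e ∧ M.Sat ψ e := Iff.rfl

theorem Str.sat_or : M.Sat (φ.or ψ) e ↔ M.Sat φ e ∨ M.Sat ψ e := Iff.rfl

theorem Str.sat_imp : M.Sat (φ.imp ψ) e ↔ (M.Sat φ e → M.Sat ψ e) := Iff.rfl

theorem Str.sat_all {τ : Ty} {φ : Fm (τ :: Γ)} :
    M.Sat (.all τ φ) e ↔ ∀ a : M.D τ, M.Sat φ (Str.cons a e) := Iff.rfl

theorem Str.sat_ex {τ : Ty} {φ : Fm (τ :: Γ)} :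
    M.Sat (.ex τ φ) e ↔ ∃ a : M.D τ, M.Sat φ (Str.cons a e) := Iff.rfl

theorem Str.env_nil_eq (e e' : M.Env []) : e = e' := by
  funext τ v; nomatch v

end

/-- A structure that satisfies all theorems of `T`, and in which terms that are provably equal
have equal values. -/
structure Model (T : Set (Fm [])) extends Str where
  sound : ∀ {φ : Fm []}, Prv T [] [] φ → toStr.Sat φ toStr.nil
  ext : ∀ {Γ : Ctx} {τ : Ty} {s t : Tm Γ τ}, Prv T Γ [] (eqT τ s t) →
    ∀ e, toStr.eval s e = toStr.eval t e
  not_falsum : ¬ toStr.Sat (falsum : Fm []) toStr.nil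

/-! ## Substitution into theorems -/

theorem Sub.wk_lift {Γ Δ : Ctx} (s : Sub Γ Δ) {σ τ : Ty} (t : Tm Γ τ) :
    (t.wk (σ := σ)).subst (s.lift σ) = (t.subst s).wk := by
  rw [Tm.wk, Tm.wk, Tm.subst_rename, Tm.rename_subst]; rfl

theorem Tm.emb_subst {Γ Δ : Ctx} (s : Sub Γ Δ) {τ : Ty} (t : Tm [] τ) :
    (t.emb).subst s = t.emb := by
  rw [Tm.emb, Tm.emb, Tm.subst_rename, ← Tm.subst_var (t.rename Ren.nil), Tm.subst_rename]
  congr 1; funext τ v; nomatch v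

theorem eqT_subst {Γ Δ : Ctx} (s : Sub Γ Δ) {τ : Ty} (a b : Tm Γ τ) :
    (eqT τ a b).subst s = eqT τ (a.subst s) (b.subst s) := by
  induction τ generalizing Γ Δ with
  | nat => rfl
  | abs =>
    simp only [eqT, eqX, eqR, Fm.subst, Tm.subst, Sub.wk_lift, Tm.emb_subst, Sub.lift]
  | fn σ τ _ h =>
    simp only [eqT, Fm.subst, h, Tm.subst, Sub.wk_lift]; rfl

variable {T : Set (Fm [])}

/-- Without assumptions, all variables can be generalized and then instantiated one after another.
-/
theorem Prv.subst {Γ : Ctx} {φ : Fm Γ} (h : Prv T Γ [] φ) {Γ' : Ctx} (s : Sub Γ Γ') :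
    Prv T Γ' [] (φ.subst s) := by
  induction Γ generalizing Γ' with
  | nil =>
    have h' := h.rename (Γ' := Γ') (Δ' := []) Ren.nil (by simp)
    rwa [← Fm.subst_var (φ.rename Ren.nil), Fm.subst_rename,
      show (fun τ v => .var (Ren.nil τ v) : Sub [] Γ') = s by funext τ v; nomatch v] at h'
  | cons τ Γ ih =>
    have h' := ih (Prv.allI h) (fun _ v => s _ (.s v))
    have h2 := Prv.allE (s _ .z) h'
    rw [Fm.subst_lift_inst] at h2
    convert h2 using 2
    funext τ v; cases v <;> rfl

theorem Prv.weaken {Γ : Ctx} {Δ Δ' : List (Fm Γ)} {φ : Fm Γ} (h : Prv T Γ Δ φ)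
    (hΔ : ∀ δ ∈ Δ, δ ∈ Δ') : Prv T Γ Δ' φ := by
  have := h.rename (Δ' := Δ') (fun _ v => v) (fun δ hδ => by rw [Fm.rename_id]; exact hΔ δ hδ)
  rwa [Fm.rename_id] at this

/-! ## Henkin's construction -/

namespace Henkin

instance : Nonempty Ty := ⟨N⟩

instance {Γ : Ctx} : Nonempty (Fm Γ) := ⟨falsum⟩

noncomputable def tyE : ℕ → Ty := (exists_surjective_nat Ty).choose

theorem tyE_surjective : Function.Surjective tyE := (exists_surjective_nat Ty).choose_spec

noncomputable def fmE (Γ : Ctx) : ℕ → Fm Γ :=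
  (exists_surjective_nat (Fm Γ)).choose

theorem fmE_surjective (Γ : Ctx) : Function.Surjective (fmE Γ) :=
  (exists_surjective_nat (Fm Γ)).choose_spec

/-- The type of the `n`-th Henkin constant. -/
noncomputable def ty (n : ℕ) : Ty := tyE n.unpair.1

/-- The context of the first `n` Henkin constants. -/
noncomputable def G : ℕ → Ctx
  | 0 => []
  | n + 1 => ty n :: G n

/-- Henkin constants are simply free variables, the newest first, so passing to a later stage is an
iterated shift. -/
noncomputable def up {n m : ℕ} (h : n ≤ m) : Ren (G n) (G m) :=
  Nat.leRec (motive := fun m _ => Ren (G n) (G m)) (fun _ v => v) (fun _ _ r τ v => (r τ v).s) h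

theorem up_self (n : ℕ) : up (le_refl n) = fun _ v => v := Nat.leRec_self ..

theorem up_succ {n m : ℕ} (h : n ≤ m) :
    up (Nat.le_succ_of_le h) = fun τ v => (up h τ v).s := Nat.leRec_succ ..

theorem up_trans {n m k : ℕ} (h : n ≤ m) (h' : m ≤ k) :
    (fun τ v => up h' τ (up h τ v)) = up (h.trans h') := by
  induction h' with
  | refl => rw [up_self]
  | @step k h' ih =>
    show (fun τ v => up (Nat.le_succ_of_le h') τ (up h τ v)) = up (Nat.le_succ_of_le (h.trans h'))
    rw [up_succ h', up_succ (h.trans h'), ← ih]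

theorem tm_up_up {n m k : ℕ} (h : n ≤ m) (h' : m ≤ k) {τ : Ty} (t : Tm (G n) τ) :
    (t.rename (up h)).rename (up h') = t.rename (up (h.trans h')) := by
  rw [Tm.rename_rename, up_trans]

theorem fm_up_up {n m k : ℕ} (h : n ≤ m) (h' : m ≤ k) (φ : Fm (G n)) :
    (φ.rename (up h)).rename (up h') = φ.rename (up (h.trans h')) := by
  rw [Fm.rename_rename, up_trans]

theorem fm_up_self {n : ℕ} (h : n ≤ n) (φ : Fm (G n)) : φ.rename (up h) = φ := by
  rw [up_self, Fm.rename_id]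

theorem tm_up_self {n : ℕ} (h : n ≤ n) {τ : Ty} (t : Tm (G n) τ) : t.rename (up h) = t := by
  rw [up_self, Tm.rename_id]

theorem fm_up_succ {n : ℕ} (φ : Fm (G n)) :
    φ.rename (up (Nat.le_succ n)) = φ.wk := by
  have : up (Nat.le_succ n) = fun τ v => (up (le_refl n) τ v).s := up_succ (le_refl n)
  rw [this, up_self]; rfl

/-- The formula that the `n`-th Henkin constant witnesses. -/
noncomputable def wit (n : ℕ) : Fm (ty n :: G n) :=
  -- The number `n` codes a type, an earlier stage and the index of a formula of that stage.
  -- Components of a pair never exceed its code, so the default is never taken and the test only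
  -- supplies `h`.
  if h : n.unpair.2.unpair.1 ≤ n then
    (fmE (ty n :: G n.unpair.2.unpair.1) n.unpair.2.unpair.2).rename ((up h).lift _)
  else falsum

/-- The formula that is decided at stage `n`. -/
noncomputable def dec (n : ℕ) : Fm (G n) :=
  (fmE (G n.unpair.1) n.unpair.2).rename (up (Nat.unpair_left_le n))

-- The formula is accepted unless it is refutable, which keeps the assumptions consistent in either
-- case.
open Classical in
noncomputable def lit (T : Set (Fm [])) (n : ℕ) (Δ : List (Fm (G n))) : Fm (G n) :=
  if Prv T (G n) (dec n :: Δ) falsum then neg (dec n) else dec n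

/-- The Henkin axiom of the `n`-th constant. -/
noncomputable def hax (n : ℕ) : Fm (G (n + 1)) := (Fm.ex (ty n) (wit n)).wk.imp (wit n)

/-- The assumptions at stage `n`. -/
noncomputable def A (T : Set (Fm [])) (Δ : List (Fm [])) : ∀ n, List (Fm (G n))
  | 0 => Δ
  | n + 1 => hax n :: (lit T n (A T Δ n) :: A T Δ n).map Fm.wk

theorem exists_dec (n : ℕ) (φ : Fm (G n)) : ∃ k, ∃ h : n ≤ k, dec k = φ.rename (up h) := by
  obtain ⟨j, rfl⟩ := fmE_surjective _ φ
  refine ⟨Nat.pair n j, Nat.left_le_pair n j, ?_⟩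
  -- The type of the formula depends on the decoded pair, so that pair is generalized before it is
  -- replaced by `(n, j)`.
  have : ∀ p : ℕ × ℕ, p = (n, j) → ∀ (k : ℕ) (h : p.1 ≤ k) (h' : n ≤ k),
      (fmE (G p.1) p.2).rename (up h) = (fmE (G n) j).rename (up h') := by
    rintro _ rfl k h h'; rfl
  exact this _ (Nat.unpair_pair n j) _ _ _

/-- The type of the constant is obtained by decoding and equals `τ` only propositionally, whence the
transport. -/
theorem exists_wit (n : ℕ) (τ : Ty) (φ : Fm (τ :: G n)) :
    ∃ k, ∃ h : n ≤ k, ∃ hτ : τ = ty k,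
      wit k = (hτ ▸ φ : Fm (ty k :: G n)).rename ((up h).lift _) := by
  obtain ⟨a, ha⟩ := tyE_surjective τ
  obtain ⟨j, rfl⟩ := fmE_surjective _ φ
  have hn : n ≤ Nat.pair a (Nat.pair n j) :=
    (Nat.left_le_pair n j).trans (Nat.right_le_pair _ _)
  have hτ : τ = ty (Nat.pair a (Nat.pair n j)) := by
    rw [ty, Nat.unpair_pair]; exact ha.symm
  refine ⟨_, hn, hτ, ?_⟩
  have h1 : ∀ σ (h : τ = σ), (h ▸ fmE (τ :: G n) j : Fm (σ :: G n)) = fmE (σ :: G n) j := by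
    rintro _ rfl; rfl
  rw [h1]
  have h2 : ∀ p : ℕ × ℕ, p = (n, j) → ∀ (k : ℕ) (h' : n ≤ k),
      (if h : p.1 ≤ k then (fmE (ty k :: G p.1) p.2).rename ((up h).lift _) else falsum) =
        (fmE (ty k :: G n) j).rename ((up h').lift _) := by
    rintro _ rfl k h'; exact dif_pos h'
  exact h2 _ (by simp) _ _

/-- All types are inhabited by closed terms, so a variable that occurs in no assumption can be
eliminated from a refutation. -/
def closedTm : ∀ τ : Ty, Tm [] τ
  | .nat => O
  | .abs => zeroX
  | .fn σ τ => (.con (.pi τ σ))⬝(closedTm τ)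

theorem falsum_of_wk {Γ : Ctx} {τ : Ty} {Δ : List (Fm Γ)}
    (h : Prv T (τ :: Γ) (Δ.map Fm.wk) falsum) : Prv T Γ Δ falsum :=
  Prv.allE ((closedTm τ).emb) (Prv.allI h)

theorem consistent_lit {n : ℕ} {Δ : List (Fm (G n))} (h : ¬ Prv T (G n) Δ falsum) :
    ¬ Prv T (G n) (lit T n Δ :: Δ) falsum := by
  unfold lit
  split_ifs with h1
  · exact fun h2 => h (.orE (.lem (dec n)) h1 h2)
  · exact h1

/-- If the existential formula holds, its elimination makes the new constant a witness and the
Henkin axiom true; if it fails, the axiom holds vacuously. In both cases a refutation from the axiom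
would refute the old assumptions. -/
theorem consistent_hax {n : ℕ} {Δ : List (Fm (G n))} (h : ¬ Prv T (G n) Δ falsum) :
    ¬ Prv T (ty n :: G n) (hax n :: Δ.map Fm.wk) falsum := by
  intro h1
  have h2 := Prv.impI h1
  apply h
  refine .orE (.lem (.ex (ty n) (wit n))) (.exE (.hyp List.mem_cons_self) ?_) (falsum_of_wk (τ := ty n) ?_)
  · refine .impE (h2.weaken ?_) (.impI (.hyp ?_))
    · intro δ hδ; simp only [List.map_cons, List.mem_cons]; exact .inr (.inr hδ)
    · simp
  · refine .impE (h2.weaken ?_) (.impI (.efq (.impE (φ := (Fm.ex (ty n) (wit n)).wk) (.hyp ?_)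
      (.hyp List.mem_cons_self))))
    · intro δ hδ; simp only [List.map_cons, List.mem_cons]; exact .inr hδ
    · simp only [List.map_cons, List.mem_cons]; exact .inr (.inl rfl)

variable {Δ : List (Fm [])}

theorem consistent (h : ¬ Prv T [] Δ falsum) (n : ℕ) : ¬ Prv T (G n) (A T Δ n) falsum := by
  induction n with
  | zero => exact h
  | succ n ih => exact consistent_hax (consistent_lit ih)

theorem mem_A {n m : ℕ} (h : n ≤ m) (φ : Fm (G n)) (hφ : φ ∈ A T Δ n) :
    φ.rename (up h) ∈ A T Δ m := by
  induction h with
  | refl => rwa [up_self, Fm.rename_id]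
  | @step m h ih =>
    rw [show φ.rename (up (Nat.le_succ_of_le h)) = (φ.rename (up h)).wk by
      rw [up_succ h, Fm.wk, Fm.rename_rename]; rfl]
    exact List.mem_cons_of_mem _ (List.mem_map_of_mem (List.mem_cons_of_mem _ ih))

/-- The truths of the Henkin model. -/
def Th (T : Set (Fm [])) (Δ : List (Fm [])) (n : ℕ) (φ : Fm (G n)) : Prop :=
  ∃ m, ∃ h : n ≤ m, Prv T (G m) (A T Δ m) (φ.rename (up h))

theorem prv_up {n m : ℕ} (h : n ≤ m) {φ : Fm (G n)} (hφ : Prv T (G n) (A T Δ n) φ) :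
    Prv T (G m) (A T Δ m) (φ.rename (up h)) := hφ.rename _ (mem_A h)

theorem Th_up {n m : ℕ} (h : n ≤ m) (φ : Fm (G n)) :
    Th T Δ m (φ.rename (up h)) ↔ Th T Δ n φ := by
  constructor
  · rintro ⟨k, hk, h1⟩
    rw [fm_up_up] at h1
    exact ⟨k, _, h1⟩
  · rintro ⟨k, hk, h1⟩
    refine ⟨max m k, le_max_left _ _, ?_⟩
    have := prv_up (le_max_right m k) h1
    rw [fm_up_up] at this ⊢
    exact this

theorem Th.mp {n : ℕ} {φ ψ : Fm (G n)} (h : Th T Δ n (φ.imp ψ)) (h' : Th T Δ n φ) :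
    Th T Δ n ψ := by
  obtain ⟨m, hm, h⟩ := h
  obtain ⟨k, hk, h'⟩ := h'
  have h1 := prv_up (le_max_left m k) h
  have h2 := prv_up (le_max_right m k) h'
  rw [fm_up_up] at h1 h2
  exact ⟨max m k, _, .impE h1 h2⟩

theorem Th.of_prv {n : ℕ} {φ : Fm (G n)} (h : Prv T (G n) [] φ) : Th T Δ n φ :=
  ⟨n, le_rfl, by rw [fm_up_self]; exact h.weaken (by simp)⟩

theorem Th.of_mem {n : ℕ} {φ : Fm (G n)} (h : φ ∈ A T Δ n) : Th T Δ n φ :=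
  ⟨n, le_rfl, by rw [fm_up_self]; exact .hyp h⟩

theorem Th.mp₁ {n : ℕ} {φ ψ : Fm (G n)} (h : Prv T (G n) [φ] ψ) (h' : Th T Δ n φ) : Th T Δ n ψ :=
  (Th.of_prv (.impI h)).mp h'

theorem Th.mp₂ {n : ℕ} {φ ψ χ : Fm (G n)} (h : Prv T (G n) [ψ, φ] χ) (h1 : Th T Δ n φ)
    (h2 : Th T Δ n ψ) : Th T Δ n χ :=
  ((Th.of_prv (.impI (.impI h))).mp h1).mp h2

theorem Th.or_neg {n : ℕ} (φ : Fm (G n)) : Th T Δ n φ ∨ Th T Δ n (neg φ) := by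
  obtain ⟨k, h, hk⟩ := exists_dec n φ
  have hmem : Fm.wk (lit T k (A T Δ k)) ∈ A T Δ (k + 1) :=
    List.mem_cons_of_mem _ (List.mem_map_of_mem List.mem_cons_self)
  have h1 := Th.of_mem hmem
  rw [← fm_up_succ, Th_up] at h1
  unfold lit at h1
  rw [hk] at h1
  split_ifs at h1
  · exact .inr ((Th_up h (neg φ)).1 h1)
  · exact .inl ((Th_up h φ).1 h1)

theorem Th.not_falsum (h : ¬ Prv T [] Δ falsum) {n : ℕ} : ¬ Th T Δ n falsum := by
  rintro ⟨m, hm, h'⟩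
  exact consistent h m h'

theorem Th.witness {n : ℕ} {τ : Ty} {φ : Fm (τ :: G n)} (h : Th T Δ n (.ex τ φ)) :
    ∃ m, ∃ h : n ≤ m, ∃ t : Tm (G m) τ, Th T Δ m ((φ.rename ((up h).lift τ)).inst t) := by
  obtain ⟨k, hk, hτ, hw⟩ := exists_wit n τ φ
  subst hτ
  refine ⟨k + 1, Nat.le_succ_of_le hk, (.var .z : Tm (ty k :: G k) (ty k)), ?_⟩
  have h1 : Th T Δ (k + 1) (hax k) := Th.of_mem List.mem_cons_self
  have h2 : Th T Δ (k + 1) (Fm.ex (ty k) (wit k)).wk := by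
    rw [← fm_up_succ, Th_up, hw]
    exact (Th_up hk _).2 h
  have h3 := h1.mp h2
  refine Eq.mp (congrArg (Th T Δ (k + 1)) (Eq.trans hw ?_)) h3
  -- The newest variable is the witness: the matrix is its own instance at that variable after
  -- weakening.
  rw [← Fm.rename_lift_inst (Fm.rename _ φ), Fm.rename_rename, Ren.lift_comp, up_succ hk]
  rfl

/-! ### The model -/

/-- Elements of the Henkin model are represented by terms over the Henkin constants. -/
abbrev Pre (τ : Ty) := Σ n, Tm (G n) τ

/-- Two terms are identified if no context of type `N` tells them apart. -/
def Rel (T : Set (Fm [])) (Δ : List (Fm [])) {τ : Ty} (p q : Pre τ) : Prop :=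
  ∀ k (hp : p.1 ≤ k) (hq : q.1 ≤ k) (r : Tm (τ :: G k) N),
    Th T Δ k (.eq (r.inst (p.2.rename (up hp))) (r.inst (q.2.rename (up hq))))

theorem Th.eq_trans {n : ℕ} {a b c : Tm (G n) N} (h : Th T Δ n (.eq a b))
    (h' : Th T Δ n (.eq b c)) : Th T Δ n (.eq a c) :=
  Th.mp₂ (.trans (.hyp (List.mem_cons_of_mem _ List.mem_cons_self)) (.hyp List.mem_cons_self)) h h'

theorem Th.eq_symm {n : ℕ} {a b : Tm (G n) N} (h : Th T Δ n (.eq a b)) : Th T Δ n (.eq b a) :=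
  Th.mp₁ (.symm (.hyp List.mem_cons_self)) h

theorem Rel.refl {τ : Ty} (p : Pre τ) : Rel T Δ p p := fun _ _ _ _ => Th.of_prv (.refl _)

theorem Rel.symm {τ : Ty} {p q : Pre τ} (h : Rel T Δ p q) : Rel T Δ q p :=
  fun k hp hq r => (h k hq hp r).eq_symm

theorem Rel.trans {τ : Ty} {p q s : Pre τ} (h : Rel T Δ p q) (h' : Rel T Δ q s) :
    Rel T Δ p s := by
  intro k hp hs r
  have hk := le_max_left k q.1
  rw [← Th_up hk]
  have h1 := h (max k q.1) (hp.trans hk) (le_max_right _ _) (r.rename ((up hk).lift τ))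
  have h2 := h' (max k q.1) (le_max_right _ _) (hs.trans hk) (r.rename ((up hk).lift τ))
  simp only [Fm.rename, Tm.inst_rename, tm_up_up]
  exact h1.eq_trans h2

def setoid (T : Set (Fm [])) (Δ : List (Fm [])) (τ : Ty) : Setoid (Pre τ) :=
  ⟨Rel T Δ, Rel.refl, Rel.symm, Rel.trans⟩

def D (T : Set (Fm [])) (Δ : List (Fm [])) (τ : Ty) : Type := Quotient (setoid T Δ τ)

def mk (T : Set (Fm [])) (Δ : List (Fm [])) (n : ℕ) {τ : Ty} (t : Tm (G n) τ) : D T Δ τ :=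
  Quotient.mk (setoid T Δ τ) ⟨n, t⟩

theorem mk_up {n m : ℕ} (h : n ≤ m) {τ : Ty} (t : Tm (G n) τ) :
    mk T Δ m (t.rename (up h)) = mk T Δ n t := by
  refine Quotient.sound (fun k hp hq r => ?_)
  simp only [tm_up_up]
  exact Th.of_prv (.refl _)

/-- Plugging one context into another; used to read a context around `f⬝a` as a context around `f`
or around `a`. -/
theorem Tm.inst_subst_hole {Γ : Ctx} {σ τ ρ : Ty} (r : Tm (τ :: Γ) ρ) (c : Tm (σ :: Γ) τ)
    (a : Tm Γ σ) :
    (r.subst (Sub.cons c (fun _ v => .var (.s v)))).inst a = r.inst (c.inst a) := by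
  rw [Tm.inst, Tm.subst_subst, Tm.inst]
  congr 1
  funext τ v; cases v <;> rfl

/-- First the function is exchanged inside the context `r(·⬝a)`, then the argument inside `r(f'⬝·)`.
-/
theorem Rel.app {σ τ : Ty} {f f' : Pre (σ⇒τ)} {a a' : Pre σ} (hf : Rel T Δ f f')
    (ha : Rel T Δ a a') :
    Rel T Δ (⟨max f.1 a.1, (f.2.rename (up (le_max_left _ _)))⬝(a.2.rename (up (le_max_right _ _)))⟩
        : Pre τ)
      ⟨max f'.1 a'.1, (f'.2.rename (up (le_max_left _ _)))⬝(a'.2.rename (up (le_max_right _ _)))⟩ := by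
  intro k hp hq r
  simp only [Tm.app_rename, tm_up_up]
  have hfk : f.1 ≤ k := (le_max_left _ _).trans hp
  have hfk' : f'.1 ≤ k := (le_max_left _ _).trans hq
  have hak : a.1 ≤ k := (le_max_right _ _).trans hp
  have hak' : a'.1 ≤ k := (le_max_right _ _).trans hq
  have h1 := hf k hfk hfk'
    (r.subst (Sub.cons (v0⬝(a.2.rename (up hak)).wk) (fun _ v => .var (.s v))))
  have h2 := ha k hak hak'
    (r.subst (Sub.cons ((f'.2.rename (up hfk')).wk⬝v0) (fun _ v => .var (.s v))))
  have e1 : ∀ (g : Tm (G k) (σ⇒τ)) (b : Tm (G k) σ), (v0⬝b.wk).inst g = g⬝b := fun g b =>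
    congrArg (Tm.app g) (Tm.wk_inst b g)
  have e2 : ∀ (g : Tm (G k) (σ⇒τ)) (b : Tm (G k) σ), (g.wk⬝v0).inst b = g⬝b := fun g b =>
    congrArg (Tm.app · b) (Tm.wk_inst g b)
  rw [Tm.inst_subst_hole, Tm.inst_subst_hole, e1, e1] at h1
  rw [Tm.inst_subst_hole, Tm.inst_subst_hole, e2, e2] at h2
  exact h1.eq_trans h2

/-- The term structure. -/
noncomputable def str (T : Set (Fm [])) (Δ : List (Fm [])) : Str where
  D := D T Δ
  app {σ τ} := Quotient.map₂ (sa := setoid T Δ (σ⇒τ)) (sb := setoid T Δ σ) (sc := setoid T Δ τ)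
    (fun f a => ⟨max f.1 a.1,
      (f.2.rename (up (le_max_left _ _)))⬝(a.2.rename (up (le_max_right _ _)))⟩)
    (fun _ _ hf _ _ ha => Rel.app hf ha)
  con c := mk T Δ 0 (.con c)

noncomputable def env (T : Set (Fm [])) (Δ : List (Fm [])) {Γ : Ctx} {n : ℕ} (s : Sub Γ (G n)) :
    (str T Δ).Env Γ :=
  fun τ v => mk T Δ n (s τ v)

theorem app_mk {n : ℕ} {σ τ : Ty} (f : Tm (G n) (σ⇒τ)) (a : Tm (G n) σ) :
    (str T Δ).app (mk T Δ n f) (mk T Δ n a) = mk T Δ n (f⬝a) := by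
  rw [← mk_up (le_max_left n n) (f⬝a)]; rfl

theorem eval_mk {Γ : Ctx} {n : ℕ} (s : Sub Γ (G n)) {τ : Ty} (t : Tm Γ τ) :
    (str T Δ).eval t (env T Δ s) = mk T Δ n (t.subst s) := by
  induction t with
  | var v => rfl
  | con c => exact (mk_up (Nat.zero_le n) (.con c)).symm
  | app f a hf ha => rw [Str.eval_app, hf, ha, app_mk]; rfl

/-- At type `0` indistinguishability is derivable equality: the trivial context gives one direction.
For the other, the extensionality rule is applied with the equation itself as its quantifier-free
premise, which makes it available under an assumption. -/
theorem mk_eq_mk_iff {n : ℕ} (a b : Tm (G n) N) :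
    mk T Δ n a = mk T Δ n b ↔ Th T Δ n (.eq a b) := by
  constructor
  · intro h
    have h1 := (Quotient.exact h : Rel T Δ ⟨n, a⟩ ⟨n, b⟩) n le_rfl le_rfl v0
    rw [tm_up_self, tm_up_self] at h1
    exact h1
  · intro h
    refine Quotient.sound (fun k hp hq r => ?_)
    have h1 := (Th_up hp _).2 h
    exact (Th.of_prv (.qfer (A := .eq (a.rename (up hp)) (b.rename (up hp))) r trivial
      (.impI (.hyp List.mem_cons_self)))).mp h1

theorem exists_mk {τ : Ty} (d : D T Δ τ) : ∃ n, ∃ t : Tm (G n) τ, d = mk T Δ n t := by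
  induction d using Quotient.inductionOn with
  | h p => exact ⟨p.1, p.2, rfl⟩

theorem mk_cons {Γ : Ctx} {n m k : ℕ} (hn : n ≤ k) (hm : m ≤ k) {τ : Ty} (t : Tm (G m) τ)
    (s : Sub Γ (G n)) :
    Str.cons (M := str T Δ) (mk T Δ m t) (env T Δ s) =
      env T Δ (Sub.cons (t.rename (up hm)) (fun σ v => (s σ v).rename (up hn))) := by
  funext σ v
  cases v with
  | z => exact (mk_up hm t).symm
  | s v => exact (mk_up hn _).symm

theorem exists_sub {Γ : Ctx} (e : (str T Δ).Env Γ) :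
    ∃ n, ∃ s : Sub Γ (G n), e = env T Δ s := by
  induction Γ with
  | nil => exact ⟨0, (fun _ v => .var v : Sub [] []), Str.env_nil_eq _ _⟩
  | cons τ Γ ih =>
    obtain ⟨n, s, hs⟩ := ih (fun σ v => e σ (.s v))
    obtain ⟨m, t, ht⟩ := exists_mk (e τ .z)
    refine ⟨max n m, _, Eq.trans ?_ (mk_cons (le_max_left n m) (le_max_right n m) t s)⟩
    funext σ v
    cases v with
    | z => exact ht
    | s v => exact congrFun (congrFun hs σ) v

/-- Truth lemma. Disjunction, implication and the universal quantifier use that every formula or its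
negation is a truth; the quantifiers use Henkin witnesses and the fact that every element is named
by a term. -/
theorem sat_iff (hc : ¬ Prv T [] Δ falsum) {Γ : Ctx} (φ : Fm Γ) :
    ∀ {n : ℕ} (s : Sub Γ (G n)),
      (str T Δ).Sat φ (env T Δ s) ↔ Th T Δ n (φ.subst s) := by
  have cons_up : ∀ {Γ : Ctx} {n k : ℕ} (h : n ≤ k) (s : Sub Γ (G n)) {τ : Ty} (t : Tm (G k) τ)
      (φ : Fm (τ :: Γ)), φ.subst (Sub.cons t (fun σ v => (s σ v).rename (up h))) =
        ((φ.subst (s.lift τ)).rename ((up h).lift τ)).inst t := by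
    intro Γ n k h s τ t φ
    rw [Fm.rename_subst, Sub.ren_lift, Fm.subst_lift_inst]
  induction φ with
  | eq a b => intro n s; rw [Str.sat_eq, eval_mk, eval_mk]; exact mk_eq_mk_iff _ _
  | and φ ψ h1 h2 =>
    intro n s
    rw [Str.sat_and, h1 s, h2 s]
    exact ⟨fun h => Th.mp₂ (.andI (.hyp (List.mem_cons_of_mem _ List.mem_cons_self))
      (.hyp List.mem_cons_self)) h.1 h.2, fun h => ⟨Th.mp₁ (.andL (.hyp List.mem_cons_self)) h,
      Th.mp₁ (.andR (.hyp List.mem_cons_self)) h⟩⟩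
  | or φ ψ h1 h2 =>
    intro n s
    rw [Str.sat_or, h1 s, h2 s]
    constructor
    · rintro (h | h)
      · exact Th.mp₁ (.orL (.hyp List.mem_cons_self)) h
      · exact Th.mp₁ (.orR (.hyp List.mem_cons_self)) h
    · intro h
      by_contra hn
      push Not at hn
      have ha := (Th.or_neg (T := T) (Δ := Δ) (φ.subst s)).resolve_left hn.1
      have hb := (Th.or_neg (T := T) (Δ := Δ) (ψ.subst s)).resolve_left hn.2
      have hp : Prv T (G n) [(φ.subst s).or (ψ.subst s), neg (ψ.subst s), neg (φ.subst s)]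
          falsum := by
        refine .orE (.hyp List.mem_cons_self) (.impE (φ := φ.subst s) (.hyp ?_)
          (.hyp List.mem_cons_self)) (.impE (φ := ψ.subst s) (.hyp ?_) (.hyp List.mem_cons_self))
          <;> simp
      exact Th.not_falsum hc (((Th.of_prv (.impI (.impI (.impI hp)))).mp ha |>.mp hb).mp h)
  | imp φ ψ h1 h2 =>
    intro n s
    rw [Str.sat_imp, h1 s, h2 s]
    constructor
    · intro h
      rcases Th.or_neg (T := T) (Δ := Δ) (φ.subst s) with ha | ha
      · exact Th.mp₁ (.impI (.hyp (List.mem_cons_of_mem _ List.mem_cons_self))) (h ha)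
      · exact Th.mp₁ (.impI (.efq (.impE (.hyp (List.mem_cons_of_mem _ List.mem_cons_self))
          (.hyp List.mem_cons_self)))) ha
    · intro h ha
      exact Th.mp (φ := φ.subst s) h ha
  | all τ φ ih =>
    intro n s
    constructor
    · intro h
      by_contra hn
      have h1 := (Th.or_neg (T := T) (Δ := Δ) ((Fm.all τ φ).subst s)).resolve_left hn
      -- Classically the failure of the universal formula gives a counterexample, and its Henkin
      -- witness is an element of the model.
      have h2 : Th T Δ n (.ex τ (neg (φ.subst (s.lift τ)))) := by
        refine Th.mp₁ (.orE (.lem (.ex τ (neg (φ.subst (s.lift τ))))) (.hyp List.mem_cons_self)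
          (.efq (.impE (.hyp (List.mem_cons_of_mem _ List.mem_cons_self)) (.allI
            (.orE (.lem (φ.subst (s.lift τ))) (.hyp List.mem_cons_self)
              (.efq (.impE (φ := (Fm.ex τ (neg (φ.subst (s.lift τ)))).wk) (.hyp
                (List.mem_cons_of_mem _ List.mem_cons_self))
                (.exI v0 (.hyp ?_)))))))) ) h1
        refine List.mem_cons.2 (.inl ?_)
        exact Fm.rename_lift_inst (neg (φ.subst (s.lift τ)))
      obtain ⟨m, hm, t, h3⟩ := h2.witness
      have h4 := h (mk T Δ m t)
      rw [mk_cons hm le_rfl, tm_up_self, ih, cons_up] at h4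
      exact Th.not_falsum hc (Th.mp (φ := ((φ.subst (s.lift τ)).rename ((up hm).lift τ)).inst t)
        h3 h4)
    · intro h d
      obtain ⟨m, t, rfl⟩ := exists_mk d
      have h1 := (Th_up (le_max_left n m) _).2 h
      rw [mk_cons (le_max_left n m) (le_max_right n m), ih, cons_up]
      exact Th.mp₁ (.allE _ (.hyp List.mem_cons_self)) h1
  | ex τ φ ih =>
    intro n s
    constructor
    · rintro ⟨d, hd⟩
      obtain ⟨m, t, rfl⟩ := exists_mk d
      rw [mk_cons (le_max_left n m) (le_max_right n m), ih, cons_up] at hd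
      rw [← Th_up (le_max_left n m)]
      exact Th.mp₁ (.exI _ (.hyp List.mem_cons_self)) hd
    · intro h
      obtain ⟨m, hm, t, h3⟩ := h.witness
      refine ⟨mk T Δ m t, ?_⟩
      rw [mk_cons hm le_rfl, tm_up_self, ih, cons_up]
      exact h3

noncomputable def model (hc : ¬ Prv T [] Δ falsum) : Model T where
  toStr := str T Δ
  sound {φ} h := by
    have h1 := (sat_iff hc φ (n := 0) (fun _ v => .var v)).2
      ((Fm.subst_var φ).symm ▸ Th.of_prv (n := 0) h)
    rwa [Str.env_nil_eq (env T Δ _) (str T Δ).nil] at h1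
  ext {Γ τ s t} h e := by
    obtain ⟨n, σ, rfl⟩ := exists_sub e
    rw [eval_mk, eval_mk]
    refine Quotient.sound (fun k hp hq r => ?_)
    -- The equation is derived without assumptions, so the extensionality rule with the trivial
    -- premise `0 = 0` transfers it to every context of type `0`.
    have h1 := (h.subst σ).rename (Δ' := []) (up hp) (by simp)
    rw [eqT_subst, eqT_rename] at h1
    exact (Th.of_prv (.qfer (A := .eq O O) r trivial
      (.impI (h1.weaken (by simp))))).mp (Th.of_prv (.refl _))
  not_falsum h := by
    rw [Str.env_nil_eq (str T Δ).nil (env T Δ (n := 0) (fun _ v => .var v)), sat_iff hc] at h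
    exact Th.not_falsum hc h

end Henkin

/-- Gödel's completeness theorem for the sentences of the language. -/
theorem Proves.of_forall_model {φ : Fm []} (h : ∀ M : Model T, M.Sat φ M.nil) : Proves T φ := by
  by_contra hn
  have hc : ¬ Prv T [] [neg φ] falsum := fun h1 =>
    hn (.orE (.lem φ) (.hyp List.mem_cons_self) (.efq h1))
  have h0 : (Henkin.str T [neg φ]).Sat φ (Henkin.str T [neg φ]).nil := h (Henkin.model hc)
  rw [Str.env_nil_eq (Henkin.str T [neg φ]).nil
    (Henkin.env T [neg φ] (n := 0) (fun _ v => .var v)), Henkin.sat_iff hc] at h0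
  have h1 : Henkin.Th T [neg φ] 0 φ := Eq.mp (congrArg (Henkin.Th T [neg φ] 0) (Fm.subst_var φ)) h0
  exact Henkin.Th.not_falsum hc (Henkin.Th.mp (Henkin.Th.of_mem (n := 0) List.mem_cons_self) h1)

end Comon

namespace Comon

/-! ## Semantics of terms and formulas in a model -/

section Semantics
variable {M : Str} {Γ Δ : Ctx}

@[simp] theorem Str.eval_z {σ : Ty} (a : M.D σ) (e : M.Env Γ) :
    M.eval (.var .z) (Str.cons a e) = a := rfl

@[simp] theorem Str.eval_s {σ τ : Ty} (a : M.D σ) (e : M.Env Γ) (v : Var Γ τ) :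
    M.eval (.var (.s v)) (Str.cons a e) = M.eval (.var v) e := rfl

@[simp] theorem Str.eval_con {τ : Ty} (c : Con τ) (e : M.Env Γ) : M.eval (.con c) e = M.con c := rfl

attribute [simp] Str.eval_app Str.sat_eq Str.sat_and Str.sat_or Str.sat_imp Str.sat_all Str.sat_ex

theorem Str.eval_rename (r : Ren Γ Δ) {τ : Ty} (t : Tm Γ τ) (e : M.Env Δ) :
    M.eval (t.rename r) e = M.eval t (fun τ v => e τ (r τ v)) := by
  induction t with
  | var v => rfl
  | con c => rfl
  | app f a hf ha => rw [Tm.app_rename, Str.eval_app, hf, ha]; rfl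

@[simp] theorem Str.eval_emb {τ : Ty} (t : Tm [] τ) (e : M.Env Γ) :
    M.eval t.emb e = M.eval t M.nil := by
  rw [Tm.emb, Str.eval_rename]; exact congrArg _ (Str.env_nil_eq _ _)

@[simp] theorem Str.eval_wk {σ τ : Ty} (t : Tm Γ τ) (a : M.D σ) (e : M.Env Γ) :
    M.eval t.wk (Str.cons a e) = M.eval t e := Str.eval_rename _ _ _

theorem Str.eval_subst (s : Sub Γ Δ) {τ : Ty} (t : Tm Γ τ) (e : M.Env Δ) :
    M.eval (t.subst s) e = M.eval t (fun τ v => M.eval (s τ v) e) := by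
  induction t with
  | var v => rfl
  | con c => rfl
  | app f a hf ha => rw [Tm.subst, Str.eval_app, hf, ha]; rfl

theorem Str.eval_lift (s : Sub Γ Δ) {σ : Ty} (a : M.D σ) (e : M.Env Δ) :
    (fun τ v => M.eval (s.lift σ τ v) (Str.cons a e)) =
      Str.cons a (fun τ v => M.eval (s τ v) e) := by
  funext τ v
  cases v with
  | z => rfl
  | s v => exact Str.eval_wk _ _ _

theorem Str.sat_subst (s : Sub Γ Δ) (φ : Fm Γ) (e : M.Env Δ) :
    M.Sat (φ.subst s) e ↔ M.Sat φ (fun τ v => M.eval (s τ v) e) := by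
  induction φ generalizing Δ with
  | eq a b => rw [Fm.subst, Str.sat_eq, Str.eval_subst, Str.eval_subst]; rfl
  | and φ ψ h1 h2 => rw [Fm.subst, Str.sat_and, h1, h2]; rfl
  | or φ ψ h1 h2 => rw [Fm.subst, Str.sat_or, h1, h2]; rfl
  | imp φ ψ h1 h2 => rw [Fm.subst, Str.sat_imp, h1, h2]; rfl
  | all τ φ h => simp only [Fm.subst, Str.sat_all, h, Str.eval_lift]
  | ex τ φ h => simp only [Fm.subst, Str.sat_ex, h, Str.eval_lift]

/-- Only the equations for `Π` and `Σ` enter, required as identities of elements; `Model.ext`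
provides them. -/
theorem Str.eval_lamWith {σ : Ty} {e : M.Env Γ} {a : M.D σ} {e' : M.Env Δ}
    (hpi : ∀ {ρ τ : Ty} (x : M.D ρ) (y : M.D τ), M.app (M.app (M.con (.pi ρ τ)) x) y = x)
    (hsigma : ∀ {δ ρ τ : Ty} (x : M.D (δ⇒ρ⇒τ)) (y : M.D (δ⇒ρ)) (z : M.D δ),
      M.app (M.app (M.app (M.con (.sigma δ ρ τ)) x) y) z = M.app (M.app x z) (M.app y z))
    {h : ∀ ρ, Var Δ ρ → Tm Γ (σ⇒ρ)} (hh : ∀ ρ v, M.app (M.eval (h ρ v) e) a = e' ρ v)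
    {τ : Ty} (t : Tm Δ τ) : M.app (M.eval (lamWith h t) e) a = M.eval t e' := by
  induction t with
  | var v => exact hh _ v
  | con c => exact hpi _ _
  | app f b hf hb => simp only [lamWith, Str.eval_app, Str.eval_con, hsigma, hf, hb]

end Semantics

namespace Model
variable {T : Set (Fm [])} (M : Model T)

theorem sound_open {Γ : Ctx} {φ : Fm Γ} (h : Prv T Γ [] φ) (e : M.Env Γ) : M.Sat φ e := by
  induction Γ with
  | nil => rw [Str.env_nil_eq e M.nil]; exact M.sound h
  | cons τ Γ ih =>
    have h1 := ih (Prv.allI h) (fun σ v => e σ (.s v)) (e τ .z)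
    convert h1 using 1
    funext σ v; cases v <;> rfl

/-- At higher types the defining equations are pointwise down to `=₀` and `=_X`; since they are
derivable, `Model.ext` makes them identities. -/
theorem app_pi {ρ τ : Ty} (x : M.D ρ) (y : M.D τ) :
    M.app (M.app (M.con (.pi ρ τ)) x) y = x :=
  M.ext (Prv.pi (v1 : Tm [τ, ρ] ρ) v0) (Str.cons y (Str.cons x M.nil))

theorem app_sigma {δ ρ τ : Ty} (x : M.D (δ⇒ρ⇒τ)) (y : M.D (δ⇒ρ)) (z : M.D δ) :
    M.app (M.app (M.app (M.con (.sigma δ ρ τ)) x) y) z = M.app (M.app x z) (M.app y z) :=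
  M.ext (Prv.sigma (v2 : Tm [δ, δ⇒ρ, δ⇒ρ⇒τ] _) v1 v0)
    (Str.cons z (Str.cons y (Str.cons x M.nil)))

@[simp] theorem app_lam {Γ : Ctx} {σ τ : Ty} (t : Tm (σ :: Γ) τ) (e : M.Env Γ) (a : M.D σ) :
    M.app (M.eval (lam t) e) a = M.eval t (Str.cons a e) := by
  refine Str.eval_lamWith M.app_pi M.app_sigma ?_ t
  intro ρ v
  cases v with
  | z => simp only [lamVar, Str.eval_app, Str.eval_con, app_sigma, app_pi]; rfl
  | s v => simp only [lamVar, Str.eval_app, Str.eval_con, app_pi]; rfl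

/-! ### Recursion and induction -/

instance : Zero (M.D N) := ⟨M.con .zero⟩

def suc (a : M.D N) : M.D N := M.app (M.con .succ) a

def recur (x a : M.D N) (f : M.D (N⇒N⇒N)) : M.D N :=
  M.app (M.app (M.app (M.con (.recur [N] .z)) x) a) f

def toVar {τ : Ty} {F : Ty → Type} (a : F τ) : ∀ σ, Var [τ] σ → F σ
  | _, .z => a

theorem recur_zero (a : M.D N) (f : M.D (N⇒N⇒N)) : M.recur 0 a f = a :=
  M.ext (Prv.recZero (Γ := [N⇒N⇒N, N]) (.z : Var [N] N) (toVar (F := Tm _) v1)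
    (fun σ v => match σ, v with | _, .z => v0)) (Str.cons f (Str.cons a M.nil))

theorem recur_suc (x a : M.D N) (f : M.D (N⇒N⇒N)) :
    M.recur (M.suc x) a f = M.app (M.app f (M.recur x a f)) x :=
  M.ext (Prv.recSucc (Γ := [N, N⇒N⇒N, N]) (.z : Var [N] N) v0 (toVar (F := Tm _) v2)
    (fun σ v => match σ, v with | _, .z => v1)) (Str.cons x (Str.cons f (Str.cons a M.nil)))

theorem eval_recN {Γ : Ctx} (x a : Tm Γ N) (f : Tm Γ (N⇒N⇒N)) (e : M.Env Γ) :
    M.eval (recN x a f) e = M.recur (M.eval x e) (M.eval a e) (M.eval f e) := rfl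

@[simp] theorem con_zero : M.con .zero = 0 := rfl

@[simp] theorem app_succ (a : M.D N) : M.app (M.con .succ) a = M.suc a := rfl

theorem suc_ne_zero (a : M.D N) : M.suc a ≠ 0 := fun h =>
  M.not_falsum (M.sound_open (Prv.succNe (v0 : Tm [N] N)) (Str.cons a M.nil) h)

theorem suc_injective {a b : M.D N} (h : M.suc a = M.suc b) : a = b :=
  M.sound_open (Prv.impI (Prv.succInj (Prv.hyp List.mem_cons_self)) :
    Prv T [N, N] [] ((Fm.eq (S v0) (S v1)).imp (.eq v0 v1))) (Str.cons a (Str.cons b M.nil)) h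

/-- Induction for definable predicates. -/
theorem induction {P : M.D N → Prop} {Γ : Ctx} (φ : Fm (N :: Γ)) (e : M.Env Γ)
    (hP : ∀ n, M.Sat φ (Str.cons n e) ↔ P n) (zero : P 0) (suc : ∀ n, P n → P (M.suc n)) (n : M.D N) :
    P n := by
  have h : Prv T Γ [] ((φ.inst O).imp ((Fm.all N (φ.imp (φ.subst (Sub.succ Γ)))).imp (.all N φ))) :=
    .impI (.impI (.ind φ (.hyp (List.mem_cons_of_mem _ List.mem_cons_self))
      (.hyp List.mem_cons_self)))
  rw [← hP]
  refine M.sound_open h e ?_ ?_ n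
  · rw [Fm.inst, Str.sat_subst]
    convert (hP 0).2 zero using 1
    funext τ v; cases v <;> rfl
  · intro n hn
    rw [Str.sat_subst]
    convert (hP _).2 (suc n ((hP n).1 hn)) using 1
    funext τ v; cases v <;> rfl

/-! ### Arithmetic -/

instance : One (M.D N) := ⟨M.suc 0⟩
instance : Add (M.D N) := ⟨fun a b => M.app (M.app (M.eval tPlus M.nil) a) b⟩
instance : Mul (M.D N) := ⟨fun a b => M.app (M.app (M.eval tTimes M.nil) a) b⟩
instance : _root_.Sub (M.D N) := ⟨fun a b => M.app (M.app (M.eval tMonus M.nil) a) b⟩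
def prd (a : M.D N) : M.D N := M.app (M.eval tPred M.nil) a

section
variable {Γ : Ctx} (e : M.Env Γ)

@[simp] theorem app_plus (a b : M.D N) :
    M.app (M.app (M.eval tPlus M.nil) a) b = a + b := rfl
@[simp] theorem app_times (a b : M.D N) :
    M.app (M.app (M.eval tTimes M.nil) a) b = a * b := rfl
@[simp] theorem app_monus (a b : M.D N) :
    M.app (M.app (M.eval tMonus M.nil) a) b = a - b := rfl
@[simp] theorem app_pred (a : M.D N) : M.app (M.eval tPred M.nil) a = M.prd a := rfl
end

variable {M}

@[simp] theorem prd_zero : M.prd 0 = 0 := by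
  rw [← app_pred]; simp [tPred, eval_recN, recur_zero]
@[simp] theorem prd_suc (a : M.D N) : M.prd (M.suc a) = a := by
  rw [← app_pred]; simp [tPred, eval_recN, recur_suc]

/-- In the recursion equations the step functions are evaluated in environments that contain
different recursion arguments, so pointwise agreement is what is at hand. Elements of function type
need not be determined by their values, hence an induction. -/
theorem recur_congr {f f' : M.D (N⇒N⇒N)} (h : ∀ r c, M.app (M.app f r) c = M.app (M.app f' r) c)
    (x a : M.D N) : M.recur x a f = M.recur x a f' := by
  refine M.induction (Γ := [N⇒N⇒N, N⇒N⇒N, N]) (.eq (recN v0 v3 v1) (recN v0 v3 v2))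
    (Str.cons f (Str.cons f' (Str.cons a M.nil))) (P := fun x => M.recur x a f = M.recur x a f')
    (fun n => Iff.rfl) ?_ ?_ x
  · rw [recur_zero, recur_zero]
  · intro n hn; rw [recur_suc, recur_suc, hn, h]

theorem add_zero' (a : M.D N) : a + 0 = a := by
  rw [← app_plus]; simp only [tPlus, app_lam, eval_recN, Str.eval_z]; rw [recur_zero]; simp
theorem add_suc (a b : M.D N) : a + M.suc b = M.suc (a + b) := by
  rw [← app_plus, ← app_plus]; simp only [tPlus, app_lam, eval_recN, Str.eval_z, recur_suc]
  simp only [Str.eval_app, Str.eval_con, Str.eval_z, Str.eval_s, app_succ]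
  exact congrArg M.suc (recur_congr (fun r c => by simp) _ _)
theorem sub_zero' (a : M.D N) : a - 0 = a := by
  rw [← app_monus]; simp [tMonus, eval_recN, recur_zero]
theorem sub_suc (a b : M.D N) : a - M.suc b = M.prd (a - b) := by
  rw [← app_monus, ← app_monus]; simp [tMonus, eval_recN, recur_suc]
  exact congrArg M.prd (recur_congr (fun r c => by simp) _ _)
theorem mul_zero' (a : M.D N) : a * 0 = 0 := by
  rw [← app_times]; simp [tTimes, eval_recN, recur_zero]
theorem mul_suc (a b : M.D N) : a * M.suc b = a * b + a := by
  rw [← app_times, ← app_times]; simp [tTimes, eval_recN, recur_suc]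
  exact congrArg (· + a) (recur_congr (fun r c => by simp) _ _)

theorem zero_add' (a : M.D N) : 0 + a = a := by
  refine M.induction (Γ := []) (.eq (plus O v0) v0) M.nil (P := fun a => 0 + a = a)
    (fun n => by simp) ?_ ?_ a
  · exact add_zero' 0
  · intro n hn; rw [add_suc, hn]

theorem suc_add (a b : M.D N) : M.suc a + b = M.suc (a + b) := by
  refine M.induction (Γ := [N]) (.eq (plus (S v1) v0) (S (plus v1 v0))) (Str.cons a M.nil)
    (P := fun b => M.suc a + b = M.suc (a + b)) (fun n => by simp) ?_ ?_ b
  · rw [add_zero', add_zero']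
  · intro n hn; rw [add_suc, hn, add_suc]

theorem add_comm' (a b : M.D N) : a + b = b + a := by
  refine M.induction (Γ := [N]) (.eq (plus v1 v0) (plus v0 v1)) (Str.cons a M.nil)
    (P := fun b => a + b = b + a) (fun n => by simp) ?_ ?_ b
  · rw [add_zero', zero_add']
  · intro n hn; rw [add_suc, hn, suc_add]

theorem add_assoc' (a b c : M.D N) : a + b + c = a + (b + c) := by
  refine M.induction (Γ := [N, N]) (.eq (plus (plus v2 v1) v0) (plus v2 (plus v1 v0)))
    (Str.cons b (Str.cons a M.nil)) (P := fun c => a + b + c = a + (b + c))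
    (fun n => by simp) ?_ ?_ c
  · rw [add_zero', add_zero']
  · intro n hn; rw [add_suc, hn, add_suc, add_suc]

theorem zero_mul' (a : M.D N) : 0 * a = 0 := by
  refine M.induction (Γ := []) (.eq (times O v0) O) M.nil (P := fun a => 0 * a = 0)
    (fun n => by simp) ?_ ?_ a
  · exact mul_zero' 0
  · intro n hn; rw [mul_suc, hn, add_zero']

theorem suc_mul (a b : M.D N) : M.suc a * b = a * b + b := by
  refine M.induction (Γ := [N]) (.eq (times (S v1) v0) (plus (times v1 v0) v0)) (Str.cons a M.nil)
    (P := fun b => M.suc a * b = a * b + b) (fun n => by simp) ?_ ?_ b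
  · rw [mul_zero', mul_zero', add_zero']
  · intro n hn
    rw [mul_suc, hn, mul_suc, add_suc, add_suc, add_assoc', add_assoc', add_comm' n a]

theorem mul_comm' (a b : M.D N) : a * b = b * a := by
  refine M.induction (Γ := [N]) (.eq (times v1 v0) (times v0 v1)) (Str.cons a M.nil)
    (P := fun b => a * b = b * a) (fun n => by simp) ?_ ?_ b
  · rw [mul_zero', zero_mul']
  · intro n hn; rw [mul_suc, hn, suc_mul]

theorem mul_add' (a b c : M.D N) : a * (b + c) = a * b + a * c := by
  refine M.induction (Γ := [N, N]) (.eq (times v2 (plus v1 v0)) (plus (times v2 v1) (times v2 v0)))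
    (Str.cons b (Str.cons a M.nil)) (P := fun c => a * (b + c) = a * b + a * c)
    (fun n => by simp) ?_ ?_ c
  · rw [add_zero', mul_zero', add_zero']
  · intro n hn; rw [add_suc, mul_suc, hn, mul_suc, add_assoc']

theorem mul_assoc' (a b c : M.D N) : a * b * c = a * (b * c) := by
  refine M.induction (Γ := [N, N]) (.eq (times (times v2 v1) v0) (times v2 (times v1 v0)))
    (Str.cons b (Str.cons a M.nil)) (P := fun c => a * b * c = a * (b * c))
    (fun n => by simp) ?_ ?_ c
  · rw [mul_zero', mul_zero', mul_zero']
  · intro n hn; rw [mul_suc, hn, mul_suc, mul_add']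

theorem mul_one' (a : M.D N) : a * 1 = a := by
  show a * M.suc 0 = a
  rw [mul_suc, mul_zero', zero_add']

/-! ### The type-`0` objects as an ordered semiring with truncated subtraction -/

instance : CommSemiring (M.D N) where
  add_assoc := add_assoc'
  zero_add := zero_add'
  add_zero := add_zero'
  add_comm := add_comm'
  nsmul := nsmulRec
  left_distrib := mul_add'
  right_distrib a b c := by rw [mul_comm', mul_add', mul_comm' c, mul_comm' c]
  zero_mul := zero_mul'
  mul_zero := mul_zero'
  mul_assoc := mul_assoc'
  one_mul a := by rw [mul_comm', mul_one']
  mul_one := mul_one'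
  mul_comm := mul_comm'

@[simp] theorem suc_eq (a : M.D N) : M.suc a = a + 1 := by
  show M.suc a = a + M.suc 0
  rw [add_suc, add_zero']

theorem nat_ind {P : M.D N → Prop} {Γ : Ctx} (φ : Fm (N :: Γ)) (e : M.Env Γ)
    (hP : ∀ n, M.Sat φ (Str.cons n e) ↔ P n) (zero : P 0) (suc : ∀ n, P n → P (n + 1))
    (n : M.D N) : P n :=
  M.induction φ e hP zero (fun n hn => by rw [suc_eq]; exact suc n hn) n

/-- Iterated injectivity of the successor; antisymmetry of the order defined by addition depends on
it. -/
theorem add_right_cancel' {a b : M.D N} (c : M.D N) (h : a + c = b + c) : a = b := by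
  refine nat_ind (Γ := [N, N]) (.imp (.eq (plus v2 v0) (plus v1 v0)) (.eq v2 v1))
    (Str.cons b (Str.cons a M.nil)) (P := fun c => a + c = b + c → a = b)
    (fun n => by simp) ?_ ?_ c h
  · simp
  · intro n hn h
    rw [← add_assoc, ← add_assoc, ← suc_eq, ← suc_eq] at h
    exact hn (M.suc_injective h)

theorem add_one_ne_zero (a : M.D N) : a + 1 ≠ 0 := by
  rw [← suc_eq]; exact M.suc_ne_zero a

theorem eq_zero_or_suc (a : M.D N) : a = 0 ∨ ∃ b, a = b + 1 := by
  refine nat_ind (Γ := []) (.or (.eq v0 O) (.ex N (.eq v1 (S v0)))) M.nil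
    (P := fun a => a = 0 ∨ ∃ b, a = b + 1) (fun n => by simp) ?_ ?_ a
  · exact .inl rfl
  · exact fun n _ => .inr ⟨n, rfl⟩

theorem le_total' (a b : M.D N) : (∃ c, b = a + c) ∨ ∃ c, a = b + c := by
  refine nat_ind (Γ := [N]) (.or (.ex N (.eq v2 (plus v1 v0))) (.ex N (.eq v1 (plus v2 v0))))
    (Str.cons b M.nil) (P := fun a => (∃ c, b = a + c) ∨ ∃ c, a = b + c) (fun n => by simp) ?_ ?_ a
  · exact .inl ⟨b, (zero_add b).symm⟩
  · rintro n (⟨c, rfl⟩ | ⟨c, rfl⟩)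
    · rcases eq_zero_or_suc c with rfl | ⟨d, rfl⟩
      · exact .inr ⟨1, by ring⟩
      · exact .inl ⟨d, by ring⟩
    · exact .inr ⟨c + 1, by ring⟩

noncomputable instance : LinearOrder (M.D N) where
  le a b := ∃ c, b = a + c
  le_refl a := ⟨0, (add_zero a).symm⟩
  le_trans a b c := by rintro ⟨x, rfl⟩ ⟨y, rfl⟩; exact ⟨x + y, add_assoc _ _ _⟩
  le_antisymm a b := by
    rintro ⟨x, rfl⟩ ⟨y, h⟩
    have h1 : 0 + a = (x + y) + a := by rw [zero_add]; nth_rewrite 1 [h]; ring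
    have h2 := add_right_cancel' _ h1
    rcases eq_zero_or_suc x with rfl | ⟨z, rfl⟩
    · exact (add_zero a).symm
    · exact absurd h2.symm (by rw [add_right_comm]; exact add_one_ne_zero _)
  le_total a b := le_total' a b
  toDecidableLE := Classical.decRel _

theorem zero_le' (a : M.D N) : 0 ≤ a := ⟨a, (zero_add a).symm⟩

instance : IsOrderedCancelAddMonoid (M.D N) where
  add_le_add_left a b h c := by
    obtain ⟨d, rfl⟩ := h; exact ⟨d, by ring⟩
  le_of_add_le_add_left a b c h := by
    obtain ⟨d, h⟩ := h
    exact ⟨d, add_right_cancel' a (by rw [add_comm c, h]; ring)⟩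

instance : CanonicallyOrderedAdd (M.D N) where
  exists_add_of_le h := h
  le_self_add _ b := ⟨b, rfl⟩
  le_add_self _ b := ⟨b, add_comm _ _⟩

theorem lt_iff {a b : M.D N} : a < b ↔ ∃ c, b = a + c + 1 := by
  constructor
  · intro h
    obtain ⟨c, rfl⟩ := h.le
    rcases eq_zero_or_suc c with rfl | ⟨d, rfl⟩
    · simp at h
    · exact ⟨d, by ring⟩
  · rintro ⟨c, rfl⟩
    refine lt_of_le_of_ne ⟨c + 1, by ring⟩ fun h => add_one_ne_zero c ?_
    exact (add_right_cancel' a (by rw [zero_add]; nth_rewrite 1 [h]; ring)).symm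

theorem add_one_le_iff {a b : M.D N} : a + 1 ≤ b ↔ a < b := by
  rw [lt_iff]
  constructor
  · rintro ⟨c, rfl⟩; exact ⟨c, by ring⟩
  · rintro ⟨c, rfl⟩; exact ⟨c, by ring⟩

theorem lt_add_one_iff {a b : M.D N} : a < b + 1 ↔ a ≤ b := by
  rw [← add_one_le_iff]; exact add_le_add_iff_right 1

theorem mul_lt_mul_left' {a b c : M.D N} (hb : b < c) (ha : 0 < a) : a * b < a * c := by
  obtain ⟨d, rfl⟩ := lt_iff.1 hb
  obtain ⟨e, rfl⟩ := lt_iff.1 ha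
  exact lt_iff.2 ⟨e * d + e + d, by ring⟩

instance : IsStrictOrderedRing (M.D N) where
  zero_le_one := zero_le' _
  exists_pair_ne := ⟨0, 1, fun h => add_one_ne_zero (0 : M.D N) (by rw [zero_add, ← h])⟩
  mul_lt_mul_of_pos_left _ ha _ _ h := mul_lt_mul_left' h ha
  mul_lt_mul_of_pos_right _ ha b c h := by
    rw [mul_comm b, mul_comm c]; exact mul_lt_mul_left' h ha

theorem add_one_sub_add_one (a b : M.D N) : (a + 1) - (b + 1) = a - b := by
  refine nat_ind (Γ := [N]) (.eq (monus (S v1) (S v0)) (monus v1 v0)) (Str.cons a M.nil)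
    (P := fun b => (a + 1) - (b + 1) = a - b) (fun n => by simp) ?_ ?_ b
  · rw [← suc_eq, ← suc_eq, sub_suc, sub_zero', prd_suc, sub_zero']
  · intro n hn
    rw [← suc_eq (n + 1), sub_suc, hn, ← suc_eq n, sub_suc]

theorem add_sub_add (a b c : M.D N) : (a + c) - (b + c) = a - b := by
  refine nat_ind (Γ := [N, N]) (.eq (monus (plus v1 v0) (plus v2 v0)) (monus v1 v2))
    (Str.cons a (Str.cons b M.nil)) (P := fun c => (a + c) - (b + c) = a - b)
    (fun n => by simp) ?_ ?_ c
  · simp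
  · intro n hn
    rw [← add_assoc, ← add_assoc, add_one_sub_add_one, hn]

theorem zero_sub' (a : M.D N) : 0 - a = 0 := by
  refine nat_ind (Γ := []) (.eq (monus O v0) O) M.nil (P := fun a => 0 - a = 0)
    (fun n => by simp) (sub_zero' 0) ?_ a
  intro n hn; rw [← suc_eq, sub_suc, hn, prd_zero]

theorem add_sub_self (a b : M.D N) : (a + b) - b = a := by
  have := add_sub_add a 0 b
  rwa [zero_add, sub_zero'] at this

theorem sub_add_self (a b : M.D N) : b - (a + b) = 0 := by
  have := add_sub_add 0 a b
  rwa [zero_add, zero_sub'] at this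

/-- This makes the defined formula `leN`, which says that a truncated difference vanishes, express
the order. -/
instance : OrderedSub (M.D N) where
  tsub_le_iff_right a b c := by
    rcases le_total a b with ⟨d, rfl⟩ | ⟨d, rfl⟩
    · rw [add_comm a d, sub_add_self]
      exact ⟨fun _ => le_trans le_add_self le_add_self, fun _ => zero_le' _⟩
    · rw [add_comm b d, add_sub_self]; exact (add_le_add_iff_right b).symm

end Model
end Comon

namespace Comon

/-! ## Ordered rings from cones -/

/-- The linear order with a given set of nonnegative elements. -/
noncomputable abbrev orderOfCone {A : Type*} [CommRing A] (P : A → Prop) (zero : P 0)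
    (add : ∀ {a b}, P a → P b → P (a + b)) (anti : ∀ {a}, P a → P (-a) → a = 0)
    (total : ∀ a, P a ∨ P (-a)) : LinearOrder A where
  le a b := P (b - a)
  le_refl a := by simpa using zero
  le_trans a b c h h' := by simpa using add h' h
  le_antisymm a b h h' := by
    have := anti h (by simpa using h')
    exact (sub_eq_zero.1 this).symm
  le_total a b := by simpa using total (b - a)
  toDecidableLE := Classical.decRel _

/-- One is nonnegative because either `1` or `-1` is and `(-1)² = 1`; products of positive elements
stay nonzero because there are no zero divisors. -/
theorem strictOrderedRing_of_cone {A : Type*} [CommRing A] [Nontrivial A] [NoZeroDivisors A]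
    (P : A → Prop) (zero : P 0)
    (add : ∀ {a b}, P a → P b → P (a + b)) (anti : ∀ {a}, P a → P (-a) → a = 0)
    (total : ∀ a, P a ∨ P (-a)) (mul : ∀ {a b}, P a → P b → P (a * b)) :
    letI := orderOfCone P zero add anti total
    IsStrictOrderedRing A := by
  let _ := orderOfCone P zero add anti total
  have hle : ∀ {a b : A}, a ≤ b ↔ P (b - a) := Iff.rfl
  have : IsOrderedAddMonoid A :=
    ⟨fun a b h c => by rw [hle] at h ⊢; simpa using h, fun a b h c => by rw [hle] at h ⊢; simpa using h⟩
  have : ZeroLEOneClass A := ⟨by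
    rw [hle, sub_zero]
    rcases total 1 with h | h
    · exact h
    · simpa using mul h h⟩
  refine .of_mul_pos fun a b ha hb => ?_
  refine lt_of_le_of_ne ?_ (mul_ne_zero ha.ne' hb.ne').symm
  have ha' := hle.1 ha.le
  have hb' := hle.1 hb.le
  rw [sub_zero] at ha' hb'
  rw [hle, sub_zero]
  exact mul ha' hb'

/-! ## Fractions over an ordered semiring -/

section Fractions
variable (R : Type*) [CommSemiring R] [LinearOrder R] [IsStrictOrderedRing R]

/-- A representation `(p - q) / d` of a fraction over `R`. -/
structure PreFrac where
  p : R
  q : R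
  d : R
  pos : 0 < d

variable {R}

namespace PreFrac

/-- Cross-multiplication with the subtracted parts moved to the other side, since `R` has no
subtraction. -/
def Rel (a b : PreFrac R) : Prop := a.p * b.d + b.q * a.d = b.p * a.d + a.q * b.d

theorem Rel.trans {a b c : PreFrac R} (h : Rel a b) (h' : Rel b c) : Rel a c := by
  unfold Rel at *
  have key : (a.p * c.d + c.q * a.d) * b.d = (c.p * a.d + a.q * c.d) * b.d := by
    linear_combination c.d * h + a.d * h'
  exact le_antisymm (le_of_mul_le_mul_right key.le b.pos) (le_of_mul_le_mul_right key.ge b.pos)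

instance setoid : Setoid (PreFrac R) :=
  ⟨Rel, fun a => add_comm _ _ |>.trans (by ring), fun {a b} h => by
    unfold Rel at *; linear_combination h.symm, Rel.trans⟩

def add (a b : PreFrac R) : PreFrac R :=
  ⟨a.p * b.d + b.p * a.d, a.q * b.d + b.q * a.d, a.d * b.d, mul_pos a.pos b.pos⟩

def mul (a b : PreFrac R) : PreFrac R :=
  ⟨a.p * b.p + a.q * b.q, a.p * b.q + a.q * b.p, a.d * b.d, mul_pos a.pos b.pos⟩

def neg (a : PreFrac R) : PreFrac R := ⟨a.q, a.p, a.d, a.pos⟩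

end PreFrac

variable (R) in
/-- The ordered ring of fractions `(p - q) / d` over `R`. -/
def Frac := Quotient (PreFrac.setoid (R := R))

namespace Frac
open PreFrac

def mk (p q d : R) (h : 0 < d) : Frac R := Quotient.mk (PreFrac.setoid (R := R)) ⟨p, q, d, h⟩

theorem mk_eq_mk {p q d p' q' d' : R} {h : 0 < d} {h' : 0 < d'} :
    mk p q d h = mk p' q' d' h' ↔ p * d' + q' * d = p' * d + q * d' :=
  ⟨fun e => Quotient.exact e, fun e => Quotient.sound e⟩

instance : Zero (Frac R) := ⟨mk 0 0 1 one_pos⟩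
instance : One (Frac R) := ⟨mk 1 0 1 one_pos⟩
instance : Neg (Frac R) := ⟨Quotient.map PreFrac.neg fun a b h => by
  change PreFrac.Rel _ _ at h; change PreFrac.Rel _ _
  simp only [PreFrac.Rel, PreFrac.neg] at *; linear_combination h.symm⟩
instance : Add (Frac R) := ⟨Quotient.map₂ PreFrac.add fun a b h a' b' h' => by
  change PreFrac.Rel _ _ at h; change PreFrac.Rel _ _ at h'; change PreFrac.Rel _ _
  simp only [PreFrac.Rel, PreFrac.add] at *
  linear_combination a'.d * b'.d * h + a.d * b.d * h'⟩
instance : Mul (Frac R) := ⟨Quotient.map₂ PreFrac.mul fun a b h a' b' h' => by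
  have h1 : PreFrac.Rel (a.mul a') (b.mul a') := by
    change PreFrac.Rel _ _ at h
    simp only [PreFrac.Rel, PreFrac.mul] at *
    linear_combination a'.p * a'.d * h + a'.q * a'.d * h.symm
  have h2 : PreFrac.Rel (b.mul a') (b.mul b') := by
    change PreFrac.Rel _ _ at h'
    simp only [PreFrac.Rel, PreFrac.mul] at *
    linear_combination b.p * b.d * h' + b.q * b.d * h'.symm
  exact h1.trans h2⟩

theorem mk_add_mk (p q d p' q' d' : R) (h : 0 < d) (h' : 0 < d') :
    mk p q d h + mk p' q' d' h' = mk (p * d' + p' * d) (q * d' + q' * d) (d * d') (mul_pos h h') :=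
  rfl

theorem mk_mul_mk (p q d p' q' d' : R) (h : 0 < d) (h' : 0 < d') :
    mk p q d h * mk p' q' d' h' = mk (p * p' + q * q') (p * q' + q * p') (d * d') (mul_pos h h') :=
  rfl

theorem neg_mk (p q d : R) (h : 0 < d) : -mk p q d h = mk q p d h := rfl

theorem zero_def : (0 : Frac R) = mk 0 0 1 one_pos := rfl

theorem one_def : (1 : Frac R) = mk 1 0 1 one_pos := rfl

theorem ind {P : Frac R → Prop} (h : ∀ p q d hd, P (mk p q d hd)) (a : Frac R) : P a :=
  Quotient.inductionOn a fun a => h a.p a.q a.d a.pos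

instance : CommRing (Frac R) where
  add_assoc a b c := by
    induction a using ind; induction b using ind; induction c using ind
    simp only [mk_add_mk, mk_eq_mk]; ring
  zero_add a := by
    induction a using ind
    simp only [zero_def, mk_add_mk, mk_eq_mk]; ring
  add_zero a := by
    induction a using ind
    simp only [zero_def, mk_add_mk, mk_eq_mk]; ring
  add_comm a b := by
    induction a using ind; induction b using ind
    simp only [mk_add_mk, mk_eq_mk]; ring
  nsmul := nsmulRec
  zsmul := zsmulRec
  left_distrib a b c := by
    induction a using ind; induction b using ind; induction c using ind
    simp only [mk_add_mk, mk_mul_mk, mk_eq_mk]; ring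
  right_distrib a b c := by
    induction a using ind; induction b using ind; induction c using ind
    simp only [mk_add_mk, mk_mul_mk, mk_eq_mk]; ring
  zero_mul a := by
    induction a using ind
    simp only [zero_def, mk_mul_mk, mk_eq_mk]; ring
  mul_zero a := by
    induction a using ind
    simp only [zero_def, mk_mul_mk, mk_eq_mk]; ring
  mul_assoc a b c := by
    induction a using ind; induction b using ind; induction c using ind
    simp only [mk_mul_mk, mk_eq_mk]; ring
  one_mul a := by
    induction a using ind
    simp only [one_def, mk_mul_mk, mk_eq_mk]; ring
  mul_one a := by
    induction a using ind
    simp only [one_def, mk_mul_mk, mk_eq_mk]; ring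
  mul_comm a b := by
    induction a using ind; induction b using ind
    simp only [mk_mul_mk, mk_eq_mk]; ring
  neg_add_cancel a := by
    induction a using ind
    simp only [zero_def, neg_mk, mk_add_mk, mk_eq_mk]; ring

def Nonneg : Frac R → Prop := Quotient.lift (fun a => a.q ≤ a.p) fun a b h => by
  have key : ∀ {a b : PreFrac R}, PreFrac.Rel a b → a.q ≤ a.p → b.q ≤ b.p := by
    intro a b h hle
    refine le_of_mul_le_mul_right ?_ a.pos
    have h1 : a.q * b.d ≤ a.p * b.d := mul_le_mul_of_nonneg_right hle b.pos.le
    unfold PreFrac.Rel at h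
    have h2 : b.q * a.d + a.p * b.d ≤ b.p * a.d + a.p * b.d := by
      rw [add_comm, h]; exact add_le_add_right h1 _
    exact le_of_add_le_add_right h2
  exact propext ⟨key h, key (Setoid.symm h)⟩

theorem nonneg_mk {p q d : R} {h : 0 < d} : Nonneg (mk p q d h) ↔ q ≤ p := Iff.rfl

theorem Nonneg.zero : Nonneg (0 : Frac R) := le_refl (0 : R)

theorem Nonneg.add {a b : Frac R} (ha : Nonneg a) (hb : Nonneg b) : Nonneg (a + b) := by
  induction a using ind with | _ p q d hd
  induction b using ind with | _ p' q' d' hd'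
  rw [nonneg_mk] at ha hb
  rw [mk_add_mk, nonneg_mk]
  exact add_le_add (mul_le_mul_of_nonneg_right ha hd'.le) (mul_le_mul_of_nonneg_right hb hd.le)

theorem Nonneg.anti {a : Frac R} (ha : Nonneg a) (hb : Nonneg (-a)) : a = 0 := by
  induction a using ind with | _ p q d hd
  rw [neg_mk, nonneg_mk] at hb
  rw [nonneg_mk] at ha
  rw [zero_def, mk_eq_mk, le_antisymm ha hb]; ring

theorem Nonneg.total (a : Frac R) : Nonneg a ∨ Nonneg (-a) := by
  induction a using ind with | _ p q d hd
  rw [neg_mk, nonneg_mk, nonneg_mk]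
  exact le_total q p

noncomputable instance : LinearOrder (Frac R) :=
  orderOfCone Nonneg Nonneg.zero Nonneg.add Nonneg.anti Nonneg.total

theorem mk_le_mk {p q d p' q' d' : R} {h : 0 < d} {h' : 0 < d'} :
    mk p q d h ≤ mk p' q' d' h' ↔ p * d' + q' * d ≤ p' * d + q * d' := by
  change Nonneg (mk p' q' d' h' - mk p q d h) ↔ _
  rw [sub_eq_add_neg, neg_mk, mk_add_mk, nonneg_mk, add_comm (q' * d)]

theorem mk_lt_mk {p q d p' q' d' : R} {h : 0 < d} {h' : 0 < d'} :
    mk p q d h < mk p' q' d' h' ↔ p * d' + q' * d < p' * d + q * d' := by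
  rw [← not_le, mk_le_mk, not_le]

variable [CanonicallyOrderedAdd R]

/-- With numerators `(q + x) - q` and `(q' + y) - q'`, the numerator of the product is `xy`. -/
theorem Nonneg.mul {a b : Frac R} (ha : Nonneg a) (hb : Nonneg b) : Nonneg (a * b) := by
  induction a using ind with | _ p q d hd
  induction b using ind with | _ p' q' d' hd'
  rw [nonneg_mk] at ha hb
  obtain ⟨x, rfl⟩ := exists_add_of_le ha
  obtain ⟨y, rfl⟩ := exists_add_of_le hb
  rw [mk_mul_mk, nonneg_mk, show (q + x) * (q' + y) + q * q' =
    (q + x) * q' + q * (q' + y) + x * y by ring]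
  exact le_self_add

instance : Nontrivial (Frac R) :=
  ⟨0, 1, fun h => by rw [zero_def, one_def, mk_eq_mk] at h; simp at h⟩

/-- A nonzero fraction is `±x/d` with `x, d > 0`, and a product of such fractions has a positive
numerator up to sign. -/
instance : NoZeroDivisors (Frac R) := ⟨fun {a b} h => by
  have key : ∀ a : Frac R, a ≠ 0 → ∃ x d : R, 0 < x ∧ ∃ hd : 0 < d,
      a = mk x 0 d hd ∨ a = - mk x 0 d hd := by
    intro a ha
    induction a using ind with | _ p q d hd
    rcases lt_trichotomy p q with h | h | h
    · obtain ⟨x, rfl⟩ := exists_add_of_le h.le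
      refine ⟨x, d, pos_of_lt_add_right h, hd, .inr ?_⟩
      rw [neg_mk, mk_eq_mk]; ring
    · exact absurd (by rw [zero_def, mk_eq_mk, h]; ring) ha
    · obtain ⟨x, rfl⟩ := exists_add_of_le h.le
      refine ⟨x, d, pos_of_lt_add_right h, hd, .inl ?_⟩
      rw [mk_eq_mk]; ring
  by_contra hn
  push Not at hn
  obtain ⟨x, d, hx, hd, ha⟩ := key a hn.1
  obtain ⟨y, e, hy, he, hb⟩ := key b hn.2
  have h1 : mk x 0 d hd * mk y 0 e he ≠ 0 := by
    rw [mk_mul_mk, zero_def, Ne, mk_eq_mk]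
    simpa using (mul_pos hx hy).ne'
  apply h1
  rcases ha with rfl | rfl <;> rcases hb with rfl | rfl <;> simpa using h⟩

instance : IsStrictOrderedRing (Frac R) :=
  strictOrderedRing_of_cone Nonneg Nonneg.zero Nonneg.add Nonneg.anti Nonneg.total Nonneg.mul

end Frac
end Fractions
end Comon

namespace Comon
open Filter

/-! ## Limits of sequences with a fixed rate of convergence -/

/-- A scale `n ↦ 2⁻ⁿ` of elements of `K`, indexed by `R`, such that `2ⁿ` is unbounded in `K`. -/
class Scale (R : outParam Type) (K : Type) [CommSemiring R] [LinearOrder R] [IsStrictOrderedRing R]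
    [CommRing K] [LinearOrder K] [IsStrictOrderedRing K] where
  tw : R → K
  tw_pos : ∀ n, 0 < tw n
  tw_le_one : ∀ n, tw n ≤ 1
  tw_add : ∀ n m, tw (n + m) = tw n * tw m
  tw_one : 2 * tw 1 = 1
  exists_lt : ∀ x : K, 0 < x → ∃ n, tw n < x
  bdd : ∀ x : K, ∃ n, |x| * tw n ≤ 1

namespace Completion
open Scale
variable {R K : Type} [CommSemiring R] [LinearOrder R] [IsStrictOrderedRing R]
    [CommRing K] [LinearOrder K] [IsStrictOrderedRing K] [Scale R K]

theorem tw_succ (n : R) : 2 * tw (K := K) (n + 1) = tw n := by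
  rw [tw_add]; linear_combination tw n * tw_one (K := K)

variable (K) in
/-- The bounded functions. -/
def bounded : Subring (R → K) where
  carrier := {f | ∃ n, ∀ i, |f i| * tw n ≤ 1}
  mul_mem' {f g} := by
    rintro ⟨n, hn⟩ ⟨m, hm⟩
    refine ⟨n + m, fun i => ?_⟩
    have h1 := mul_le_mul (hn i) (hm i) (mul_nonneg (abs_nonneg _) (tw_pos m).le) zero_le_one
    rw [Pi.mul_apply, abs_mul, tw_add]
    linarith
  one_mem' := ⟨0, fun i => by simpa using tw_le_one (0 : R)⟩
  add_mem' {f g} := by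
    rintro ⟨n, hn⟩ ⟨m, hm⟩
    -- Because `2ⁿ + 2ᵐ ≤ 2ⁿ⁺ᵐ⁺¹`.
    refine ⟨n + m + 1, fun i => ?_⟩
    have h1 : |f i| * tw n * tw m ≤ 1 * 1 :=
      mul_le_mul (hn i) (tw_le_one m) (tw_pos m).le zero_le_one
    have h2 : |g i| * tw m * tw n ≤ 1 * 1 :=
      mul_le_mul (hm i) (tw_le_one n) (tw_pos n).le zero_le_one
    have h3 := mul_le_mul_of_nonneg_right (abs_add_le (f i) (g i)) (tw_pos (K := K) (n + m)).le
    rw [Pi.add_apply]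
    have h4 := tw_succ (K := K) (n + m)
    have h5 : tw (K := K) (n + m) = tw n * tw m := tw_add n m
    have h6 : |f i + g i| * tw (n + m + 1) * 2 = |f i + g i| * tw (n + m) := by rw [← h4]; ring
    rw [h5] at h3 h6
    linarith
  zero_mem' := ⟨0, fun i => by simp⟩
  neg_mem' {f} := by
    rintro ⟨n, hn⟩
    exact ⟨n, fun i => by simpa using hn i⟩

-- An ultrafilter, and not just `atTop`, so that any two bounded functions become comparable; see
-- `Pos.total`.
variable (R) in
noncomputable def filt : Ultrafilter R := Ultrafilter.of atTop

theorem eventually_filt {p : R → Prop} (h : ∀ᶠ i in atTop, p i) : ∀ᶠ i in filt R, p i :=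
  Ultrafilter.of_le atTop h

/-- Nonnegativity up to infinitesimals. -/
def Pos (f : bounded K) : Prop := ∀ k : R, ∀ᶠ i in filt R, -tw k ≤ f.1 i

theorem Pos.add {f g : bounded K} (hf : Pos f) (hg : Pos g) : Pos (f + g) := by
  intro k
  filter_upwards [hf (k + 1), hg (k + 1)] with i h1 h2
  have := tw_succ (K := K) k
  change -tw k ≤ f.1 i + g.1 i
  linarith

theorem Pos.mul {f g : bounded K} (hf : Pos f) (hg : Pos g) : Pos (f * g) := by
  intro k
  obtain ⟨n, hn⟩ := f.2
  obtain ⟨m, hm⟩ := g.2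
  -- Each factor is tested with a precision that absorbs the bound `2ᵐ` or `2ⁿ` of the other one.
  filter_upwards [hf (k + m), hg (k + n)] with i h1 h2
  have hn := hn i
  have hm := hm i
  have hfn := le_abs_self (f.1 i)
  have hgm := le_abs_self (g.1 i)
  have pn := tw_pos (K := K) n
  have pm := tw_pos (K := K) m
  have pk := tw_pos (K := K) k
  change -tw k ≤ f.1 i * g.1 i
  rw [tw_add] at h1 h2
  rcases le_total 0 (f.1 i) with hf0 | hf0 <;> rcases le_total 0 (g.1 i) with hg0 | hg0
  · nlinarith [mul_nonneg hf0 hg0]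
  · rw [abs_of_nonneg hf0] at hn
    have h3 := mul_le_mul_of_nonneg_left h2 hf0
    have h4 := mul_le_mul_of_nonneg_left hn pk.le
    linarith
  · rw [abs_of_nonneg hg0] at hm
    have h3 := mul_le_mul_of_nonneg_right h1 hg0
    have h4 := mul_le_mul_of_nonneg_left hm pk.le
    linarith
  · linarith [mul_nonneg_of_nonpos_of_nonpos hf0 hg0]

theorem not_pos_iff {f : bounded K} : ¬ Pos f ↔ ∃ k : R, ∀ᶠ i in filt R, f.1 i < -tw k := by
  unfold Pos
  simp only [not_forall, ← Ultrafilter.eventually_not, not_le]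

theorem Pos.total (f : bounded K) : Pos f ∨ Pos (-f) := by
  by_contra h
  push Not at h
  obtain ⟨k, hk⟩ := not_pos_iff.1 h.1
  obtain ⟨l, hl⟩ := not_pos_iff.1 h.2
  obtain ⟨i, h1, h2⟩ := (hk.and hl).exists
  have h2 : -f.1 i < -tw l := h2
  linarith [tw_pos (K := K) k, tw_pos (K := K) l]

theorem Pos.zero : Pos (0 : bounded K) := fun k => .of_forall fun i => by
  change -tw k ≤ (0 : K)
  linarith [tw_pos (K := K) k]

variable (K) in
/-- The infinitesimal functions. -/
def infinitesimal : Ideal (bounded K) where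
  carrier := {f | Pos f ∧ Pos (-f)}
  add_mem' {f g} hf hg := ⟨hf.1.add hg.1, by rw [neg_add]; exact hf.2.add hg.2⟩
  zero_mem' := ⟨Pos.zero, by rw [neg_zero]; exact Pos.zero⟩
  smul_mem' f g hg := by
    rw [smul_eq_mul]
    rcases Pos.total f with h | h
    · exact ⟨h.mul hg.1, by rw [← mul_neg]; exact h.mul hg.2⟩
    · exact ⟨by rw [← neg_mul_neg]; exact h.mul hg.2, by rw [← neg_mul]; exact h.mul hg.1⟩

variable (K) in
/-- The ordered ring in which sequences with a fixed rate of convergence have limits. -/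
def Real := bounded K ⧸ infinitesimal K

instance : CommRing (Real K) := inferInstanceAs <| CommRing (bounded K ⧸ infinitesimal K)

def mk : bounded K →+* Real K := Ideal.Quotient.mk (infinitesimal K)

def Nonneg (x : Real K) : Prop := ∃ f, Pos f ∧ mk f = x

theorem nonneg_mk {f : bounded K} : Nonneg (mk f) ↔ Pos f := by
  constructor
  · rintro ⟨g, hg, h⟩
    have := (Ideal.Quotient.eq.1 h).2
    simpa using hg.add this
  · exact fun h => ⟨f, h, rfl⟩

theorem ind {P : Real K → Prop} (h : ∀ f, P (mk f)) (x : Real K) : P x := by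
  obtain ⟨f, rfl⟩ := Ideal.Quotient.mk_surjective x
  exact h f

theorem Nonneg.zero : Nonneg (0 : Real K) := ⟨0, Pos.zero, rfl⟩

theorem Nonneg.add {x y : Real K} : Nonneg x → Nonneg y → Nonneg (x + y) := by
  rintro ⟨f, hf, rfl⟩ ⟨g, hg, rfl⟩
  exact ⟨f + g, hf.add hg, rfl⟩

theorem Nonneg.mul {x y : Real K} : Nonneg x → Nonneg y → Nonneg (x * y) := by
  rintro ⟨f, hf, rfl⟩ ⟨g, hg, rfl⟩
  exact ⟨f * g, hf.mul hg, rfl⟩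

theorem mk_eq_zero_iff {f : bounded K} : mk f = 0 ↔ Pos f ∧ Pos (-f) :=
  Ideal.Quotient.eq_zero_iff_mem

theorem Nonneg.anti {x : Real K} (h : Nonneg x) (h' : Nonneg (-x)) : x = 0 := by
  induction x using ind with | _ f
  exact mk_eq_zero_iff.2 ⟨nonneg_mk.1 h, nonneg_mk.1 h'⟩

theorem Nonneg.total (x : Real K) : Nonneg x ∨ Nonneg (-x) := by
  induction x using ind with | _ f
  exact (Pos.total f).imp nonneg_mk.2 nonneg_mk.2

instance : Nontrivial (Real K) := ⟨1, 0, fun h => by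
  obtain ⟨i, hi⟩ := ((mk_eq_zero_iff (f := 1)).1 h |>.2 (1 : R)).exists
  have hi : -tw (1 : R) ≤ (-1 : K) := hi
  linarith [tw_one (K := K)]⟩

/-- A nonzero class stays away from `0` by some `2⁻ᵏ` on a set of the ultrafilter; two such sets
meet, and there the product exceeds `2⁻⁽ᵏ⁺ˡ⁾` in absolute value. -/
instance : NoZeroDivisors (Real K) := ⟨fun {x y} h => by
  induction x using ind with | _ f
  induction y using ind with | _ g
  have key : ∀ f : bounded K, mk f ≠ 0 → ∃ k : R, ∀ᶠ i in filt R, tw k < |f.1 i| := by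
    intro f hf
    rw [Ne, mk_eq_zero_iff, not_and_or, not_pos_iff, not_pos_iff] at hf
    rcases hf with ⟨k, hk⟩ | ⟨k, hk⟩ <;> refine ⟨k, hk.mono fun i hi => ?_⟩
    · exact lt_of_lt_of_le (lt_neg_of_lt_neg hi) (neg_le_abs _)
    · exact lt_of_lt_of_le (neg_lt_neg_iff.1 hi) (le_abs_self _)
  by_contra hn
  push Not at hn
  obtain ⟨k, hk⟩ := key f hn.1
  obtain ⟨l, hl⟩ := key g hn.2
  obtain ⟨h1, h2⟩ := (mk_eq_zero_iff (f := f * g)).1 h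
  obtain ⟨i, hk, hl, h1, h2⟩ := (hk.and (hl.and ((h1 (k + l)).and (h2 (k + l))))).exists
  have h1 : -tw (k + l) ≤ f.1 i * g.1 i := h1
  have h2 : -tw (k + l) ≤ -(f.1 i * g.1 i) := h2
  have h3 : |f.1 i * g.1 i| ≤ tw (k + l) := abs_le.2 ⟨h1, by linarith⟩
  rw [abs_mul, tw_add] at h3
  exact absurd (mul_lt_mul'' hk hl (tw_pos k).le (tw_pos l).le) (not_lt.2 h3)⟩

noncomputable instance : LinearOrder (Real K) :=
  orderOfCone Nonneg Nonneg.zero Nonneg.add Nonneg.anti Nonneg.total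

instance : IsStrictOrderedRing (Real K) :=
  strictOrderedRing_of_cone Nonneg Nonneg.zero Nonneg.add Nonneg.anti Nonneg.total Nonneg.mul

variable (K) in
/-- The embedding of `K`. -/
def const : K →+* Real K :=
  mk.comp
    { toFun := fun x => ⟨fun _ => x, by
        obtain ⟨n, hn⟩ := Scale.bdd x
        exact ⟨n, fun _ => hn⟩⟩
      map_one' := rfl
      map_mul' := fun _ _ => rfl
      map_zero' := rfl
      map_add' := fun _ _ => rfl }

theorem const_nonneg {x : K} (h : 0 ≤ x) : 0 ≤ const K x := by
  change Nonneg (const K x - 0)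
  rw [sub_zero]
  refine nonneg_mk.2 fun k => .of_forall fun i => ?_
  change -tw k ≤ x
  linarith [tw_pos (K := K) k]

theorem const_strictMono : StrictMono (const K) := by
  refine Monotone.strictMono_of_injective (fun x y h => ?_) ?_
  · rw [← sub_nonneg, ← map_sub]; exact const_nonneg (sub_nonneg.2 h)
  · rw [injective_iff_map_eq_zero]
    intro x hx
    obtain ⟨h1, h2⟩ := mk_eq_zero_iff.1 hx
    by_contra hne
    obtain ⟨n, hn⟩ := Scale.exists_lt |x| (abs_pos.2 hne)
    obtain ⟨i, h1, h2⟩ := ((h1 n).and (h2 n)).exists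
    have h1 : -tw n ≤ x := h1
    have h2 : -tw n ≤ -x := h2
    exact absurd (abs_le.2 ⟨h1, by linarith⟩) (not_le.2 hn)

/-- Infinitesimals have been divided out, so the scale of `K` still tends to `0` in the quotient. -/
theorem exists_const_lt {x : Real K} (hx : 0 < x) : ∃ n : R, const K (tw n) < x := by
  induction x using ind with | _ f
  have h : ¬ Pos (-f) := fun h => hx.not_ge <| by
    change Nonneg (0 - mk f)
    rw [zero_sub]
    exact nonneg_mk.2 h
  obtain ⟨k, hk⟩ := not_pos_iff.1 h
  refine ⟨k + 1, lt_of_lt_of_le (const_strictMono (show tw (K := K) (k + 1) < tw k by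
    linarith [tw_succ (K := K) k, tw_pos (K := K) (k + 1)])) ?_⟩
  change Nonneg (mk f - mk _)
  rw [← map_sub]
  refine nonneg_mk.2 fun l => hk.mono fun i hi => ?_
  have hi : -f.1 i < -tw k := hi
  change -tw l ≤ f.1 i - tw k
  linarith [tw_pos (K := K) l]

theorem abs_mk_le {f : bounded K} {x : K} (h : ∀ i, |f.1 i| ≤ x) : |mk f| ≤ const K x := by
  have key : ∀ f : bounded K, (∀ i, f.1 i ≤ x) → mk f ≤ const K x := by
    intro f h
    change Nonneg (mk _ - mk f)
    rw [← map_sub]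
    refine nonneg_mk.2 fun k => .of_forall fun i => ?_
    change -tw k ≤ x - f.1 i
    linarith [h i, tw_pos (K := K) k]
  refine abs_le'.2 ⟨key f fun i => (le_abs_self _).trans (h i), ?_⟩
  rw [← map_neg]
  exact key (-f) fun i => (neg_le_abs _).trans (h i)

theorem exists_abs_mul_const_le (x : Real K) : ∃ n : R, |x| * const K (tw n) ≤ 1 := by
  induction x using ind with | _ f
  obtain ⟨n, hn⟩ := f.2
  refine ⟨n, ?_⟩
  have hpos : 0 < const K (tw n) := map_zero (const K) ▸ const_strictMono (tw_pos n)
  rw [← abs_of_pos hpos, ← abs_mul, ← map_one (const K)]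
  change |mk f * mk _| ≤ _
  rw [← map_mul]
  refine abs_mk_le fun i => ?_
  change |f.1 i * tw n| ≤ 1
  rw [abs_mul, abs_of_pos (tw_pos (K := K) n)]
  exact hn i

/-- A quantity that is at most a multiple of every `2⁻ⁿ` vanishes. -/
theorem eq_zero_of_abs_le {x : Real K} (C : Real K) (h : ∀ n : R, |x| ≤ C * const K (tw n)) :
    x = 0 := by
  by_contra hx
  obtain ⟨k, hk⟩ := exists_const_lt (abs_pos.2 hx)
  obtain ⟨m, hm⟩ := exists_abs_mul_const_le C
  have h1 := h (m + k)
  -- With `C ≤ 2ᵐ` and `2⁻ᵏ < |x|`, the bound at `m + k` is contradictory.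
  rw [tw_add, map_mul, ← mul_assoc] at h1
  have hpos : ∀ n : R, 0 < const K (tw n) := fun n =>
    map_zero (const K) ▸ const_strictMono (tw_pos n)
  have h2 : C * const K (tw m) ≤ 1 :=
    (mul_le_mul_of_nonneg_right (le_abs_self C) (hpos m).le).trans hm
  have h3 := mul_le_mul_of_nonneg_right h2 (hpos k).le
  linarith

/-- A sequence with rate of convergence `2⁻ⁿ` has a limit. -/
theorem exists_limit {h : R → K} (hh : ∀ n m, n ≤ m → |h n - h m| ≤ tw n) :
    ∃ x : Real K, ∀ n, |const K (h n) - x| ≤ const K (tw n) := by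
  have hb : h ∈ bounded K := by
    obtain ⟨n, hn⟩ := Scale.bdd (|h 0| + 1)
    refine ⟨n, fun i => le_trans ?_ hn⟩
    refine mul_le_mul_of_nonneg_right ?_ (tw_pos n).le
    rw [abs_of_nonneg (by positivity : 0 ≤ |h 0| + 1)]
    have h0 : |h 0 - h i| ≤ 1 := (le_total 0 i).elim (fun hi => (hh 0 i hi).trans (tw_le_one 0))
      fun hi => by rw [abs_sub_comm]; exact (hh i 0 hi).trans (tw_le_one i)
    have := abs_sub_abs_le_abs_sub (h i) (h 0)
    rw [abs_sub_comm] at this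
    linarith
  -- The sequence represents its own limit: beyond `n` its terms stay within `2⁻ⁿ` of `h n`.
  refine ⟨mk ⟨h, hb⟩, fun n => ?_⟩
  rw [abs_le]
  constructor
  all_goals
    rw [← sub_nonneg]
    change Nonneg (_ - 0)
    rw [sub_zero]
  · change Nonneg (mk _ - mk _ - -mk _)
    rw [← map_sub, ← map_neg, ← map_sub]
    refine nonneg_mk.2 fun k => eventually_filt ((eventually_ge_atTop n).mono fun i hi => ?_)
    change -tw k ≤ h n - h i - -tw n
    linarith [(abs_le.1 (hh n i hi)).1, tw_pos (K := K) k]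
  · change Nonneg (mk _ - (mk _ - mk _))
    rw [← map_sub, ← map_sub]
    refine nonneg_mk.2 fun k => eventually_filt ((eventually_ge_atTop n).mono fun i hi => ?_)
    change -tw k ≤ tw n - (h n - h i)
    linarith [(abs_le.1 (hh n i hi)).2, tw_pos (K := K) k]

end Completion
end Comon

namespace Comon

/-! ## Codes of pairs and of rational numbers in a model -/

namespace Model
variable {T : Set (Fm [])} {M : Model T}

theorem recur_add_one (x a : M.D N) (f : M.D (N⇒N⇒N)) :
    M.recur (x + 1) a f = M.app (M.app f (M.recur x a f)) x := by
  rw [← suc_eq, recur_suc]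

@[simp] theorem prd_add_one (a : M.D N) : M.prd (a + 1) = a := by rw [← suc_eq, prd_suc]

theorem prd_add_one_of_pos {a : M.D N} (h : 0 < a) : M.prd a + 1 = a := by
  rcases eq_zero_or_suc a with rfl | ⟨b, rfl⟩
  · exact absurd h (lt_irrefl _)
  · rw [prd_add_one]

def pw (a : M.D N) : M.D N := M.app (M.eval tPow M.nil) a
def cnd (c a b : M.D N) : M.D N := M.app (M.app (M.app (M.eval tCond M.nil) c) a) b
def pr (a : M.D N) : M.D N := M.app (M.eval tPar M.nil) a
def hf (a : M.D N) : M.D N := M.app (M.eval tHalf M.nil) a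
def dst (a b : M.D N) : M.D N := M.app (M.app (M.eval tDist M.nil) a) b
def lst (f : M.D R1) (b : M.D N) : M.D N := M.app (M.app (M.eval tLeast M.nil) f) b
def bmn (f : M.D R1) (b : M.D N) : M.D N := M.app (M.app (M.eval tBmin M.nil) f) b
def pairJ (a b : M.D N) : M.D N := M.app (M.app (M.eval tJ M.nil) a) b
def fstJ (a : M.D N) : M.D N := M.app (M.eval tFst M.nil) a
def sndJ (a : M.D N) : M.D N := M.app (M.eval tSnd M.nil) a

@[simp] theorem app_pow (a : M.D N) : M.app (M.eval tPow M.nil) a = pw a := rfl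
@[simp] theorem app_cond (c a b : M.D N) :
    M.app (M.app (M.app (M.eval tCond M.nil) c) a) b = cnd c a b := rfl
@[simp] theorem app_par (a : M.D N) : M.app (M.eval tPar M.nil) a = pr a := rfl
@[simp] theorem app_half (a : M.D N) : M.app (M.eval tHalf M.nil) a = hf a := rfl
@[simp] theorem app_dist (a b : M.D N) : M.app (M.app (M.eval tDist M.nil) a) b = dst a b := rfl
@[simp] theorem app_least (f : M.D R1) (b : M.D N) :
    M.app (M.app (M.eval tLeast M.nil) f) b = lst f b := rfl
@[simp] theorem app_bmin (f : M.D R1) (b : M.D N) :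
    M.app (M.app (M.eval tBmin M.nil) f) b = bmn f b := rfl
@[simp] theorem app_J (a b : M.D N) : M.app (M.app (M.eval tJ M.nil) a) b = pairJ a b := rfl
@[simp] theorem app_fst (a : M.D N) : M.app (M.eval tFst M.nil) a = fstJ a := rfl
@[simp] theorem app_snd (a : M.D N) : M.app (M.eval tSnd M.nil) a = sndJ a := rfl

@[simp] theorem pw_zero : pw (0 : M.D N) = 1 := by
  rw [← app_pow]; simp [tPow, eval_recN, recur_zero]

theorem pw_add_one (a : M.D N) : pw (a + 1) = 2 * pw a := by
  rw [← app_pow, ← app_pow]; simp [tPow, eval_recN, recur_add_one, two_mul]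
  exact congrArg (fun x => x + x) (recur_congr (fun r c => by simp) _ _)

@[simp] theorem cnd_zero (a b : M.D N) : cnd 0 a b = a := by
  rw [← app_cond]; simp [tCond, eval_recN, recur_zero]
@[simp] theorem cnd_add_one (c a b : M.D N) : cnd (c + 1) a b = b := by
  rw [← app_cond]; simp [tCond, eval_recN, recur_add_one]
@[simp] theorem cnd_one (a b : M.D N) : cnd 1 a b = b := by
  rw [← zero_add (1 : M.D N), cnd_add_one]
theorem cnd_of_ne_zero {c : M.D N} (h : c ≠ 0) (a b : M.D N) : cnd c a b = b := by
  rcases eq_zero_or_suc c with rfl | ⟨d, rfl⟩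
  · exact absurd rfl h
  · exact cnd_add_one _ _ _

@[simp] theorem pr_zero : pr (0 : M.D N) = 0 := by
  rw [← app_par]; simp [tPar, eval_recN, recur_zero]
theorem pr_add_one (a : M.D N) : pr (a + 1) = 1 - pr a := by
  rw [← app_par, ← app_par]; simp [tPar, eval_recN, recur_add_one]
  exact congrArg (fun x => 1 - x) (recur_congr (fun r c => by simp) _ _)

@[simp] theorem hf_zero : hf (0 : M.D N) = 0 := by
  rw [← app_half]; simp [tHalf, eval_recN, recur_zero]
theorem hf_add_one (a : M.D N) : hf (a + 1) = hf a + pr a := by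
  rw [← app_half, ← app_half]; simp [tHalf, eval_recN, recur_add_one]
  exact recur_congr (fun r c => by simp) _ _

theorem pr_hf_two_mul (a : M.D N) : pr (2 * a) = 0 ∧ hf (2 * a) = a := by
  refine nat_ind (Γ := []) (.and (.eq (par (times (num 2) v0)) O)
    (.eq (half (times (num 2) v0)) v0)) M.nil
    (P := fun a => pr (2 * a) = 0 ∧ hf (2 * a) = a)
    (fun n => by simp [num, one_add_one_eq_two]) (by simp) ?_ a
  rintro n ⟨h1, h2⟩
  rw [show 2 * (n + 1) = 2 * n + 1 + 1 by ring, pr_add_one, pr_add_one, hf_add_one, hf_add_one,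
    pr_add_one, h1, h2]
  simp

@[simp] theorem pr_two_mul (a : M.D N) : pr (2 * a) = 0 := (pr_hf_two_mul a).1
@[simp] theorem hf_two_mul (a : M.D N) : hf (2 * a) = a := (pr_hf_two_mul a).2
@[simp] theorem pr_two_mul_add_one (a : M.D N) : pr (2 * a + 1) = 1 := by simp [pr_add_one]
@[simp] theorem hf_two_mul_add_one (a : M.D N) : hf (2 * a + 1) = a := by simp [hf_add_one]

theorem even_or_odd' (a : M.D N) : ∃ b, a = 2 * b ∨ a = 2 * b + 1 := by
  refine nat_ind (Γ := []) (.ex N (.or (.eq v1 (times (num 2) v0))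
    (.eq v1 (plus (times (num 2) v0) (num 1))))) M.nil
    (P := fun a => ∃ b, a = 2 * b ∨ a = 2 * b + 1)
    (fun n => by simp [num, one_add_one_eq_two]) ⟨0, by simp⟩ ?_ a
  rintro n ⟨b, rfl | rfl⟩
  · exact ⟨b, .inr rfl⟩
  · exact ⟨b + 1, .inl (by ring)⟩

theorem dst_eq (a b : M.D N) : dst a b = (a - b) + (b - a) := by
  rw [← app_dist]; simp [tDist]

@[simp] theorem dst_eq_zero {a b : M.D N} : dst a b = 0 ↔ a = b := by
  rw [dst_eq, add_eq_zero, tsub_eq_zero_iff_le, tsub_eq_zero_iff_le, le_antisymm_iff]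

@[simp] theorem lst_zero (f : M.D R1) : lst f 0 = 0 := by
  rw [← app_least]; simp [tLeast, eval_recN, recur_zero]

theorem lst_add_one (f : M.D R1) (c : M.D N) :
    lst f (c + 1) = cnd (M.app f (lst f c)) (lst f c) (c + 1) := by
  rw [← app_least, ← app_least]; simp [tLeast, eval_recN, recur_add_one]
  exact congrArg (fun x => cnd (M.app f x) x (c + 1)) (recur_congr (fun r c => by simp) _ _)

theorem lst_spec (f : M.D R1) (b : M.D N) : lst f b ≤ b ∧ (∀ u, u < lst f b → M.app f u ≠ 0) ∧
    (lst f b < b → M.app f (lst f b) = 0) := by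
  refine nat_ind (Γ := [R1]) (.and (leN (least v1 v0) v0) (.and
    (.all N (.imp (leN (S v0) (least v2 v1)) (neg (.eq (v2⬝v0) O))))
    (.imp (leN (S (least v1 v0)) v0) (.eq (v1⬝(least v1 v0)) O)))) (Str.cons f M.nil)
    (P := fun b => lst f b ≤ b ∧ (∀ u, u < lst f b → M.app f u ≠ 0) ∧
    (lst f b < b → M.app f (lst f b) = 0)) (fun n => by
      simp [tsub_eq_zero_iff_le, add_one_le_iff]) (by simp) ?_ b
  rintro n ⟨h1, h2, h3⟩
  rw [lst_add_one]
  by_cases h : M.app f (lst f n) = 0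
  · rw [h, cnd_zero]
    exact ⟨h1.trans le_self_add, h2, fun _ => h⟩
  · rw [cnd_of_ne_zero h]
    have h4 : lst f n = n := by
      by_contra hne; exact h (h3 (lt_of_le_of_ne h1 hne))
    rw [h4] at h2 h
    refine ⟨le_rfl, fun u hu => ?_, fun h => absurd h (lt_irrefl _)⟩
    rcases (lt_add_one_iff.1 hu).lt_or_eq with hu | rfl
    exacts [h2 u hu, h]

theorem bmn_eq (f : M.D R1) (b : M.D N) : bmn f b = cnd (M.app f (lst f b)) (lst f b) 0 := by
  rw [← app_bmin]; simp [tBmin]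

/-- The search below `b` ends at a zero or at `b`; in the second case no number below `b` is a zero,
so `u = b`. -/
theorem app_bmn {f : M.D R1} {b u : M.D N} (hu : u ≤ b) (h : M.app f u = 0) :
    M.app f (bmn f b) = 0 := by
  obtain ⟨h1, h2, h3⟩ := lst_spec f b
  have h4 : M.app f (lst f b) = 0 := by
    rcases h1.lt_or_eq with h1 | h1
    · exact h3 h1
    · rw [h1] at h2 ⊢
      rcases hu.lt_or_eq with hu | rfl
      exacts [absurd h (h2 u hu), h]
  rw [bmn_eq, h4, cnd_zero, h4]

/-- The right side is even by the parity of `n + m`, so the bounded search that defines the pairing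
finds its half. -/
theorem two_mul_pairJ (n m : M.D N) : 2 * pairJ n m = (n + m) * (n + m + 1) + 2 * n := by
  have key : ∃ u, 2 * u = (n + m) * (n + m + 1) + 2 * n := by
    obtain ⟨b, hb | hb⟩ := even_or_odd' (n + m)
    · exact ⟨b * (2 * b + 1) + n, by rw [hb]; ring⟩
    · exact ⟨(2 * b + 1) * (b + 1) + n, by rw [hb]; ring⟩
  obtain ⟨u, hu⟩ := key
  have hj : ∀ n m : M.D N, M.app (M.app (M.eval tJB M.nil) n) m = (n + m) * (n + m + 1) + 2 * n := by
    intro n m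
    simp [tJB, num]
    ring
  have h := app_bmn (M := M) (f := M.eval (lam (dist (times (num 2) v0) (tJB.emb⬝v2⬝v1)))
    (Str.cons m (Str.cons n M.nil))) (b := M.app (M.app (M.eval tJB M.nil) n) m) (u := u)
    (by rw [hj, ← hu, two_mul]; exact le_self_add)
    (by simp [num, one_add_one_eq_two, hj, hu])
  simp only [app_lam] at h
  simp only [Str.eval_app, Str.eval_emb, app_dist, app_times, Str.eval_z, Str.eval_s, hj,
    dst_eq_zero] at h
  rw [← hj, ← app_J]
  simp only [tJ, app_lam]
  simpa [num, one_add_one_eq_two, hj] using h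

theorem le_mul_self_add (m : M.D N) : 2 * m ≤ m * (m + 1) := by
  rcases eq_zero_or_suc m with rfl | ⟨k, rfl⟩
  · simp
  · exact ⟨k * k + k, by ring⟩

theorem left_le_pairJ (n m : M.D N) : n ≤ pairJ n m := by
  refine le_of_mul_le_mul_left ?_ (two_pos : (0 : M.D N) < 2)
  rw [two_mul_pairJ]; exact le_add_self

theorem right_le_pairJ (n m : M.D N) : m ≤ pairJ n m := by
  refine le_of_mul_le_mul_left ?_ (two_pos : (0 : M.D N) < 2)
  rw [two_mul_pairJ]
  refine (le_mul_self_add m).trans ?_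
  exact ⟨n * n + 2 * n * m + 3 * n, by ring⟩

/-- For `s = n + m` one has `s(s+1) + 2n < (s+1)(s+2)`, so the code determines the sum and then both
components. -/
theorem pairJ_inj {n m n' m' : M.D N} (h : pairJ n m = pairJ n' m') : n = n' ∧ m = m' := by
  have key : ∀ {n m n' m' : M.D N}, pairJ n m = pairJ n' m' → ¬ n + m < n' + m' := by
    intro n m n' m' h hlt
    have h1 := congrArg (2 * ·) h
    simp only [two_mul_pairJ] at h1
    obtain ⟨d, hd⟩ := lt_iff.1 hlt
    rw [hd] at h1
    refine (lt_irrefl ((n + m + d + 1) * (n + m + d + 1 + 1) + 2 * n')) ?_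
    nth_rewrite 1 [← h1]
    exact lt_iff.2 ⟨2 * (n + m) * d + d * d + 3 * d + 1 + 2 * n' + 2 * m, by ring⟩
  have hs : n + m = n' + m' := le_antisymm (not_lt.1 (key h.symm)) (not_lt.1 (key h))
  have h1 := congrArg (2 * ·) h
  simp only [two_mul_pairJ, hs] at h1
  have h2 : n = n' := mul_left_cancel₀ (two_ne_zero (α := M.D N)) (add_left_cancel h1)
  exact ⟨h2, by rw [h2] at hs; exact add_left_cancel hs⟩

@[simp] theorem fstJ_pairJ (n m : M.D N) : fstJ (pairJ n m) = n := by
  set w := pairJ n m with hw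
  have inner := app_bmn (M := M) (f := M.eval (lam (dist (pair v1 v0) v2))
    (Str.cons n (Str.cons w M.nil))) (b := w) (u := m) (right_le_pairJ n m) (by simp [hw])
  have outer := app_bmn (M := M) (f := M.eval
    (lam (dist (pair v0 (bmin (lam (dist (pair v1 v0) v2)) v1)) v1)) (Str.cons w M.nil))
    (b := w) (u := n) (left_le_pairJ n m) (by simpa using inner)
  simp only [app_lam] at outer
  simp only [Str.eval_app, Str.eval_emb, app_dist, app_J, Str.eval_z, Str.eval_s,
    dst_eq_zero] at outer
  rw [← app_fst]
  simp only [tFst, app_lam, Str.eval_app, Str.eval_emb, app_bmin, Str.eval_z]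
  exact (pairJ_inj (outer.trans hw)).1

@[simp] theorem sndJ_pairJ (n m : M.D N) : sndJ (pairJ n m) = m := by
  set w := pairJ n m with hw
  have inner := app_bmn (M := M) (f := M.eval (lam (dist (pair v0 v1) v2))
    (Str.cons m (Str.cons w M.nil))) (b := w) (u := n) (left_le_pairJ n m) (by simp [hw])
  have outer := app_bmn (M := M) (f := M.eval
    (lam (dist (pair (bmin (lam (dist (pair v0 v1) v2)) v1) v0) v1)) (Str.cons w M.nil))
    (b := w) (u := m) (right_le_pairJ n m) (by simpa using inner)
  simp only [app_lam] at outer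
  simp only [Str.eval_app, Str.eval_emb, app_dist, app_J, Str.eval_z, Str.eval_s,
    dst_eq_zero] at outer
  rw [← app_snd]
  simp only [tSnd, app_lam, Str.eval_app, Str.eval_emb, app_bmin, Str.eval_z]
  exact (pairJ_inj (outer.trans hw)).2

theorem lt_pw (a : M.D N) : a < pw a := by
  refine nat_ind (Γ := []) (leN (S v0) (pow v0)) M.nil (P := fun a => a < pw a)
    (fun n => by simp [tsub_eq_zero_iff_le, add_one_le_iff]) (by simp) ?_ a
  intro n hn
  obtain ⟨c, hc⟩ := lt_iff.1 hn
  rw [pw_add_one, hc]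
  exact lt_iff.2 ⟨n + 2 * c, by ring⟩

theorem pw_pos (a : M.D N) : 0 < pw a := (zero_le' a).trans_lt (lt_pw a)

theorem pw_add (a b : M.D N) : pw (a + b) = pw a * pw b := by
  refine nat_ind (Γ := [N]) (.eq (pow (plus v1 v0)) (times (pow v1) (pow v0))) (Str.cons a M.nil)
    (P := fun b => pw (a + b) = pw a * pw b) (fun n => by simp) (by simp) ?_ b
  intro n hn
  rw [← add_assoc, pw_add_one, hn, pw_add_one]; ring

/-! ### Rational numbers -/

def posN (a : M.D N) : M.D N := M.app (M.eval tPos M.nil) a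
def negN (a : M.D N) : M.D N := M.app (M.eval tNeg M.nil) a
def denN (a : M.D N) : M.D N := M.app (M.eval tDen M.nil) a
def mkN (p q d : M.D N) : M.D N := M.app (M.app (M.app (M.eval tMk M.nil) p) q) d

@[simp] theorem app_tPos (a : M.D N) : M.app (M.eval tPos M.nil) a = posN a := rfl
@[simp] theorem app_tNeg (a : M.D N) : M.app (M.eval tNeg M.nil) a = negN a := rfl
@[simp] theorem app_tDen (a : M.D N) : M.app (M.eval tDen M.nil) a = denN a := rfl
@[simp] theorem app_tMk (p q d : M.D N) :
    M.app (M.app (M.app (M.eval tMk M.nil) p) q) d = mkN p q d := rfl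

theorem posN_eq (a : M.D N) : posN a = cnd (pr (fstJ a)) (hf (fstJ a)) 0 := by
  rw [← app_tPos]; simp [tPos]
theorem negN_eq (a : M.D N) : negN a = cnd (pr (fstJ a)) 0 (hf (fstJ a) + 1) := by
  rw [← app_tNeg]; simp [tNeg]
theorem denN_eq (a : M.D N) : denN a = sndJ a + 1 := by
  rw [← app_tDen]; simp [tDen]
theorem mkN_eq (p q d : M.D N) :
    mkN p q d = pairJ (2 * (p - q) + M.prd (2 * (q - p))) (M.prd d) := by
  rw [← app_tMk]; simp [tMk, num, one_add_one_eq_two]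

theorem denN_pos (a : M.D N) : 0 < denN a := by
  rw [denN_eq]; exact lt_iff.2 ⟨sndJ a, by ring⟩

theorem posN_or_negN (a : M.D N) : posN a = 0 ∨ negN a = 0 := by
  rw [posN_eq, negN_eq]
  rcases eq_or_ne (pr (fstJ a)) 0 with h | h
  · right; rw [h, cnd_zero]
  · left; rw [cnd_of_ne_zero h]

variable (M) in
/-- The ordered ring of fractions over the natural numbers of `M`. -/
abbrev Q := Frac (M.D N)

/-- The rational number with code `a`. -/
noncomputable def q (a : M.D N) : Q M := Frac.mk (posN a) (negN a) (denN a) (denN_pos a)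

/-- One of the truncated differences vanishes: a difference `z ≥ 0` receives the even numerator code
`2z`, a difference `-(z+1)` the odd code `2z + 1`. -/
theorem q_mkN (x y d : M.D N) (h : 0 < d) : q (mkN x y d) = Frac.mk x y d h := by
  have hd : denN (mkN x y d) = d := by
    rw [mkN_eq, denN_eq, sndJ_pairJ, prd_add_one_of_pos h]
  rw [q, Frac.mk_eq_mk, hd]
  rcases le_or_gt y x with hxy | hxy
  · obtain ⟨z, rfl⟩ := hxy
    have h1 : (y + z) - y = z := by rw [add_comm, add_sub_self]
    have h2 : y - (y + z) = 0 := by rw [add_comm, sub_add_self]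
    rw [posN_eq, negN_eq, mkN_eq, fstJ_pairJ, h1, h2]
    simp; ring
  · obtain ⟨z, rfl⟩ := lt_iff.1 hxy
    have h1 : (x + z + 1) - x = z + 1 := by
      rw [show x + z + 1 = z + 1 + x by ring, add_sub_self]
    have h2 : x - (x + z + 1) = 0 := by
      rw [show x + z + 1 = z + 1 + x by ring, sub_add_self]
    rw [posN_eq, negN_eq, mkN_eq, fstJ_pairJ, h1, h2,
      show 2 * (z + 1) = (2 * z + 1) + 1 by ring]
    simp; ring

def plusN (a b : M.D N) : M.D N := M.app (M.app (M.eval tPlusQ M.nil) a) b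
def timesN (a b : M.D N) : M.D N := M.app (M.app (M.eval tTimesQ M.nil) a) b
def minusN (a : M.D N) : M.D N := M.app (M.eval tMinusQ M.nil) a
def absN (a : M.D N) : M.D N := M.app (M.eval tAbsQ M.nil) a
def invN (a : M.D N) : M.D N := M.app (M.eval tInvQ M.nil) a
def ltTmN (a b : M.D N) : M.D N := M.app (M.app (M.eval tLtQ M.nil) a) b
def twoNegN (a : M.D N) : M.D N := M.app (M.eval tTwoNeg M.nil) a

@[simp] theorem app_tPlusQ (a b : M.D N) : M.app (M.app (M.eval tPlusQ M.nil) a) b = plusN a b := rfl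
@[simp] theorem app_tTimesQ (a b : M.D N) :
    M.app (M.app (M.eval tTimesQ M.nil) a) b = timesN a b := rfl
@[simp] theorem app_tMinusQ (a : M.D N) : M.app (M.eval tMinusQ M.nil) a = minusN a := rfl
@[simp] theorem app_tAbsQ (a : M.D N) : M.app (M.eval tAbsQ M.nil) a = absN a := rfl
@[simp] theorem app_tInvQ (a : M.D N) : M.app (M.eval tInvQ M.nil) a = invN a := rfl
@[simp] theorem app_tLtQ (a b : M.D N) : M.app (M.app (M.eval tLtQ M.nil) a) b = ltTmN a b := rfl
@[simp] theorem app_tTwoNeg (a : M.D N) : M.app (M.eval tTwoNeg M.nil) a = twoNegN a := rfl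

@[simp] theorem q_plusN (a b : M.D N) : q (plusN a b) = q a + q b := by
  have : plusN a b = mkN (posN a * denN b + posN b * denN a) (negN a * denN b + negN b * denN a)
      (denN a * denN b) := by rw [← app_tPlusQ]; simp [tPlusQ]
  rw [this, q_mkN _ _ _ (mul_pos (denN_pos a) (denN_pos b))]
  exact (Frac.mk_add_mk ..).symm

@[simp] theorem q_timesN (a b : M.D N) : q (timesN a b) = q a * q b := by
  have : timesN a b = mkN (posN a * posN b + negN a * negN b) (posN a * negN b + negN a * posN b)
      (denN a * denN b) := by rw [← app_tTimesQ]; simp [tTimesQ]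
  rw [this, q_mkN _ _ _ (mul_pos (denN_pos a) (denN_pos b))]
  exact (Frac.mk_mul_mk ..).symm

@[simp] theorem q_minusN (a : M.D N) : q (minusN a) = -q a := by
  have : minusN a = mkN (negN a) (posN a) (denN a) := by rw [← app_tMinusQ]; simp [tMinusQ]
  rw [this, q_mkN _ _ _ (denN_pos a)]
  exact (Frac.neg_mk ..).symm

@[simp] theorem q_absN (a : M.D N) : q (absN a) = |q a| := by
  have : absN a = mkN (posN a + negN a) 0 (denN a) := by rw [← app_tAbsQ]; simp [tAbsQ]
  rw [this, q_mkN _ _ _ (denN_pos a)]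
  rcases posN_or_negN a with h | h
  · rw [abs_of_nonpos, q, Frac.neg_mk, Frac.mk_eq_mk, h]
    · ring
    · rw [q, Frac.zero_def, Frac.mk_le_mk, h]; simp
  · rw [abs_of_nonneg, q, Frac.mk_eq_mk, h]
    · ring
    · rw [q, Frac.zero_def, Frac.mk_le_mk, h]; simp

theorem q_invN {a : M.D N} (ha : q a ≠ 0) : q (invN a) * q a = 1 := by
  have : invN a = cnd (posN a) (cnd (negN a) (pairJ 0 0) (mkN 0 (denN a) (negN a)))
      (mkN (denN a) 0 (posN a)) := by rw [← app_tInvQ]; simp [tInvQ]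
  rw [this]
  rcases (zero_le' (posN a)).eq_or_lt with hp | hp
  · rw [← hp, cnd_zero]
    have hn : 0 < negN a := by
      refine lt_of_le_of_ne (zero_le' _) fun h => ha ?_
      rw [q, Frac.zero_def, Frac.mk_eq_mk, ← hp, ← h]; simp
    rw [cnd_of_ne_zero hn.ne', q_mkN _ _ _ hn, q, Frac.mk_mul_mk, Frac.one_def, Frac.mk_eq_mk, ← hp]
    ring
  · have hn : negN a = 0 := (posN_or_negN a).resolve_left hp.ne'
    rw [cnd_of_ne_zero hp.ne', q_mkN _ _ _ hp, q, Frac.mk_mul_mk, Frac.one_def, Frac.mk_eq_mk, hn]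
    ring

@[simp] theorem ltTmN_eq_zero {a b : M.D N} : ltTmN a b = 0 ↔ q a < q b := by
  have : ltTmN a b = (posN a * denN b + negN b * denN a + 1) -
      (posN b * denN a + negN a * denN b) := by rw [← app_tLtQ]; simp [tLtQ]
  rw [this, tsub_eq_zero_iff_le, add_one_le_iff, q, q, Frac.mk_lt_mk]

theorem posN_pairJ (a b : M.D N) : posN (pairJ (2 * a) b) = a := by rw [posN_eq]; simp
theorem negN_pairJ (a b : M.D N) : negN (pairJ (2 * a) b) = 0 := by rw [negN_eq]; simp
theorem denN_pairJ (a b : M.D N) : denN (pairJ a b) = b + 1 := by rw [denN_eq]; simp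

theorem q_pairJ (a b : M.D N) :
    q (pairJ (2 * a) b) = Frac.mk a 0 (b + 1) (lt_iff.2 ⟨b, by ring⟩) := by
  rw [q, Frac.mk_eq_mk, posN_pairJ, negN_pairJ, denN_pairJ]

@[simp] theorem q_zero : q (pairJ 0 0 : M.D N) = 0 := by
  have := q_pairJ (0 : M.D N) 0
  rw [mul_zero] at this
  rw [this, Frac.zero_def, Frac.mk_eq_mk]; ring

@[simp] theorem q_one : q (pairJ 2 0 : M.D N) = 1 := by
  have := q_pairJ (1 : M.D N) 0
  rw [mul_one] at this
  rw [this, Frac.one_def, Frac.mk_eq_mk]; ring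

open Completion

/-- Everything rests on `n < 2ⁿ`: a positive fraction with denominator `d` is at least `1/d > 2⁻ᵈ`,
and `|(p - q)/d| ≤ p + q < 2^(p+q)`. -/
noncomputable instance : Scale (M.D N) (Q M) where
  tw n := Frac.mk 1 0 (pw n) (pw_pos n)
  tw_pos n := by rw [Frac.zero_def, Frac.mk_lt_mk]; simp
  tw_le_one n := by
    rw [Frac.one_def, Frac.mk_le_mk]
    simpa [← add_one_le_iff] using pw_pos n
  tw_add n m := by rw [Frac.mk_mul_mk, Frac.mk_eq_mk, pw_add]; ring
  tw_one := by
    have h : pw (1 : M.D N) = 2 := by rw [← zero_add (1 : M.D N), pw_add_one]; simp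
    rw [two_mul, Frac.mk_add_mk, Frac.one_def, Frac.mk_eq_mk, h]; ring
  exists_lt x := by
    induction x using Frac.ind with | _ p q d hd
    intro h
    rw [Frac.zero_def, Frac.mk_lt_mk] at h
    obtain ⟨c, rfl⟩ := lt_iff.1 (show q < p by simpa using h)
    obtain ⟨e, he⟩ := lt_iff.1 (lt_pw d)
    refine ⟨d, ?_⟩
    rw [Frac.mk_lt_mk, he]
    exact lt_iff.2 ⟨c * (d + e + 1) + e, by ring⟩
  bdd x := by
    induction x using Frac.ind with | _ p q d hd
    obtain ⟨e, he⟩ := lt_iff.1 (lt_pw (p + q))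
    obtain ⟨f, hf⟩ := lt_iff.1 hd
    have h : |Frac.mk p q d hd| ≤ Frac.mk (p + q) 0 d hd := by
      rw [abs_le', Frac.neg_mk, Frac.mk_le_mk, Frac.mk_le_mk]
      exact ⟨⟨2 * q * d, by ring⟩, ⟨2 * p * d, by ring⟩⟩
    refine ⟨p + q, ?_⟩
    refine (mul_le_mul_of_nonneg_right h ?_).trans ?_
    · rw [Frac.zero_def, Frac.mk_le_mk]; simp
    · rw [Frac.mk_mul_mk, Frac.one_def, Frac.mk_le_mk, hf, he]
      exact ⟨(p + q) * f + (f + 1) * (e + 1), by ring⟩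

@[simp] theorem q_twoNegN (n : M.D N) : q (twoNegN n) = Scale.tw n := by
  have h : twoNegN n = pairJ (2 * 1) (M.prd (pw n)) := by
    rw [← app_tTwoNeg]; simp [tTwoNeg, num, one_add_one_eq_two]
  rw [h, q_pairJ]
  change _ = Frac.mk 1 0 (pw n) (pw_pos n)
  rw [Frac.mk_eq_mk, prd_add_one_of_pos (pw_pos n)]

end Model
end Comon

namespace Comon
namespace Model
open Completion Scale
variable {T : Set (Fm [])} {M : Model T}

/-! ## Real numbers in a model -/

variable (M) in
/-- The ordered ring of the values of the real numbers of `M`. -/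
abbrev F := Completion.Real (Q M)

theorem one_sub_eq_zero {a : M.D N} : 1 - a = 0 ↔ a ≠ 0 := by
  rw [tsub_eq_zero_iff_le, ← zero_add (1 : M.D N), add_one_le_iff, pos_iff_ne_zero]

/-- The characteristic function of the places where a sequence converges fast enough. -/
def irreg : Tm [N, R1] R1 := lam (monus (S O)
    (ltTmQ (absQ (plusQ (v2⬝v0) (minusQ (v2⬝(S v0))))) (twoNeg (S v0))))

def hatR (f : M.D R1) (n : M.D N) : M.D N := M.app (M.app (M.eval tHat M.nil) f) n

@[simp] theorem app_tHat (f : M.D R1) (n : M.D N) :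
    M.app (M.app (M.eval tHat M.nil) f) n = hatR f n := rfl

def Regular (f : M.D R1) : Prop :=
  ∀ n, |q (M.app f n) - q (M.app f (n + 1))| < tw (n + 1)

/-- The search stops at zeros, so a zero has to mean that the step is too large. -/
theorem app_irreg {f : M.D R1} {m n : M.D N} :
    M.app (M.eval irreg (Str.cons m (Str.cons f M.nil))) n = 0 ↔
      ¬ |q (M.app f n) - q (M.app f (n + 1))| < tw (n + 1) := by
  simp [irreg, one_sub_eq_zero, sub_eq_add_neg]

theorem lst_congr {f g : M.D R1} (h : ∀ u, M.app f u = M.app g u) (b : M.D N) :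
    lst f b = lst g b := by
  refine nat_ind (Γ := [R1, R1]) (.eq (least v2 v0) (least v1 v0)) (Str.cons g (Str.cons f M.nil))
    (P := fun b => lst f b = lst g b) (fun n => by simp) (by simp) ?_ b
  intro n hn
  rw [lst_add_one, lst_add_one, hn, h]

/-- In the term `tHat` the searched function also carries the bound `n` in its environment; fixing
it at `0` allows values at consecutive arguments to be compared. -/
theorem hatR_eq (f : M.D R1) (n : M.D N) :
    hatR f n = M.app f (lst (M.eval irreg (Str.cons 0 (Str.cons f M.nil))) n) := by
  have : hatR f n = M.app f (lst (M.eval irreg (Str.cons n (Str.cons f M.nil))) n) := by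
    rw [← app_tHat]
    simp only [tHat, app_lam, Str.eval_app, Str.eval_emb, app_least, Str.eval_z, Str.eval_s, irreg]
  rw [this]
  refine congrArg (M.app f) (lst_congr (fun u => ?_) n)
  simp [irreg]

@[simp] theorem hatR_zero (f : M.D R1) : hatR f 0 = M.app f 0 := by rw [hatR_eq, lst_zero]

theorem hatR_of_regular {f : M.D R1} (hf : Regular f) (n : M.D N) : hatR f n = M.app f n := by
  rw [hatR_eq]
  obtain ⟨h1, -, h3⟩ := lst_spec (M.eval irreg (Str.cons 0 (Str.cons f M.nil))) n
  rcases h1.lt_or_eq with h | h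
  · exact absurd (hf _) (app_irreg.1 (h3 h))
  · rw [h]

/-- After a violation the sequence is constant, and before the first one every step is small. -/
theorem abs_hatR_sub_succ (f : M.D R1) (n : M.D N) :
    |q (hatR f n) - q (hatR f (n + 1))| < tw (n + 1) := by
  rw [hatR_eq, hatR_eq, lst_add_one]
  obtain ⟨h1, -, h3⟩ := lst_spec (M.eval irreg (Str.cons 0 (Str.cons f M.nil))) n
  by_cases h : M.app (M.eval irreg (Str.cons 0 (Str.cons f M.nil)))
      (lst (M.eval irreg (Str.cons 0 (Str.cons f M.nil))) n) = 0
  · rw [h, cnd_zero, sub_self, abs_zero]; exact tw_pos _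
  · rw [cnd_of_ne_zero h]
    have h4 := h1.lt_or_eq.resolve_left fun hlt => h (h3 hlt)
    rw [h4] at h ⊢
    rwa [app_irreg, not_not] at h

/-- Summation of a geometric series, done by definable induction because `k` may be nonstandard. -/
theorem abs_hatR_sub_add (f : M.D R1) (n k : M.D N) :
    |q (hatR f n) - q (hatR f (n + k))| ≤ tw n - tw (n + k) := by
  refine nat_ind (Γ := [N, R1]) (neg (ltQ (plusQ (twoNeg v1) (minusQ (twoNeg (plus v1 v0))))
    (absQ (plusQ (hat v2 v1) (minusQ (hat v2 (plus v1 v0)))))))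
    (Str.cons n (Str.cons f M.nil))
    (P := fun k => |q (hatR f n) - q (hatR f (n + k))| ≤ tw n - tw (n + k))
    (fun k => by simp [sub_eq_add_neg]) (by simp) ?_ k
  intro k hk
  have h1 := abs_hatR_sub_succ f (n + k)
  have h2 := abs_sub_le (q (hatR f n)) (q (hatR f (n + k))) (q (hatR f (n + k + 1)))
  have h3 := tw_succ (K := Q M) (n + k)
  rw [← add_assoc]
  linarith

theorem abs_hatR_sub_le (f : M.D R1) {n m : M.D N} (h : n ≤ m) :
    |q (hatR f n) - q (hatR f m)| ≤ tw n := by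
  obtain ⟨k, rfl⟩ := h
  linarith [abs_hatR_sub_add f n k, tw_pos (K := Q M) (n + k)]

/-- The value of a real number. -/
noncomputable def val (f : M.D R1) : F M :=
  (exists_limit (h := fun n => q (hatR f n)) fun _ _ h => abs_hatR_sub_le f h).choose

variable (M) in
/-- The embedding of the rational numbers into the values of real numbers. -/
noncomputable abbrev ι : Q M →+* F M := const (Q M)

theorem ι_lt {x y : Q M} : ι M x < ι M y ↔ x < y := const_strictMono.lt_iff_lt
theorem ι_le {x y : Q M} : ι M x ≤ ι M y ↔ x ≤ y := const_strictMono.le_iff_le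

theorem ι_abs (x : Q M) : ι M |x| = |ι M x| := by
  rcases le_total 0 x with h | h
  · rw [abs_of_nonneg h, abs_of_nonneg (by rwa [← map_zero (ι M), ι_le])]
  · rw [abs_of_nonpos h, abs_of_nonpos (by rwa [← map_zero (ι M), ι_le]), map_neg]

theorem ι_tw_pos (n : M.D N) : 0 < ι M (tw n) := by
  rw [← map_zero (ι M), ι_lt]; exact tw_pos n

theorem ι_tw_succ (n : M.D N) : 2 * ι M (tw (n + 1)) = ι M (tw n) := by
  rw [← tw_succ n, map_mul, map_ofNat]

theorem ι_tw_add (n m : M.D N) : ι M (tw (n + m)) = ι M (tw n) * ι M (tw m) := by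
  rw [tw_add, map_mul]

theorem abs_hatR_sub_val_le (f : M.D R1) (n : M.D N) :
    |ι M (q (hatR f n)) - val f| ≤ ι M (tw n) :=
  (exists_limit (h := fun n => q (hatR f n)) fun _ _ h => abs_hatR_sub_le f h).choose_spec n

/-- Strictness comes from the strict bound on the next step; `sat_eqR` needs it, since `eqR` is
defined by strict inequalities. -/
theorem abs_hatR_sub_val_lt (f : M.D R1) (n : M.D N) :
    |ι M (q (hatR f n)) - val f| < ι M (tw n) := by
  have h1 := ι_lt.2 (abs_hatR_sub_succ f n)
  have h2 := abs_hatR_sub_val_le f (n + 1)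
  have h3 := abs_sub_le (ι M (q (hatR f n))) (ι M (q (hatR f (n + 1)))) (val f)
  rw [ι_abs, map_sub] at h1
  linarith [ι_tw_succ n]

theorem val_eq_of_abs_le {f : M.D R1} {y : F M} (C : F M)
    (h : ∀ n, |ι M (q (hatR f n)) - y| ≤ C * ι M (tw n)) : val f = y := by
  rw [← sub_eq_zero]
  refine eq_zero_of_abs_le (R := M.D N) (C + 1) fun n => ?_
  have h1 := h n
  have h2 := abs_hatR_sub_val_le f n
  have h3 := abs_sub_le (val f) (ι M (q (hatR f n))) y
  rw [abs_sub_comm (val f) (ι M _)] at h3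
  linarith

/-- At index `n + 1` the two approximation errors add up to less than `2⁻ⁿ`; conversely,
approximants that agree at every precision force equal values in `F M`. -/
theorem sat_eqR {Γ : Ctx} {f g : Tm Γ R1} {e : M.Env Γ} :
    M.Sat (eqR f g) e ↔ val (M.eval f e) = val (M.eval g e) := by
  have : M.Sat (eqR f g) e ↔ ∀ n, |q (hatR (M.eval f e) (n + 1)) - q (hatR (M.eval g e) (n + 1))|
      < tw n := by simp [eqR, sub_eq_add_neg]
  rw [this]
  generalize M.eval f e = a
  generalize M.eval g e = b
  constructor
  · intro h
    rw [← sub_eq_zero]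
    refine eq_zero_of_abs_le (R := M.D N) 2 fun n => ?_
    have h1 := ι_lt.2 (h n)
    rw [ι_abs, map_sub] at h1
    have h2 := abs_hatR_sub_val_lt a (n + 1)
    have h3 := abs_hatR_sub_val_lt b (n + 1)
    have h4 := ι_tw_succ n
    rw [abs_lt] at h1 h2 h3
    rw [abs_le]
    constructor <;> linarith
  · intro h n
    rw [← ι_lt, ι_abs, map_sub]
    have h2 := abs_hatR_sub_val_lt a (n + 1)
    have h3 := abs_hatR_sub_val_lt b (n + 1)
    have h4 := ι_tw_succ n
    rw [h] at h2
    rw [abs_lt] at h2 h3 ⊢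
    constructor <;> linarith

theorem sat_ltR {Γ : Ctx} {f g : Tm Γ R1} {e : M.Env Γ} :
    M.Sat (ltR f g) e ↔ val (M.eval f e) < val (M.eval g e) := by
  have : M.Sat (ltR f g) e ↔ ∃ n, tw n ≤ q (hatR (M.eval g e) (n + 1)) -
      q (hatR (M.eval f e) (n + 1)) := by simp [ltR, sub_eq_add_neg]
  rw [this]
  generalize M.eval f e = a
  generalize M.eval g e = b
  constructor
  · rintro ⟨n, h⟩
    have h1 := ι_le.2 h
    rw [map_sub] at h1
    have h2 := abs_hatR_sub_val_lt a (n + 1)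
    have h3 := abs_hatR_sub_val_lt b (n + 1)
    have h4 := ι_tw_succ n
    rw [abs_lt] at h2 h3
    linarith
  · intro h
    obtain ⟨k, hk⟩ := exists_const_lt (R := M.D N) (sub_pos.2 h)
    -- A gap above `2⁻ᵏ` loses less than `2 · 2⁻⁽ᵏ⁺²⁾` when the values are replaced by approximants
    -- at `k + 2`, which leaves more than `2⁻⁽ᵏ⁺¹⁾`.
    refine ⟨k + 1, ?_⟩
    rw [← ι_le, map_sub]
    have h2 := abs_hatR_sub_val_lt a (k + 1 + 1)
    have h3 := abs_hatR_sub_val_lt b (k + 1 + 1)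
    have h4 := ι_tw_succ k
    have h5 := ι_tw_succ (k + 1)
    rw [abs_lt] at h2 h3
    linarith

theorem sat_leR {Γ : Ctx} {f g : Tm Γ R1} {e : M.Env Γ} :
    M.Sat (leR f g) e ↔ val (M.eval f e) ≤ val (M.eval g e) := by
  rw [leR, Str.sat_imp, sat_ltR, ← not_lt]
  simp

/-! ### Operations on real numbers -/

theorem val_eq_of_regular {f : M.D R1} (hf : Regular f) {y : F M} (C : F M)
    (h : ∀ n, |ι M (q (M.app f n)) - y| ≤ C * ι M (tw n)) : val f = y :=
  val_eq_of_abs_le C fun n => by rw [hatR_of_regular hf]; exact h n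

@[simp] theorem val_ratR (a : M.D N) : val (M.app (M.eval tRat M.nil) a) = ι M (q a) := by
  have h : ∀ n, M.app (M.app (M.eval tRat M.nil) a) n = a := fun n => by simp [tRat]
  refine val_eq_of_regular (fun n => ?_) 0 fun n => ?_
  · rw [h, h, sub_self, abs_zero]; exact tw_pos _
  · rw [h]; simp

@[simp] theorem val_plusR (f g : M.D R1) :
    val (M.app (M.app (M.eval tPlusR M.nil) f) g) = val f + val g := by
  have h : ∀ n, q (M.app (M.app (M.app (M.eval tPlusR M.nil) f) g) n) =
      q (hatR f (n + 1)) + q (hatR g (n + 1)) := fun n => by simp [tPlusR]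
  refine val_eq_of_regular (fun n => ?_) 1 fun n => ?_
  · rw [h, h]
    have h1 := abs_hatR_sub_succ f (n + 1)
    have h2 := abs_hatR_sub_succ g (n + 1)
    have h3 := tw_succ (K := Q M) (n + 1)
    rw [abs_lt] at h1 h2 ⊢
    constructor <;> linarith
  · rw [h, map_add]
    have h1 := abs_hatR_sub_val_le f (n + 1)
    have h2 := abs_hatR_sub_val_le g (n + 1)
    have h3 := ι_tw_succ n
    rw [abs_le] at h1 h2 ⊢
    constructor <;> linarith

@[simp] theorem val_minusR (f : M.D R1) : val (M.app (M.eval tMinusR M.nil) f) = -val f := by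
  have h : ∀ n, q (M.app (M.app (M.eval tMinusR M.nil) f) n) = -q (hatR f n) :=
    fun n => by simp [tMinusR]
  refine val_eq_of_regular (fun n => ?_) 1 fun n => ?_
  · rw [h, h, neg_sub_neg, abs_sub_comm]; exact abs_hatR_sub_succ f n
  · rw [h, map_neg, neg_sub_neg, abs_sub_comm, one_mul]; exact abs_hatR_sub_val_le f n

@[simp] theorem val_absR (f : M.D R1) : val (M.app (M.eval tAbsR M.nil) f) = |val f| := by
  have h : ∀ n, q (M.app (M.app (M.eval tAbsR M.nil) f) n) = |q (hatR f n)| :=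
    fun n => by simp [tAbsR]
  refine val_eq_of_regular (fun n => ?_) 1 fun n => ?_
  · rw [h, h]; exact (abs_abs_sub_abs_le _ _).trans_lt (abs_hatR_sub_succ f n)
  · rw [h, ι_abs, one_mul]; exact (abs_abs_sub_abs_le _ _).trans (abs_hatR_sub_val_le f n)

def bdR (f : M.D R1) : M.D N := M.app (M.eval tBd M.nil) f

@[simp] theorem app_tBd (f : M.D R1) : M.app (M.eval tBd M.nil) f = bdR f := rfl

/-- Denominators are at least `1`, so `bdR f` bounds `|f 0| + 1` and hence every approximant, and
`bdR f < 2^(bdR f)`. -/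
theorem abs_hatR_mul_lt (f : M.D R1) (n : M.D N) : |q (hatR f n)| * tw (bdR f) < 1 := by
  have hb : bdR f = posN (M.app f 0) + negN (M.app f 0) + 1 := by rw [← app_tBd]; simp [tBd]
  have h0 : |q (M.app f 0)| + 1 ≤ Frac.mk (bdR f) 0 1 one_pos := by
    obtain ⟨d, hd⟩ := lt_iff.1 (denN_pos (M.app f 0))
    rw [← le_sub_iff_add_le, abs_le', Frac.one_def, sub_eq_add_neg, Frac.neg_mk, Frac.mk_add_mk, q,
      Frac.neg_mk, Frac.mk_le_mk, Frac.mk_le_mk, hb, hd]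
    set p := posN (M.app f 0)
    set r := negN (M.app f 0)
    exact ⟨⟨p * d + r * d + 2 * r, by ring⟩, ⟨p * d + r * d + 2 * p, by ring⟩⟩
  have h1 : Frac.mk (bdR f) 0 1 one_pos * tw (bdR f) < 1 := by
    change _ * Frac.mk 1 0 (pw (bdR f)) (pw_pos _) < _
    rw [Frac.mk_mul_mk, Frac.one_def, Frac.mk_lt_mk]
    simpa using lt_pw (bdR f)
  have h2 := abs_hatR_sub_le f (zero_le' n)
  rw [hatR_zero, abs_sub_comm] at h2
  have h3 := abs_sub_abs_le_abs_sub (q (hatR f n)) (q (M.app f 0))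
  have h4 := tw_le_one (K := Q M) (0 : M.D N)
  exact (mul_le_mul_of_nonneg_right (by linarith) (tw_pos _).le).trans_lt h1

@[simp] theorem val_timesR (f g : M.D R1) :
    val (M.app (M.app (M.eval tTimesR M.nil) f) g) = val f * val g := by
  have h : ∀ n, q (M.app (M.app (M.app (M.eval tTimesR M.nil) f) g) n) =
      q (hatR f (n + (bdR f + bdR g))) * q (hatR g (n + (bdR f + bdR g))) :=
    fun n => by simp [tTimesR]
  have half : ∀ f : M.D R1, 2 * tw (K := Q M) (bdR f) ≤ 1 := by
    intro f
    have hb : bdR f = posN (M.app f 0) + negN (M.app f 0) + 1 := by rw [← app_tBd]; simp [tBd]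
    rw [hb, tw_succ]; exact tw_le_one _
  -- In `ac - bd = a(c - d) + (a - b)d` each summand is below `z/2`: the bound on `a` or `d` cancels
  -- one of the factors `x`, `y`, and the other is at most `1/2`.
  have key : ∀ a b c d x y z : Q M, 0 < x → 2 * x ≤ 1 → 0 < y → 2 * y ≤ 1 → 0 < z →
      |a| * x < 1 → |d| * y < 1 → |a - b| < z * (x * y) → |c - d| < z * (x * y) →
      |a * c - b * d| < z := by
    intro a b c d x y z hx hx2 hy hy2 hz ha hd hab hcd
    have h1 : a * c - b * d = a * (c - d) + (a - b) * d := by ring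
    rw [h1]
    refine (abs_add_le _ _).trans_lt ?_
    rw [abs_mul, abs_mul]
    have h2 := mul_le_mul_of_nonneg_left hcd.le (abs_nonneg a)
    have h3 := mul_le_mul_of_nonneg_right hab.le (abs_nonneg d)
    have h4 := mul_lt_mul_of_pos_right ha (mul_pos hz hy)
    have h5 := mul_lt_mul_of_pos_right hd (mul_pos hz hx)
    have h6 := mul_le_mul_of_nonneg_left hx2 hz.le
    have h7 := mul_le_mul_of_nonneg_left hy2 hz.le
    linarith
  refine val_eq_of_regular (fun n => ?_) (|val f| + |val g| + 1) fun n => ?_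
  · rw [h, h]
    refine key _ _ _ _ (tw (bdR f)) (tw (bdR g)) _ (tw_pos _) (half f) (tw_pos _) (half g)
      (tw_pos _) (abs_hatR_mul_lt f _) (abs_hatR_mul_lt g _) ?_ ?_
    all_goals
      rw [← tw_add, ← tw_add, add_right_comm]
      exact abs_hatR_sub_succ _ _
  · rw [h, map_mul]
    have h1 := abs_hatR_sub_val_le f (n + (bdR f + bdR g))
    have h2 := abs_hatR_sub_val_le g (n + (bdR f + bdR g))
    have h3 : ι M (tw (n + (bdR f + bdR g))) ≤ ι M (tw n) := by
      rw [ι_le, tw_add]; exact mul_le_of_le_one_right (tw_pos _).le (tw_le_one _)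
    generalize ι M (q (hatR f (n + (bdR f + bdR g)))) = a at *
    generalize ι M (q (hatR g (n + (bdR f + bdR g)))) = b at *
    have h4 : a * b - val f * val g =
      (a - val f) * (b - val g) + val f * (b - val g) + (a - val f) * val g := by ring
    have h5 : |b - val g| ≤ 1 := (h2.trans h3).trans (by
      rw [← map_one (ι M), ι_le]; exact tw_le_one n)
    rw [h4]
    refine (abs_add_three _ _ _).trans ?_
    rw [abs_mul, abs_mul, abs_mul]
    have h6 := mul_le_mul (h1.trans h3) h5 (abs_nonneg _) (ι_tw_pos n).le
    have h7 := mul_le_mul_of_nonneg_left (h2.trans h3) (abs_nonneg (val f))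
    have h8 := mul_le_mul_of_nonneg_right (h1.trans h3) (abs_nonneg (val g))
    linarith

/-- At precision `n + 2l + 2` the approximants exceed `2⁻⁽ˡ⁺¹⁾` in absolute value, so their
reciprocals stay below `2ˡ⁺¹`. As `1/a - 1/b = (b - a)/(ab)`, inversion costs a factor of at most
`2²ˡ⁺²`, which the shift compensates. -/
theorem val_invR {l : M.D N} {f : M.D R1} (hf : ι M (tw l) < |val f|) :
    val (M.app (M.app (M.eval tInvR M.nil) l) f) * val f = 1 := by
  have h : ∀ n, M.app (M.app (M.app (M.eval tInvR M.nil) l) f) n =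
      invN (hatR f (n + (2 * l + 2))) := fun n => by simp [tInvR, num, one_add_one_eq_two]
  set g := M.app (M.app (M.eval tInvR M.nil) l) f
  have hl : ∀ n, tw (l + 1) < |q (hatR f (n + (2 * l + 2)))| := by
    intro n
    have h1 := abs_hatR_sub_val_le f (n + (2 * l + 2))
    have h2 : tw (K := Q M) (n + (2 * l + 2)) ≤ tw (l + 1) := by
      rw [show n + (2 * l + 2) = (l + 1) + (n + l + 1) by ring, tw_add]
      exact mul_le_of_le_one_right (tw_pos _).le (tw_le_one _)
    have h3 := ι_tw_succ l
    have h4 := abs_sub_abs_le_abs_sub (val f) (ι M (q (hatR f (n + (2 * l + 2)))))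
    rw [abs_sub_comm] at h4
    rw [← ι_lt, ι_abs]
    have h5 := ι_le.2 h2
    linarith
  have hne : ∀ n, q (M.app g n) * q (hatR f (n + (2 * l + 2))) = 1 := by
    intro n
    rw [h]
    refine q_invN fun h0 => ?_
    have := hl n
    rw [h0, abs_zero] at this
    exact absurd this (not_lt.2 (tw_pos _).le)
  have hi : ∀ n, |q (M.app g n)| * tw (l + 1) < 1 := by
    intro n
    have h1 := congrArg abs (hne n)
    rw [abs_mul, abs_one] at h1
    have h2 : 0 < |q (M.app g n)| := abs_pos.2 fun h0 => by
      rw [h0, abs_zero, zero_mul] at h1; exact zero_ne_one h1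
    rw [← h1]
    exact mul_lt_mul_of_pos_left (hl n) h2
  have hreg : Regular g := by
    intro n
    have h1 := abs_hatR_sub_succ f (n + (2 * l + 2))
    have h2 := hne n
    have h3 := hne (n + 1)
    rw [add_right_comm n 1] at h3
    have h4 : q (M.app g n) - q (M.app g (n + 1)) = q (M.app g n) * q (M.app g (n + 1)) *
        (q (hatR f (n + (2 * l + 2) + 1)) - q (hatR f (n + (2 * l + 2)))) := by
      linear_combination q (M.app g (n + 1)) * h2 - q (M.app g n) * h3
    rw [h4, abs_mul, abs_mul, abs_sub_comm]
    have h5 : tw (K := Q M) (n + (2 * l + 2) + 1) = tw (l + 1) * tw (l + 1) * tw (n + 1) := by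
      rw [← tw_add, ← tw_add]; congr 1; ring
    rw [h5] at h1
    have h6 := mul_lt_mul'' (hi n) (hi (n + 1)) (mul_nonneg (abs_nonneg _) (tw_pos _).le)
      (mul_nonneg (abs_nonneg _) (tw_pos _).le)
    have h7 := mul_le_mul_of_nonneg_left h1.le
      (mul_nonneg (abs_nonneg (q (M.app g n))) (abs_nonneg (q (M.app g (n + 1)))))
    have h8 := mul_lt_mul_of_pos_right h6 (tw_pos (K := Q M) (n + 1))
    linarith
  rw [← sub_eq_zero]
  refine eq_zero_of_abs_le (R := M.D N) (|val f| + |val g| + 1) fun n => ?_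
  have h1 := abs_hatR_sub_val_le f (n + (2 * l + 2))
  have h2 := abs_hatR_sub_val_le g n
  rw [hatR_of_regular hreg] at h2
  have h3 : ι M (tw (n + (2 * l + 2))) ≤ ι M (tw n) := by
    rw [ι_le, tw_add]; exact mul_le_of_le_one_right (tw_pos _).le (tw_le_one _)
  have h4 := congrArg (ι M) (hne n)
  rw [map_mul, map_one] at h4
  generalize ι M (q (hatR f (n + (2 * l + 2)))) = a at *
  generalize ι M (q (M.app g n)) = b at *
  have h5 : val g * val f - 1 = -((b - val g) * (a - val f) + val g * (a - val f) +
    (b - val g) * val f) := by linear_combination h4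
  have h6 : |a - val f| ≤ 1 := (h1.trans h3).trans (by
    rw [← map_one (ι M), ι_le]; exact tw_le_one n)
  rw [h5, abs_neg]
  refine (abs_add_three _ _ _).trans ?_
  rw [abs_mul, abs_mul, abs_mul]
  have h7 := mul_le_mul h2 h6 (abs_nonneg _) (ι_tw_pos n).le
  have h8 := mul_le_mul_of_nonneg_left (h1.trans h3) (abs_nonneg (val g))
  have h9 := mul_le_mul_of_nonneg_right h2 (abs_nonneg (val f))
  linarith

attribute [simp] sat_eqR sat_ltR sat_leR

end Model
end Comon

namespace Comon

/-! ## The normed space of a model -/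

/-- The theory contains the axioms of the theory of real inner product spaces. -/
class IsInnerProductTheory (T : Set (Fm [])) : Prop where
  mem : ∀ φ ∈ innerProductAxioms, φ ∈ T

namespace Model
open Completion Scale
variable {T : Set (Fm [])} {M : Model T}

theorem sat_ax {φ : Fm []} (h : φ ∈ T) : M.Sat φ M.nil := by
  have := M.sound (Prv.ax (Γ := []) (Δ := []) h)
  rwa [Fm.emb_nil] at this

def addX (x y : M.D X) : M.D X := M.app (M.app (M.con .plusX) x) y
def negX (x : M.D X) : M.D X := M.app (M.con .minusX) x
def smulX (a : M.D R1) (x : M.D X) : M.D X := M.app (M.app (M.con .scalX) a) x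
noncomputable def nrmX (x : M.D X) : F M := val (M.app (M.con .normX) x)

@[simp] theorem app_plusX (x y : M.D X) : M.app (M.app (M.con .plusX) x) y = addX x y := rfl
@[simp] theorem app_minusX (x : M.D X) : M.app (M.con .minusX) x = negX x := rfl
@[simp] theorem app_scalX (a : M.D R1) (x : M.D X) :
    M.app (M.app (M.con .scalX) a) x = smulX a x := rfl
@[simp] theorem val_normX (x : M.D X) : val (M.app (M.con .normX) x) = nrmX x := rfl

variable [IsInnerProductTheory T]

-- The index is the position in the list of axioms: `0`-`7` for the vector space, `8`-`16` for the
-- norm, `17` for the parallelogram law.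
variable (M) in
theorem sat_innerProductAxioms (i : ℕ) (h : i < innerProductAxioms.length) :
    M.Sat innerProductAxioms[i] M.nil :=
  sat_ax (IsInnerProductTheory.mem _ (List.getElem_mem h))

theorem nrmX_sub_self (x : M.D X) : nrmX (addX x (negX x)) = 0 := by
  have h := M.sat_innerProductAxioms 8 (by decide)
  simp [innerProductAxioms, vectorSpaceAxioms, normAxioms] at h
  exact h x

theorem nrmX_sub_comm (x y : M.D X) : nrmX (addX x (negX y)) = nrmX (addX y (negX x)) := by
  have h := M.sat_innerProductAxioms 9 (by decide)
  simp [innerProductAxioms, vectorSpaceAxioms, normAxioms] at h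
  exact h x y

theorem nrmX_triangle (x y z : M.D X) :
    nrmX (addX x (negX z)) ≤ nrmX (addX x (negX y)) + nrmX (addX y (negX z)) := by
  have h := M.sat_innerProductAxioms 10 (by decide)
  simp [innerProductAxioms, vectorSpaceAxioms, normAxioms] at h
  exact h x y z

theorem nrmX_smul_sub (a : M.D R1) (x y : M.D X) :
    nrmX (addX (smulX a x) (negX (smulX a y))) = |val a| * nrmX (addX x (negX y)) := by
  have h := M.sat_innerProductAxioms 11 (by decide)
  simp [innerProductAxioms, vectorSpaceAxioms, normAxioms] at h
  exact h a x y

theorem nrmX_sub_smul (a b : M.D R1) (x : M.D X) :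
    nrmX (addX (smulX a x) (negX (smulX b x))) = |val a - val b| * nrmX x := by
  have h := M.sat_innerProductAxioms 12 (by decide)
  simp [innerProductAxioms, vectorSpaceAxioms, normAxioms] at h
  rw [h a b x, sub_eq_add_neg]

theorem nrmX_add_sub_add (x y u v : M.D X) : nrmX (addX (addX x y) (negX (addX u v))) ≤
    nrmX (addX x (negX u)) + nrmX (addX y (negX v)) := by
  have h := M.sat_innerProductAxioms 13 (by decide)
  simp [innerProductAxioms, vectorSpaceAxioms, normAxioms] at h
  exact h x y u v

theorem nrmX_neg_sub_neg (x y : M.D X) :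
    nrmX (addX (negX x) (negX (negX y))) = nrmX (addX x (negX y)) := by
  have h := M.sat_innerProductAxioms 14 (by decide)
  simp [innerProductAxioms, vectorSpaceAxioms, normAxioms] at h
  exact h x y

theorem abs_nrmX_sub_le (x y : M.D X) : |nrmX x - nrmX y| ≤ nrmX (addX x (negX y)) := by
  have h := M.sat_innerProductAxioms 15 (by decide)
  simp [innerProductAxioms, vectorSpaceAxioms, normAxioms] at h
  rw [sub_eq_add_neg]
  exact h x y

theorem nrmX_sub_nonneg (x y : M.D X) : 0 ≤ nrmX (addX x (negX y)) :=
  (abs_nonneg _).trans (abs_nrmX_sub_le x y)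

variable (M) in
/-- Equality of vectors. -/
instance setoidX : Setoid (M.D X) where
  r x y := nrmX (addX x (negX y)) = 0
  iseqv :=
    { refl := nrmX_sub_self
      symm := fun h => by rwa [nrmX_sub_comm]
      trans := fun {x y z} h h' => le_antisymm
        ((nrmX_triangle x y z).trans (by rw [h, h', add_zero])) (nrmX_sub_nonneg x z) }

variable (M) in
/-- The vectors of `M`, up to equality. -/
def Vec := Quotient (setoidX M)

def vec (x : M.D X) : Vec M := Quotient.mk _ x

theorem vec_eq {x y : M.D X} : vec x = vec y ↔ nrmX (addX x (negX y)) = 0 :=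
  ⟨fun h => Quotient.exact h, fun h => Quotient.sound h⟩

theorem Vec.ind {P : Vec M → Prop} (h : ∀ x, P (vec x)) (x : Vec M) : P x := Quotient.inductionOn x h

@[simp] theorem sat_eqX {Γ : Ctx} {x y : Tm Γ X} {e : M.Env Γ} :
    M.Sat (eqX x y) e ↔ vec (M.eval x e) = vec (M.eval y e) := by
  rw [eqX, sat_eqR, vec_eq]; simp

instance : Zero (Vec M) := ⟨vec (M.con .zeroX)⟩

/-- The axioms that make the operations extensional are what lets them descend to the quotient. -/
instance : Add (Vec M) := ⟨Quotient.map₂ addX fun x x' h y y' h' => le_antisymm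
  ((nrmX_add_sub_add x y x' y').trans (by
    rw [show nrmX (addX x (negX x')) = 0 from h, show nrmX (addX y (negX y')) = 0 from h', add_zero]))
  (nrmX_sub_nonneg _ _)⟩

instance : Neg (Vec M) := ⟨Quotient.map negX fun x x' h => (nrmX_neg_sub_neg x x').trans h⟩

@[simp] theorem vec_zeroX : vec (M.con .zeroX) = 0 := rfl
@[simp] theorem vec_addX (x y : M.D X) : vec (addX x y) = vec x + vec y := rfl
@[simp] theorem vec_negX (x : M.D X) : vec (negX x) = -vec x := rfl

theorem add_comm_vec (x y : Vec M) : x + y = y + x := by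
  induction x using Vec.ind with | _ x
  induction y using Vec.ind with | _ y
  have h := M.sat_innerProductAxioms 1 (by decide)
  simp [innerProductAxioms, vectorSpaceAxioms] at h
  exact h x y

theorem add_zero_vec (x : Vec M) : x + 0 = x := by
  induction x using Vec.ind with | _ x
  have h := M.sat_innerProductAxioms 2 (by decide)
  simp [innerProductAxioms, vectorSpaceAxioms] at h
  exact h x

theorem add_neg_vec (x : Vec M) : x + -x = 0 := by
  induction x using Vec.ind with | _ x
  have h := M.sat_innerProductAxioms 3 (by decide)
  simp [innerProductAxioms, vectorSpaceAxioms] at h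
  exact h x

instance : AddCommGroup (Vec M) where
  add_assoc x y z := by
    induction x using Vec.ind with | _ x
    induction y using Vec.ind with | _ y
    induction z using Vec.ind with | _ z
    have h := M.sat_innerProductAxioms 0 (by decide)
    simp [innerProductAxioms, vectorSpaceAxioms] at h
    exact (h x y z).symm
  zero_add x := by rw [add_comm_vec, add_zero_vec]
  add_zero := add_zero_vec
  add_comm := add_comm_vec
  neg_add_cancel x := by rw [add_comm_vec, add_neg_vec]
  nsmul := nsmulRec
  zsmul := zsmulRec

/-- The norm of a vector. -/
noncomputable def nrm : Vec M → F M := Quotient.lift nrmX fun x y h => by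
  have h1 := abs_nrmX_sub_le x y
  rw [show nrmX (addX x (negX y)) = 0 from h, abs_nonpos_iff] at h1
  exact sub_eq_zero.1 h1

theorem nrm_vec (x : M.D X) : nrm (vec x) = nrmX x := rfl

@[simp] theorem nrmX_eq (x : M.D X) : nrmX x = nrm (vec x) := rfl

/-- Scalar multiplication. -/
def scal (a : M.D R1) : Vec M →+ Vec M :=
  AddMonoidHom.mk' (Quotient.map (smulX a) fun x y h => by
    change nrmX _ = 0
    rw [nrmX_smul_sub, show nrmX (addX x (negX y)) = 0 from h, mul_zero]) fun x y => by
  induction x using Vec.ind with | _ x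
  induction y using Vec.ind with | _ y
  have h := M.sat_innerProductAxioms 7 (by decide)
  simp [innerProductAxioms, vectorSpaceAxioms] at h
  exact h a x y

@[simp] theorem vec_smulX (a : M.D R1) (x : M.D X) : vec (smulX a x) = scal a (vec x) := rfl

theorem nrm_eq_zero {x : Vec M} : nrm x = 0 ↔ x = 0 := by
  induction x using Vec.ind with | _ x
  rw [← vec_zeroX, vec_eq, ← nrm_vec, vec_addX, vec_negX, vec_zeroX, neg_zero, add_zero]

theorem nrm_nonneg (x : Vec M) : 0 ≤ nrm x := by
  induction x using Vec.ind with | _ x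
  have h := nrmX_sub_nonneg x (M.con .zeroX)
  rwa [← nrm_vec, vec_addX, vec_negX, vec_zeroX, neg_zero, add_zero] at h

theorem nrm_scal (a : M.D R1) (x : Vec M) : nrm (scal a x) = |val a| * nrm x := by
  induction x using Vec.ind with | _ x
  have h := nrmX_smul_sub a x (M.con .zeroX)
  simpa [← nrm_vec] using h

/-- Scalars are objects of type `1`, because an element of `F M` need not be the value of such an
object; the action still depends only on the value. -/
theorem scal_congr {a b : M.D R1} (h : val a = val b) (x : Vec M) : scal a x = scal b x := by
  induction x using Vec.ind with | _ x
  have h1 := nrmX_sub_smul a b x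
  rw [h, sub_self, abs_zero, zero_mul] at h1
  exact vec_eq.2 h1

theorem scal_of_val_eq_one {a : M.D R1} (ha : val a = 1) (x : Vec M) : scal a x = x := by
  have h := M.sat_innerProductAxioms 4 (by decide)
  simp [innerProductAxioms, vectorSpaceAxioms, num, one_add_one_eq_two] at h
  have h1 : scal (M.app (M.eval tRat M.nil) (pairJ 2 0)) x = x := by
    induction x using Vec.ind with | _ x
    exact h x
  refine (scal_congr ?_ x).trans h1
  rw [ha, val_ratR, q_one, map_one]

theorem scal_timesR (a b : M.D R1) (x : Vec M) :
    scal (M.app (M.app (M.eval tTimesR M.nil) a) b) x = scal a (scal b x) := by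
  induction x using Vec.ind with | _ x
  have h := M.sat_innerProductAxioms 5 (by decide)
  simp [innerProductAxioms, vectorSpaceAxioms] at h
  exact (h a b x).symm

theorem scal_plusR (a b : M.D R1) (x : Vec M) :
    scal (M.app (M.app (M.eval tPlusR M.nil) a) b) x = scal a x + scal b x := by
  induction x using Vec.ind with | _ x
  have h := M.sat_innerProductAxioms 6 (by decide)
  simp [innerProductAxioms, vectorSpaceAxioms] at h
  exact h a b x

theorem nrm_add_le (x y : Vec M) : nrm (x + y) ≤ nrm x + nrm y := by
  induction x using Vec.ind with | _ x
  induction y using Vec.ind with | _ y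
  have h := nrmX_triangle x (M.con .zeroX) (negX y)
  simpa using h

end Model
end Comon

/-! ### The operator and the four statements in a model -/

namespace Comon

/-- Strips the quantifiers from a provable equation, so that `Model.ext` applies to its open terms.
-/
theorem Prv.of_all {T : Set (Fm [])} {Γ : Ctx} {τ : Ty} {φ : Fm (τ :: Γ)}
    (h : Prv T Γ [] (.all τ φ)) : Prv T (τ :: Γ) [] φ := by
  have h1 := (h.rename (Γ' := τ :: Γ) (Δ' := []) (fun _ v => .s v) (by simp)).allE v0
  rwa [Fm.rename_lift_inst] at h1

namespace Model
open Completion Scale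
variable {T : Set (Fm [])} {M : Model T}

/-- `u ∈ A x`. -/
def Mem (u x : M.D X) : Prop := M.app (M.app (M.con .chi) x) u = 0

@[simp] theorem sat_mem {Γ : Ctx} {u x : Tm Γ X} {e : M.Env Γ} :
    M.Sat (mem u x) e ↔ Mem (M.eval u e) (M.eval x e) := Iff.rfl

/-- The reciprocal `(γ)⁻¹_l`. -/
def inv (l : M.D N) (γ : M.D R1) : M.D R1 := M.app (M.app (M.eval tInvR M.nil) l) γ

@[simp] theorem app_tInvR (l : M.D N) (γ : M.D R1) :
    M.app (M.app (M.eval tInvR M.nil) l) γ = inv l γ := rfl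

/-- The resolvent `J_γ x`. -/
def jX (γ : M.D R1) (x : M.D X) : M.D X := M.app (M.app (M.con .res) γ) x

@[simp] theorem app_res (γ : M.D R1) (x : M.D X) :
    M.app (M.app (M.con .res) γ) x = jX γ x := rfl

/-- The resolvent axiom for the parameters `γ` with `P γ`. -/
def Res (P : M.D R1 → Prop) : Prop :=
  ∀ γ x l, P γ → ι M (tw l) < val γ → Mem (smulX (inv l γ) (addX x (negX (jX γ x)))) (jX γ x)

theorem nonpos_of_le_mul {x : F M} (C : F M) (h : ∀ n, x ≤ C * ι M (tw n)) : x ≤ 0 := by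
  by_contra hx
  rw [not_le] at hx
  exact hx.ne' (eq_zero_of_abs_le (R := M.D N) C fun n => by rw [abs_of_pos hx]; exact h n)

theorem abs_mul_self_sub_le {a b t : F M} (hb : 0 ≤ b) (ht : t ≤ 1) (h : |a - b| ≤ 2 * t) :
    |a * a - b * b| ≤ 2 * t * (2 * b + 2) := by
  have h1 : |a + b| ≤ 2 * b + 2 := by
    rw [abs_le] at h ⊢
    constructor <;> linarith
  rw [show a * a - b * b = (a - b) * (a + b) by ring, abs_mul]
  exact mul_le_mul h h1 (abs_nonneg _) ((abs_nonneg _).trans h)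

/-- The axiom gives only `≥ 2⁻ᵐ`, while reciprocals require a strict bound, so `l = m + 1` is used
for `γ̃`. -/
theorem two_pow_lt_gam (hg : axGam ∈ T) (M : Model T) :
    ι M (tw (M.con .mgam + 1)) < val (M.con .gam) := by
  have h := M.sat_ax hg
  simp [axGam] at h
  have h1 := ι_tw_succ (M := M) (M.con .mgam)
  have h2 := ι_tw_pos (M := M) (M.con .mgam + 1)
  linarith

variable [IsInnerProductTheory T]

/-- The strong resolvent axiom for the parameters `γ` with `P γ`. -/
def StrongRes (P : M.D R1 → Prop) : Prop :=
  ∀ γ x p l, ι M (tw l) < val γ → P γ → vec p = vec (jX γ x) →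
    Mem (smulX (inv l γ) (addX x (negX p))) p

/-- `⟨x, u⟩ ≥ ρ̃ ‖u‖²`. -/
def Comonotone (x u : Vec M) : Prop := val (M.con .rho) * (nrm u * nrm u) ≤
  ι M (tw 2) * (nrm (x + u) * nrm (x + u) + -(nrm (x + -u) * nrm (x + -u)))

@[simp] theorem sat_comonIneq {Γ : Ctx} {x y u v : Tm Γ X} {e : M.Env Γ} :
    M.Sat (comonIneq x y u v) e ↔
      Comonotone (vec (M.eval x e) + -vec (M.eval y e)) (vec (M.eval u e) + -vec (M.eval v e)) := by
  rw [comonIneq, sat_leR]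
  simp [innerX, Comonotone, num, one_add_one_eq_two]

variable (M) in
/-- Extensionality of `A`. -/
def Extensional : Prop :=
  ∀ x y x' y' : M.D X, vec x = vec x' → vec y = vec y' →
    M.app (M.app (M.con .chi) x) y = M.app (M.app (M.con .chi) x') y'

theorem sat_extensionality : M.Sat extensionality M.nil ↔ Extensional M := by
  simp [extensionality, Extensional]

variable (M) in
/-- Maximal comonotonicity of `A`. -/
def Maximal : Prop :=
  ∀ x u : M.D X, (∀ y v, Mem v y → Comonotone (vec x + -vec y) (vec u + -vec v)) → Mem u x

theorem sat_maximalComonotone : M.Sat maximalComonotone M.nil ↔ Maximal M := by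
  simp [maximalComonotone, Maximal]

/-- Convergence of a sequence of vectors. -/
def Conv (xs : M.D (N⇒X)) (x : M.D X) : Prop :=
  ∀ k, ∃ n, ∀ m, n ≤ m → nrm (vec (M.app xs m) + -vec x) ≤ ι M (tw k)

@[simp] theorem sat_convX {Γ : Ctx} {xs : Tm Γ (N⇒X)} {x : Tm Γ X} {e : M.Env Γ} :
    M.Sat (convX xs x) e ↔ Conv (M.eval xs e) (M.eval x e) := by
  simp [convX, Conv, tsub_eq_zero_iff_le]

variable (M) in
/-- Closedness of the graph of `A`. -/
def Closed : Prop :=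
  ∀ (x y : M.D X) (xs ys : M.D (N⇒X)), Conv xs x → Conv ys y →
    (∀ n, Mem (M.app ys n) (M.app xs n)) → Mem y x

theorem sat_closedGraph : M.Sat closedGraph M.nil ↔ Closed M := by
  simp [closedGraph, Closed]

/-! ### The cycle of implications in a model -/

theorem Extensional.strongRes (h : Extensional M) {P : M.D R1 → Prop} (hr : Res P) :
    StrongRes P := by
  intro γ x p l hl hP hp
  refine (h _ _ _ _ hp ?_).trans (hr γ x l hP hl)
  simp [hp]

theorem abs_nrm_sub_le (x y : Vec M) : |nrm x - nrm y| ≤ nrm (x + -y) := by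
  induction x using Vec.ind with | _ x
  induction y using Vec.ind with | _ y
  simpa using abs_nrmX_sub_le x y

theorem nrm_add_scal (γ : M.D R1) (w : Vec M) : nrm (w + scal γ w) = |1 + val γ| * nrm w := by
  have h : val (M.app (M.eval tRat M.nil) (pairJ 2 0) : M.D R1) = 1 := by simp
  nth_rewrite 1 [← scal_of_val_eq_one h w]
  rw [← scal_plusR, nrm_scal, val_plusR, h]

theorem scal_minusR (γ : M.D R1) (w : Vec M) :
    scal (M.app (M.eval tMinusR M.nil) γ) w = -scal γ w := by
  rw [eq_neg_iff_add_eq_zero, ← scal_plusR, ← nrm_eq_zero, nrm_scal]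
  simp

theorem nrm_neg (w : Vec M) : nrm (-w) = nrm w := by
  have h : val (M.app (M.eval tRat M.nil) (pairJ 2 0) : M.D R1) = 1 := by simp
  nth_rewrite 1 [← scal_of_val_eq_one h w]
  rw [← scal_minusR, nrm_scal]
  simp

/-- Comonotonicity passes to limits. -/
theorem Comonotone.of_limit {x u : Vec M} (h : ∀ k, ∃ x' u', nrm (x' + -x) ≤ ι M (tw k) ∧
    nrm (u' + -u) ≤ ι M (tw k) ∧ Comonotone x' u') : Comonotone x u := by
  unfold Comonotone at *
  rw [← sub_nonpos]
  -- All three norms change by at most `2 · 2⁻ᵏ`, so each square changes by at most `2 · 2⁻ᵏ (2b +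
  -- 2)` with `b` the limiting norm; the constant collects these errors with the weights `|ρ̃|` and
  -- `1/4`.
  refine nonpos_of_le_mul (|val (M.con .rho)| * (2 * (2 * nrm u + 2)) + ι M (tw 2) *
    (2 * (2 * nrm (x + u) + 2) + 2 * (2 * nrm (x + -u) + 2))) fun k => ?_
  obtain ⟨x', u', hx, hu, h⟩ := h k
  have ht : ι M (tw k) ≤ 1 := by rw [← map_one (ι M), ι_le]; exact tw_le_one k
  have h0 := ι_tw_pos (M := M) k
  have h1 := abs_mul_self_sub_le (a := nrm u') (nrm_nonneg u) ht
    ((abs_nrm_sub_le u' u).trans (by linarith))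
  have h2 := abs_mul_self_sub_le (a := nrm (x' + u')) (nrm_nonneg (x + u)) ht
    ((abs_nrm_sub_le _ _).trans (by
      rw [show x' + u' + -(x + u) = (x' + -x) + (u' + -u) by abel]
      exact (nrm_add_le _ _).trans (by linarith)))
  have h3 := abs_mul_self_sub_le (a := nrm (x' + -u')) (nrm_nonneg (x + -u)) ht
    ((abs_nrm_sub_le _ _).trans (by
      rw [show x' + -u' + -(x + -u) = (x' + -x) + -(u' + -u) by abel]
      refine (nrm_add_le _ _).trans ?_
      rw [nrm_neg]; linarith))
  have h4 := mul_le_mul_of_nonneg_left h1 (abs_nonneg (val (M.con .rho)))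
  rw [← abs_mul] at h4
  have h5 := mul_le_mul_of_nonneg_left (le_of_abs_le h2) (ι_tw_pos (M := M) 2).le
  have h6 := mul_le_mul_of_nonneg_left (neg_le_of_abs_le h3) (ι_tw_pos (M := M) 2).le
  have h7 := neg_le_of_abs_le h4
  linarith

/-- Every graph point is comonotonically related to all pairs `(x_n, y_n)`, hence to their limit,
which maximality then puts into the graph. -/
theorem Maximal.closed (h : Maximal M)
    (hc : ∀ x y u v : M.D X, Mem u x → Mem v y →
      Comonotone (vec x + -vec y) (vec u + -vec v)) : Closed M := by
  intro x y xs ys hx hy hm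
  refine h x y fun z v hv => Comonotone.of_limit fun k => ?_
  obtain ⟨n, hn⟩ := hx k
  obtain ⟨m, hm'⟩ := hy k
  refine ⟨_, _, ?_, ?_, hc _ _ _ _ (hm (max n m)) hv⟩
  · convert hn _ (le_max_left n m) using 2; abel
  · convert hm' _ (le_max_right n m) using 2; abel

/-- A constant sequence converges to every vector that is `=_X` to its value, so membership
transfers in both directions; as `χ_A` takes only the values `0` and `1`, this gives equality of its
values. -/
theorem Closed.extensional (h : Closed M)
    (hb : ∀ x u : M.D X, M.app (M.app (M.con .chi) x) u ≤ 1) : Extensional M := by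
  -- The combinator `Π` applied to `x` is the constant sequence.
  have conv : ∀ x x' : M.D X, vec x = vec x' → Conv (M.app (M.con (.pi X N)) x) x' := by
    intro x x' hx k
    refine ⟨0, fun m _ => ?_⟩
    rw [app_pi, hx, add_neg_cancel, nrm_eq_zero.2 rfl]
    exact (ι_tw_pos k).le
  have key : ∀ x y x' y' : M.D X, vec x = vec x' → vec y = vec y' → Mem y x → Mem y' x' :=
    fun x y x' y' hx hy hm => h x' y' _ _ (conv x x' hx) (conv y y' hy) fun n => by
      rw [app_pi, app_pi]; exact hm
  have hb' : ∀ x u : M.D X, Mem u x ∨ M.app (M.app (M.con .chi) x) u = 1 := by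
    intro x u
    rcases eq_zero_or_suc (M.app (M.app (M.con .chi) x) u) with h0 | ⟨c, h1⟩
    · exact .inl h0
    · have h2 := hb x u
      rw [h1] at h2 ⊢
      have h3 : c = 0 := by simpa using h2
      exact .inr (by rw [h3, zero_add])
  intro x y x' y' hx hy
  rcases hb' x y with h1 | h1
  · exact Eq.trans h1 (key x y x' y' hx hy h1).symm
  · rcases hb' x' y' with h2 | h2
    · exact Eq.trans (key x' y' x y hx.symm hy.symm h2) (Eq.symm h2)
    · rw [h1, h2]

theorem scal_inv {γ : M.D R1} {l : M.D N} (h : ι M (tw l) < val γ) (x : Vec M) :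
    scal γ (scal (inv l γ) x) = x := by
  rw [← scal_timesR]
  refine scal_of_val_eq_one ?_ x
  rw [val_timesR, mul_comm]
  exact val_invR (h.trans_le (le_abs_self _))

theorem inv_scal {γ : M.D R1} {l : M.D N} (h : ι M (tw l) < val γ) (x : Vec M) :
    scal (inv l γ) (scal γ x) = x := by
  rw [← scal_timesR]
  refine scal_of_val_eq_one ?_ x
  rw [val_timesR]
  exact val_invR (h.trans_le (le_abs_self _))

/-- A vector `w` with `⟨-γ w, w⟩ ≥ ρ̃ ‖w‖²` vanishes if `ρ̃ > -γ`. -/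
theorem Comonotone.eq_zero {γ : M.D R1} {w : Vec M} (h : Comonotone (-scal γ w) w)
    (hγ : 0 < val (M.con .rho) + val γ) : w = 0 := by
  unfold Comonotone at h
  -- Both vectors are multiples of `w`, so homogeneity of the norm evaluates the polarization
  -- formula: `¼((1 - γ)² - (1 + γ)²) = -γ`.
  have h1 : nrm (-scal γ w + w) = |1 - val γ| * nrm w := by
    rw [add_comm, ← scal_minusR, nrm_add_scal, val_minusR, sub_eq_add_neg]
  have h2 : nrm (-scal γ w + -w) = |1 + val γ| * nrm w := by
    rw [← neg_add, nrm_neg, add_comm, nrm_add_scal]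
  have h3 : 4 * ι M (tw 2) = 1 := by
    have h4 := ι_tw_succ (M := M) 1
    have h5 := ι_tw_succ (M := M) 0
    have h6 : ι M (tw 0) = 1 := by
      have h7 := ι_tw_add (M := M) 0 0
      rw [add_zero] at h7
      exact (mul_left_cancel₀ (ι_tw_pos (M := M) 0).ne' (by rw [mul_one]; exact h7)).symm
    rw [one_add_one_eq_two] at h4
    rw [zero_add, h6] at h5
    linarith
  rw [h1, h2, mul_mul_mul_comm |1 - _|, abs_mul_abs_self, mul_mul_mul_comm |1 + _|,
    abs_mul_abs_self] at h
  have h8 : (val (M.con .rho) + val γ) * (nrm w * nrm w) ≤ 0 := by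
    linear_combination h + (-val γ * (nrm w * nrm w)) * h3
  have h9 : nrm w * nrm w ≤ 0 := nonpos_of_mul_nonpos_right h8 hγ
  exact nrm_eq_zero.1 (mul_self_eq_zero.1 (le_antisymm h9 (mul_self_nonneg _)))

/-- An identity of elements, not merely modulo `=_X`; without extensionality of `χ_A` only this
permits replacement inside a membership statement. The equation is proved in the theory, through
completeness, and then `Model.ext` applies: this is where the quantifier-free rule of extensionality
is used. -/
theorem inv_smul_add_sub (hg : axGam ∈ T) (x u : M.D X) :
    smulX (inv (M.con .mgam + 1) (M.con .gam))
      (addX (addX x (smulX (M.con .gam) u)) (negX x)) = u := by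
  have h : Proves T (.all X (.all X (eqX (scalX (invR (S mgam) gam)
      (subX (plusX v1 (scalX gam v0)) v1)) v0))) := by
    refine Proves.of_forall_model fun M => ?_
    simp only [Str.sat_all, sat_eqX]
    intro x u
    have := inv_scal (M.two_pow_lt_gam hg) (vec u)
    simpa using this
  have h1 := M.ext (τ := X) (Prv.of_all (Prv.of_all h)) (Str.cons u (Str.cons x M.nil))
  simpa using h1

/-- The resolvent at `z = x + γ̃u` supplies the one graph point with which `(x, u)` has to be
compared. That comparison forces `J_γ̃ z =_X x`, and the strong resolvent axiom may then be used at
`x` itself. -/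
theorem StrongRes.maximal (hg : axGam ∈ T) {P : M.D R1 → Prop} (h : StrongRes P) (hr : Res P)
    (hP : P (M.con .gam)) (hρ : 0 < val (M.con .rho) + val (M.con .gam)) : Maximal M := by
  intro x u hxu
  have hγ := M.two_pow_lt_gam hg
  set γ := M.con .gam
  set l := M.con .mgam + 1
  set z := addX x (smulX γ u) with hz
  have h1 := hxu _ _ (hr γ z l hP hγ)
  set p := jX γ z with hp
  have h2 : vec z = vec x + scal γ (vec u) := rfl
  -- With `w = u - γ⁻¹(z - p)`, this says `γw = -(x - p)`, so the comonotonicity inequality involves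
  -- only `w` and its multiple `-γw`.
  have h3 : scal γ (vec u + -vec (smulX (inv l γ) (addX z (negX p)))) = -(vec x + -vec p) := by
    rw [map_add, map_neg, vec_smulX, scal_inv hγ, vec_addX, vec_negX, h2]; abel
  have h4 := Comonotone.eq_zero (γ := γ) (by rw [h3, neg_neg]; exact h1) hρ
  rw [h4, map_zero, eq_comm, neg_eq_zero, ← sub_eq_add_neg, sub_eq_zero] at h3
  have h5 := h γ z x l hγ hP h3
  rwa [hz, inv_smul_add_sub hg] at h5

end Model

/-- The equivalences, for a theory in which the resolvent axiom holds for the parameters `γ` with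
`P γ`, and in which `sr` is the strong resolvent axiom for these parameters. -/
theorem proves_imp {T : Set (Fm [])} [IsInnerProductTheory T] (hb : axBool ∈ T) (hc : axComon ∈ T)
    (hg : axGam ∈ T) {sr : Fm []} (P : ∀ M : Model T, M.D R1 → Prop)
    (hsr : ∀ M : Model T, M.Sat sr M.nil ↔ Model.StrongRes (P M))
    (hr : ∀ M : Model T, Model.Res (P M)) (hP : ∀ M : Model T, P M (M.con .gam))
    (hρ : ∀ M : Model T, 0 < Model.val (M.con .rho) + Model.val (M.con .gam)) :
    ∀ φ ∈ [extensionality, sr, maximalComonotone, closedGraph],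
      ∀ ψ ∈ [extensionality, sr, maximalComonotone, closedGraph], Proves T (φ.imp ψ) := by
  have key : ∀ M : Model T, ([extensionality, sr, maximalComonotone, closedGraph].map
      (M.Sat · M.nil)).TFAE := by
    intro M
    simp only [List.map, Model.sat_extensionality, hsr, Model.sat_maximalComonotone,
      Model.sat_closedGraph]
    have h1 := M.sat_ax hb
    have h2 := M.sat_ax hc
    simp [axBool, axComon, tsub_eq_zero_iff_le] at h1 h2
    tfae_have 1 → 2 := fun h => h.strongRes (hr M)
    tfae_have 2 → 3 := fun h => h.maximal hg (hr M) (hP M) (hρ M)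
    tfae_have 3 → 4 := fun h => h.closed h2
    tfae_have 4 → 1 := fun h => h.extensional h1
    tfae_finish
  intro φ hφ ψ hψ
  refine Proves.of_forall_model fun M => ?_
  exact (key M _ (List.mem_map_of_mem hφ) _ (List.mem_map_of_mem hψ)).1

instance : IsInnerProductTheory U := ⟨fun _ h => List.mem_append_left _ h⟩
instance : IsInnerProductTheory UStar := ⟨fun _ h => List.mem_append_left _ h⟩

end Comon

/-! ### The two theories -/

theorem mainTheorem5 :
    (∀ φ ∈ [Comon.extensionality, Comon.strongResolvent, Comon.maximalComonotone,
          Comon.closedGraph],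
      ∀ ψ ∈ [Comon.extensionality, Comon.strongResolvent, Comon.maximalComonotone,
          Comon.closedGraph],
        Comon.Proves Comon.U (φ.imp ψ)) ∧
    (∀ φ ∈ [Comon.extensionality, Comon.strongResolventStar, Comon.maximalComonotone,
          Comon.closedGraph],
      ∀ ψ ∈ [Comon.extensionality, Comon.strongResolventStar, Comon.maximalComonotone,
          Comon.closedGraph],
        Comon.Proves Comon.UStar (φ.imp ψ)) := by
  open Comon Comon.Model Comon.Scale in
  constructor
  -- The margin `2⁻ⁿ` in axiom (V) makes `ρ̃ + γ̃` strictly positive.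
  · have hρ : ∀ M : Model U, 0 < val (M.con .rho) + val (M.con .gam) := fun M => by
      have h := M.sat_ax (show axRho ∈ U by simp [U])
      simp [axRho] at h
      linarith [ι_tw_pos (M := M) (M.con .ngam)]
    refine proves_imp (by simp [U]) (by simp [U]) (by simp [U])
      (fun M γ => -val γ < val (M.con .rho)) (fun M => ?_) (fun M => ?_)
      (fun M => by linarith [hρ M]) hρ
    · simp [strongResolvent, StrongRes]
    · have h := M.sat_ax (show axRes ∈ U by simp [U])
      simp [axRes] at h
      -- The resolvent axiom of `U` holds for all positive `γ`; the side condition on `ρ̃` belongs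
      -- only to the strong form.
      exact fun γ x l _ hl => h γ x l hl
  · have hρ : ∀ M : Model UStar, -(ι M (tw 1) * val (M.con .gam)) < val (M.con .rho) := fun M => by
      have h := M.sat_ax (show axRhoStar ∈ UStar by simp [UStar])
      simp [axRhoStar, num] at h
      linarith [ι_tw_pos (M := M) (M.con .ngam)]
    refine proves_imp (by simp [UStar]) (by simp [UStar]) (by simp [UStar])
      (fun M γ => -(ι M (tw 1) * val γ) < val (M.con .rho)) (fun M => ?_) (fun M => ?_)
      hρ (fun M => ?_)
    · simp [strongResolventStar, StrongRes, num]
    · have h := M.sat_ax (show axResStar ∈ UStar by simp [UStar])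
      simp [axResStar, num] at h
      exact fun γ x l hP hl => h γ x l hP hl
    -- As `γ̃` is positive, `γ̃/2 ≤ γ̃`, so the stronger condition `ρ̃ > -γ̃/2` implies `ρ̃ + γ̃ >
    -- 0`.
    · have h1 := M.two_pow_lt_gam (show axGam ∈ UStar by simp [UStar])
      have h2 := ι_tw_pos (M := M) (M.con .mgam + 1)
      have h3 : ι M (tw 1) ≤ 1 := by rw [← map_one (ι M), ι_le]; exact tw_le_one 1
      have h4 := mul_le_mul_of_nonneg_right h3 (h2.trans h1).le
      linarith [hρ M]
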